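/- **Setting.** Let $m\ge 2$ and let $(M,\nabla)$ be an affine manifold of dimension $m$: a smooth (Hausdorff, second countable) $m$-manifold $M$ without boundary with a smooth torsion-free connection $\nabla$ on $TM$. Let $\rho(x,y)=\operatorname{Tr}\{z\mapsto R(z,x)y\}$ be the Ricci tensor, $R(x,y)=[\nabla_x,\nabla_y]-\nabla_{[x,y]}$, let $\rho_s$ be its symmetrization, and let $\mathcal H f=\nabla^2f$ be the Hessian. Put $\mu_m:=-\frac1{m-1}$. For $\mu\in\mathbb R$ let $E(\mu,\nabla)$ be the space of $f\in C^2(M)$ with $\mathcal Hf=\mu f\rho_s$, and for $P\in M$ let $E(P,\mu,\nabla)$ be the space of germs at $P$ of smooth functions satisfying this equation near $P$. Connections $\nabla,\tilde\nabla$ on an open set $U$ are *strongly projectively equivalent* if there is a closed smooth $1$-form $\theta$ on $U$ with $\nabla_XY=\tilde\nabla_XY+\theta(X)Y+\theta(Y)X$ for all vector fields $X,Y$. We say that $\nabla$ is *strongly projectively flat near $P$* if on some open neighbourhood of $P$ it is strongly projectively equivalent to a flat connection, and that $M$ is *strongly projectively flat* if this holds near every point. **Theorem 1.5.** 1. For every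 $P\in M$: $\nabla$ is strongly projectively flat near $P$ if and only if $\dim E(P,\mu_m,\nabla)=m+1$. If $M$ is simply connected (in particular connected), then $M$ is strongly projectively flat if and only if $\dim E(\mu_m,\nabla)=m+1$. 2. Let $\mu\in\mathbb R$. If $\dim E(P,\mu,\nabla)=m+1$, then $\nabla$ is strongly projectively flat near $P$. If $M$ is connected and $\dim E(\mu,\nabla)=m+1$, then $M$ is strongly projectively flat. 3. Let $\mu\ne\mu_m$. If $\dim E(P,\mu,\nabla)=m+1$, then $\rho=0$ on a neighbourhood of $P$. If $M$ is connected and $\dim E(\mu,\nabla)=m+1$, then $M$ is Ricci flat, i.e. $\rho=0$ on $M$. 4. Suppose $\dim E(P,\mu_m,\nabla)=m+1$. Then there is a basis $\{\phi_0,\dots,\phi_m\}$ of $E(P,\mu_m,\nabla)$ with $\phi_0(P)\neq0$ and $\phi_i(P)=0$ for $i>0$. For every such basis, the functions $z^i:=\phi_i/\phi_0$, $1\le i\le m$, form a system of smooth coordinates on some neighbourhood of $P$ in which the unparametrized geodesics of $\nabla$ are straight lines: a regular smooth curve in this coordinate neighbourhood, defined on an open interval, is a reparametrized geodesic if and only if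 its coordinate image lies in a straight line. -/

import Mathlib

open scoped Manifold ContDiff Topology

noncomputable section

namespace AffineGeometry

variable {m : ℕ} {M : Type*} [TopologicalSpace M]
  [ChartedSpace (EuclideanSpace ℝ (Fin m)) M] [IsManifold (𝓡 m) ∞ M]

/-! ### Curvature and the Hessian of a connection on the tangent bundle

Throughout, `cov Y x u` is the value at `x` of the covariant derivative of the field `Y` in the
direction `u`. -/

variable (m M) in
/-- The type of (not yet axiomatised) covariant differentiation operators on vector fields.
Used for connections that are only meaningful on an open subset; the laws are Mathlib's
`IsCovariantDerivativeOn` and `ContMDiffCovariantDerivativeOn`. -/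
abbrev FieldDerivation : Type _ :=
  ((x : M) → TangentSpace (𝓡 m) x) →
    ((x : M) → TangentSpace (𝓡 m) x →L[ℝ] TangentSpace (𝓡 m) x)

/-- The local vector field which extends `v ∈ T_x M` with constant coefficients in the
coordinates of the preferred chart at `x`; that is, `v = v^i ∂_i` is extended by `v^i ∂_i`.
It is smooth near `x`. -/
abbrev coordField {x : M} (v : TangentSpace (𝓡 m) x) (y : M) : TangentSpace (𝓡 m) y :=
  FiberBundle.extend (EuclideanSpace ℝ (Fin m)) v y

/-- The curvature operator on vector fields:
`R(X, Y) Z = ∇_X ∇_Y Z - ∇_Y ∇_X Z - ∇_{[X, Y]} Z`, evaluated at `x`. -/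
def curvatureOfFields (cov : FieldDerivation m M) (X Y Z : (x : M) → TangentSpace (𝓡 m) x)
    (x : M) : TangentSpace (𝓡 m) x :=
  cov (fun y => cov Z y (Y y)) x (X x) - cov (fun y => cov Z y (X y)) x (Y x)
    - cov Z x (VectorField.mlieBracket (𝓡 m) X Y x)

/-- The curvature tensor `R(u, v) w` at a point, computed on the coordinate fields through
`u`, `v`, `w` (by tensoriality the choice of smooth extension is irrelevant). -/
def curvature (cov : FieldDerivation m M) (x : M) (u v w : TangentSpace (𝓡 m) x) :
    TangentSpace (𝓡 m) x :=
  curvatureOfFields cov (coordField u) (coordField v) (coordField w) x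

/-- The coordinates of a tangent vector in the preferred chart at its base point. In Mathlib the
tangent space at `x` is `ℝ^m` itself, by means of that chart. -/
def tangentCoords {x : M} (v : TangentSpace (𝓡 m) x) : EuclideanSpace ℝ (Fin m) := v

/-- The tangent vector `∂_i` at `x`, for the preferred chart at `x`. -/
def tangentBasis (x : M) (i : Fin m) : TangentSpace (𝓡 m) x :=
  (EuclideanSpace.single i (1 : ℝ) : EuclideanSpace ℝ (Fin m))

/-- The Ricci tensor `ρ(u, v) = Tr (z ↦ R(z, u) v)`, the trace being taken in the basis `∂_i`
of `T_x M`. -/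
def ricci (cov : FieldDerivation m M) (x : M) (u v : TangentSpace (𝓡 m) x) : ℝ :=
  ∑ i : Fin m, tangentCoords (curvature cov x (tangentBasis x i) u v) i

/-- The symmetric Ricci tensor. -/
def ricciSymm (cov : FieldDerivation m M) (x : M) (u v : TangentSpace (𝓡 m) x) : ℝ :=
  (1 / 2) * (ricci cov x u v + ricci cov x v u)

/-- The Hessian `(∇² f)(u, v) = u (V f) - (∇_u V) f`, where `V` is the coordinate field
through `v`. -/
def hessian (cov : FieldDerivation m M) (f : M → ℝ) (x : M) (u v : TangentSpace (𝓡 m) x) : ℝ :=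
  mvfderiv (𝓡 m) (fun y => mvfderiv (𝓡 m) f y (coordField v y)) x u
    - mvfderiv (𝓡 m) f x (cov (coordField v) x u)

/-! ### The affine quasi-Einstein equation -/

/-- The equation `∇² f = μ f ρ_s` at the point `x`. -/
def SolvesAt (cov : FieldDerivation m M) (μ : ℝ) (f : M → ℝ) (x : M) : Prop :=
  ∀ u v : TangentSpace (𝓡 m) x, hessian cov f x u v = μ * f x * ricciSymm cov x u v

lemma two_le_infty : (2 : ℕ∞ω) ≤ ∞ := by
  exact ENat.LEInfty.out

set_option linter.unusedSectionVars false in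
lemma mvfderiv_congr {f g : M → ℝ} {x : M} (h : f =ᶠ[𝓝 x] g) (u : TangentSpace (𝓡 m) x) :
    mvfderiv (𝓡 m) f x u = mvfderiv (𝓡 m) g x u := by
  change (mfderiv (𝓡 m) 𝓘(ℝ, ℝ) f x u : ℝ) = (mfderiv (𝓡 m) 𝓘(ℝ, ℝ) g x u : ℝ)
  have := h.mfderiv_eq (I := 𝓡 m) (I' := 𝓘(ℝ, ℝ))
  exact congrArg (fun L : EuclideanSpace ℝ (Fin m) →L[ℝ] ℝ => L u) this

lemma mdifferentiableAt_mvfderiv_coordField {f : M → ℝ} {x : M}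
    (hf : ContMDiffAt (𝓡 m) 𝓘(ℝ, ℝ) 2 f x) (v : TangentSpace (𝓡 m) x) :
    MDifferentiableAt (𝓡 m) 𝓘(ℝ, ℝ) (fun y => mvfderiv (𝓡 m) f y (coordField v y)) x := by
  have h1 := (hf.mfderiv_const (m := 1) (by norm_num)).mdifferentiableAt one_ne_zero
  have h2 := FiberBundle.mdifferentiableAt_extend (𝓡 m) (EuclideanSpace ℝ (Fin m)) v
  have h3 := MDifferentiableAt.clm_apply_of_inCoordinates
    (E₁ := TangentSpace (𝓡 m)) (E₂ := TangentSpace 𝓘(ℝ, ℝ)) (b₁ := id) (b₂ := f)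
    h1 h2 (hf.mdifferentiableAt two_ne_zero)
  rw [mdifferentiableAt_totalSpace] at h3
  refine h3.2.congr_of_eventuallyEq (Filter.Eventually.of_forall fun y => ?_)
  simp [mvfderiv]
  rfl

lemma hessian_add (cov : FieldDerivation m M) {f g : M → ℝ} {x : M}
    (hf : ContMDiffAt (𝓡 m) 𝓘(ℝ, ℝ) 2 f x) (hg : ContMDiffAt (𝓡 m) 𝓘(ℝ, ℝ) 2 g x)
    (u v : TangentSpace (𝓡 m) x) :
    hessian cov (f + g) x u v = hessian cov f x u v + hessian cov g x u v := by
  have key : (fun y => mvfderiv (𝓡 m) (f + g) y (coordField v y)) =ᶠ[𝓝 x]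
      (fun y => mvfderiv (𝓡 m) f y (coordField v y)) +
        (fun y => mvfderiv (𝓡 m) g y (coordField v y)) := by
    filter_upwards [contMDiffAt_iff_contMDiffAt_nhds (by simp) |>.1 hf, contMDiffAt_iff_contMDiffAt_nhds (by simp) |>.1 hg] with y hy hy'
    rw [mvfderiv_add (hy.mdifferentiableAt two_ne_zero) (hy'.mdifferentiableAt two_ne_zero)]
    rfl
  have e1 : mvfderiv (𝓡 m) (fun y => mvfderiv (𝓡 m) (f + g) y (coordField v y)) x u =
      mvfderiv (𝓡 m) ((fun y => mvfderiv (𝓡 m) f y (coordField v y)) +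
        (fun y => mvfderiv (𝓡 m) g y (coordField v y))) x u := by
    exact mvfderiv_congr key u
  unfold hessian
  rw [e1, mvfderiv_add (mdifferentiableAt_mvfderiv_coordField hf v)
    (mdifferentiableAt_mvfderiv_coordField hg v),
    mvfderiv_add (hf.mdifferentiableAt two_ne_zero) (hg.mdifferentiableAt two_ne_zero)]
  simp only [add_apply]
  ring

lemma hessian_const_smul (cov : FieldDerivation m M) {f : M → ℝ} {x : M}
    (hf : ContMDiffAt (𝓡 m) 𝓘(ℝ, ℝ) 2 f x) (c : ℝ) (u v : TangentSpace (𝓡 m) x) :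
    hessian cov (c • f) x u v = c * hessian cov f x u v := by
  have hc : ∀ {h : M → ℝ} {y : M} (w : TangentSpace (𝓡 m) y),
      MDifferentiableAt (𝓡 m) 𝓘(ℝ, ℝ) h y →
      mvfderiv (𝓡 m) (c • h) y w = c * mvfderiv (𝓡 m) h y w := by
    intro h y w hh
    have := mvfderiv_smul (I := 𝓡 m) (a := fun _ : M => c) (g := h) mdifferentiableAt_const hh
    have e : (fun _ : M => c) • h = c • h := rfl
    rw [e] at this
    rw [this, mvfderiv_const]
    simp
  have key : (fun y => mvfderiv (𝓡 m) (c • f) y (coordField v y)) =ᶠ[𝓝 x]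
      c • (fun y => mvfderiv (𝓡 m) f y (coordField v y)) := by
    filter_upwards [contMDiffAt_iff_contMDiffAt_nhds (by simp) |>.1 hf] with y hy
    rw [hc _ (hy.mdifferentiableAt two_ne_zero)]
    rfl
  have e1 : mvfderiv (𝓡 m) (fun y => mvfderiv (𝓡 m) (c • f) y (coordField v y)) x u =
      mvfderiv (𝓡 m) (c • (fun y => mvfderiv (𝓡 m) f y (coordField v y))) x u := by
    exact mvfderiv_congr key u
  unfold hessian
  rw [e1, hc _ (mdifferentiableAt_mvfderiv_coordField hf v),
    hc _ (hf.mdifferentiableAt two_ne_zero)]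
  ring

lemma hessian_zero (cov : FieldDerivation m M) (x : M) (u v : TangentSpace (𝓡 m) x) :
    hessian cov (0 : M → ℝ) x u v = 0 := by
  have h := hessian_const_smul cov (f := (0 : M → ℝ)) (x := x) contMDiffAt_const 0 u v
  simpa using h

lemma SolvesAt.add {cov : FieldDerivation m M} {μ : ℝ} {f g : M → ℝ} {x : M}
    (hf : ContMDiffAt (𝓡 m) 𝓘(ℝ, ℝ) 2 f x) (hg : ContMDiffAt (𝓡 m) 𝓘(ℝ, ℝ) 2 g x)
    (sf : SolvesAt cov μ f x) (sg : SolvesAt cov μ g x) : SolvesAt cov μ (f + g) x := by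
  intro u v
  rw [hessian_add cov hf hg, sf u v, sg u v, Pi.add_apply]
  ring

lemma SolvesAt.const_smul {cov : FieldDerivation m M} {μ : ℝ} {f : M → ℝ} {x : M}
    (hf : ContMDiffAt (𝓡 m) 𝓘(ℝ, ℝ) 2 f x) (c : ℝ)
    (sf : SolvesAt cov μ f x) : SolvesAt cov μ (c • f) x := by
  intro u v
  rw [hessian_const_smul cov hf, sf u v, Pi.smul_apply, smul_eq_mul]
  ring

lemma SolvesAt.zero (cov : FieldDerivation m M) (μ : ℝ) (x : M) :
    SolvesAt cov μ (0 : M → ℝ) x := by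
  intro u v
  rw [hessian_zero]
  simp

/-- `E(μ, ∇)`: the space of all `C²` functions on `M` with `∇² f = μ f ρ_s`. -/
def solutionSpace (cov : FieldDerivation m M) (μ : ℝ) : Submodule ℝ (M → ℝ) where
  carrier := {f | ContMDiff (𝓡 m) 𝓘(ℝ, ℝ) 2 f ∧ ∀ x, SolvesAt cov μ f x}
  add_mem' := fun hf hg => ⟨hf.1.add hg.1, fun x => (hf.2 x).add (hf.1 x) (hg.1 x) (hg.2 x)⟩
  zero_mem' := ⟨contMDiff_const, SolvesAt.zero cov μ⟩
  smul_mem' := fun c _ hf =>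
    ⟨(contMDiff_const (c := c)).mul hf.1, fun x => (hf.2 x).const_smul (hf.1 x) c⟩

/-- `f` is smooth and solves `∇² f = μ f ρ_s` on a neighbourhood of `P`. -/
def SolvesNear (cov : FieldDerivation m M) (μ : ℝ) (f : M → ℝ) (P : M) : Prop :=
  ∀ᶠ x in 𝓝 P, ContMDiffAt (𝓡 m) 𝓘(ℝ, ℝ) ∞ f x ∧ SolvesAt cov μ f x

/-- `E(P, μ, ∇)`: the space of germs at `P` of smooth solutions of `∇² f = μ f ρ_s`. -/
def solutionGerms (cov : FieldDerivation m M) (P : M) (μ : ℝ) :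
    Submodule ℝ (Filter.Germ (𝓝 P) ℝ) where
  carrier := {φ | ∃ f : M → ℝ, SolvesNear cov μ f P ∧ (f : Filter.Germ (𝓝 P) ℝ) = φ}
  add_mem' := by
    rintro _ _ ⟨f, hf, rfl⟩ ⟨g, hg, rfl⟩
    refine ⟨f + g, ?_, rfl⟩
    filter_upwards [hf, hg] with x hx hy
    exact ⟨hx.1.add hy.1, hx.2.add (hx.1.of_le two_le_infty)
      (hy.1.of_le two_le_infty) hy.2⟩
  zero_mem' :=
    ⟨0, Filter.Eventually.of_forall fun x => ⟨contMDiffAt_const, SolvesAt.zero cov μ x⟩, rfl⟩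
  smul_mem' := by
    rintro c _ ⟨f, hf, rfl⟩
    refine ⟨c • f, ?_, rfl⟩
    filter_upwards [hf] with x hx
    exact ⟨(contMDiffAt_const (c := c)).mul hx.1, hx.2.const_smul (hx.1.of_le two_le_infty) c⟩

/-! ### Projective equivalence -/

/-- A vector field is smooth on the set `U`. -/
abbrev SmoothFieldOn (X : (x : M) → TangentSpace (𝓡 m) x) (U : Set M) : Prop :=
  ContMDiffOn (𝓡 m) (𝓡 m).tangent ∞
    (fun x => (⟨x, X x⟩ : TangentBundle (𝓡 m) M)) U

/-- A 1-form is smooth on the open set `U`: its values on smooth vector fields are smooth. -/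
def SmoothFormOn (θ : (x : M) → TangentSpace (𝓡 m) x →L[ℝ] ℝ) (U : Set M) : Prop :=
  ∀ X : (x : M) → TangentSpace (𝓡 m) x, SmoothFieldOn X U →
    ContMDiffOn (𝓡 m) 𝓘(ℝ, ℝ) ∞ (fun x => θ x (X x)) U

/-- A 1-form is closed on the open set `U`:
`dθ(X, Y) = X (θ(Y)) - Y (θ(X)) - θ([X, Y])` vanishes for all smooth fields `X`, `Y` on `U`. -/
def ClosedFormOn (θ : (x : M) → TangentSpace (𝓡 m) x →L[ℝ] ℝ) (U : Set M) : Prop :=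
  ∀ X Y : (x : M) → TangentSpace (𝓡 m) x, SmoothFieldOn X U → SmoothFieldOn Y U → ∀ x ∈ U,
    mvfderiv (𝓡 m) (fun y => θ y (Y y)) x (X x) - mvfderiv (𝓡 m) (fun y => θ y (X y)) x (Y x)
      - θ x (VectorField.mlieBracket (𝓡 m) X Y x) = 0

/-- `θ` provides a projective equivalence on `U` between the connections `cov` and `cov'`:
`∇_u Y = ∇'_u Y + θ(u) Y + θ(Y) u`. -/
def ProvidesProjectiveEquivalenceOn (θ : (x : M) → TangentSpace (𝓡 m) x →L[ℝ] ℝ)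
    (cov cov' : FieldDerivation m M) (U : Set M) : Prop :=
  ∀ Y : (x : M) → TangentSpace (𝓡 m) x, SmoothFieldOn Y U →
    ∀ x ∈ U, ∀ u : TangentSpace (𝓡 m) x,
      cov Y x u = cov' Y x u + θ x u • Y x + θ x (Y x) • u

/-- The connections `cov` and `cov'` are strongly projectively equivalent on the open set `U`. -/
def StronglyProjectivelyEquivalentOn (cov cov' : FieldDerivation m M) (U : Set M) : Prop :=
  ∃ θ : (x : M) → TangentSpace (𝓡 m) x →L[ℝ] ℝ, SmoothFormOn θ U ∧ ClosedFormOn θ U ∧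
    ProvidesProjectiveEquivalenceOn θ cov cov' U

/-- `cov` is a smooth flat connection on the open set `U`. -/
structure IsFlatConnectionOn (cov : FieldDerivation m M) (U : Set M) : Prop where
  isCovariantDerivativeOn : IsCovariantDerivativeOn (EuclideanSpace ℝ (Fin m)) cov U
  smooth : ContMDiffCovariantDerivativeOn (EuclideanSpace ℝ (Fin m)) ∞ cov U
  curvature_eq_zero : ∀ x ∈ U, ∀ u v w : TangentSpace (𝓡 m) x, curvature cov x u v w = 0

/-- `cov` is strongly projectively flat near `P`: on some open neighbourhood of `P` it is strongly
projectively equivalent to a flat connection. -/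
def StronglyProjectivelyFlatAt (cov : FieldDerivation m M) (P : M) : Prop :=
  ∃ U : Set M, IsOpen U ∧ P ∈ U ∧ ∃ cov' : FieldDerivation m M,
    IsFlatConnectionOn cov' U ∧ StronglyProjectivelyEquivalentOn cov cov' U

/-- `cov` is strongly projectively flat: it is so near every point. -/
def StronglyProjectivelyFlat (cov : FieldDerivation m M) : Prop :=
  ∀ P : M, StronglyProjectivelyFlatAt cov P

/-- The Ricci tensor vanishes identically. -/
def RicciFlat (cov : FieldDerivation m M) : Prop :=
  ∀ (x : M) (u v : TangentSpace (𝓡 m) x), ricci cov x u v = 0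

/-! ### Geodesics -/

/-- The velocity of a curve. -/
def velocity (γ : ℝ → M) (t : ℝ) : TangentSpace (𝓡 m) (γ t) :=
  mfderiv 𝓘(ℝ, ℝ) (𝓡 m) γ t (1 : ℝ)

/-- The covariant acceleration `∇_{γ'} γ'`. In the coordinates of the preferred chart at `γ t`
it is `x''^k + Γ_{ij}^k x'^i x'^j`: the covariant derivative at `γ t` of the coordinate field
through `γ' t`, in the direction of `γ' t`, is `Γ_{ij}^k x'^i x'^j ∂_k`. -/
def acceleration (cov : FieldDerivation m M) (γ : ℝ → M) (t : ℝ) : EuclideanSpace ℝ (Fin m) :=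
  deriv (deriv (fun s => extChartAt (𝓡 m) (γ t) (γ s))) t
    + tangentCoords (cov (coordField (velocity (m := m) γ t)) (γ t) (velocity (m := m) γ t))

/-- `γ` is a geodesic on the open interval `J`: it is smooth with `∇_{γ'} γ' = 0`. -/
def IsGeodesicOn (cov : FieldDerivation m M) (γ : ℝ → M) (J : Set ℝ) : Prop :=
  ContMDiffOn 𝓘(ℝ, ℝ) (𝓡 m) ∞ γ J ∧ ∀ t ∈ J, acceleration cov γ t = 0

variable (m) in
/-- `c` is a smooth curve with nowhere vanishing velocity on `J`. -/
def IsRegularCurveOn (c : ℝ → M) (J : Set ℝ) : Prop :=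
  ContMDiffOn 𝓘(ℝ, ℝ) (𝓡 m) ∞ c J ∧ ∀ t ∈ J, velocity (m := m) c t ≠ 0

/-- `c` is an unparametrized geodesic on the open interval `J`: after a smooth regular change
`τ : J' → J` of the parameter it becomes a geodesic. -/
def IsUnparametrizedGeodesicOn (cov : FieldDerivation m M) (c : ℝ → M) (J : Set ℝ) : Prop :=
  ∃ (J' : Set ℝ) (τ : ℝ → ℝ), IsOpen J' ∧ J'.OrdConnected ∧ ContDiffOn ℝ ∞ τ J' ∧
    (∀ s ∈ J', deriv τ s ≠ 0) ∧ τ '' J' = J ∧ IsGeodesicOn cov (c ∘ τ) J'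

/-- The set `S ⊆ ℝ^m` is contained in a straight line. -/
def IsInLine (S : Set (EuclideanSpace ℝ (Fin m))) : Prop :=
  ∃ p v : EuclideanSpace ℝ (Fin m), v ≠ 0 ∧ ∀ y ∈ S, ∃ s : ℝ, y = p + s • v

/-- In the coordinates `z` the unparametrized geodesics of `cov` are precisely the (segments of)
straight lines. -/
def GeodesicsAreStraightLines (cov : FieldDerivation m M)
    (z : OpenPartialHomeomorph M (EuclideanSpace ℝ (Fin m))) : Prop :=
  ∀ (J : Set ℝ) (c : ℝ → M), IsOpen J → J.OrdConnected → IsRegularCurveOn m c J →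
    Set.MapsTo c J z.source →
    (IsUnparametrizedGeodesicOn cov c J ↔ IsInLine (z '' (c '' J)))

/-- `φ_0, …, φ_m` are germs at `P` with `φ_0(P) ≠ 0` and `φ_i(P) = 0` for `i > 0`. -/
def IsNormalizedAt {P : M} (φ : Fin (m + 1) → Filter.Germ (𝓝 P) ℝ) : Prop :=
  (φ 0).value ≠ 0 ∧ ∀ i : Fin m, (φ i.succ).value = 0

/-- The germs `φ_i / φ_0`, `1 ≤ i ≤ m`, are the germs at `P` of the coordinate functions of the
chart `z` about `P`. -/
def IsRatioChart {P : M} (φ : Fin (m + 1) → Filter.Germ (𝓝 P) ℝ)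
    (z : OpenPartialHomeomorph M (EuclideanSpace ℝ (Fin m))) : Prop :=
  z ∈ IsManifold.maximalAtlas (𝓡 m) ∞ M ∧ P ∈ z.source ∧
    ∀ i : Fin m, ((fun q => z q i : M → ℝ) : Filter.Germ (𝓝 P) ℝ) = φ i.succ / φ 0

end AffineGeometry

end

noncomputable section

namespace AffineGeometry

set_option linter.unusedSectionVars false
set_option maxSynthPendingDepth 3

section

variable {m : ℕ} {M : Type*} [TopologicalSpace M]
  [ChartedSpace (EuclideanSpace ℝ (Fin m)) M] [IsManifold (𝓡 m) ∞ M]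

/-! ### Tensors in a fixed chart -/

/-! The equation `∇²f = μ f ρ_s` expresses all second derivatives of `f` through `f` and `df`, so
the 1-jet of a solution satisfies a closed linear first-order system. A germ of a solution is
therefore determined by its 1-jet at `P`. Hence `dim E(P, μ, ∇) ≤ m + 1`, with equality exactly when
every 1-jet occurs (`jet_surjective_iff`).

The link with projective geometry is `IsProjectivelyAffineAt`: a nonvanishing `φ` and an immersion
`h` into `ℝ^m` whose Hessian vanishes for the connection obtained from `∇` by the projective change
with `θ = d log φ`. The changed connection is then flat
(`localCurvature_eq_zero_of_projectivelyAffine`), and all functions `φ (c + l ∘ h)` solve `∇²f = f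
S` with the single tensor `S = φ⁻¹ ∇²φ`. The Ricci identity for those that vanish at a point gives
`R(w, u) v = S(w, v) u - S(u, v) w`, and the trace gives `ρ = (1 - m) S`.

If the space of germs is full, a normalized basis supplies such a pair, with `φ = φ_0`, `h = (φ_i /
φ_0)` and `S = μ ρ_s` (`eventually_isProjectivelyAffineAt`). This yields strong projective flatness
for every `μ`. It also gives `ρ = (1 - m) μ ρ_s`; symmetrizing, `ρ_s`, and then `ρ`, vanishes unless
`μ = -1 / (m - 1)`.

Conversely, let `∇` differ from a flat connection by the projective change with a closed `θ`. The
Frobenius theorem `exists_solution_of_integrable` gives both `φ` with `θ = d log φ` and affine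
coordinates `h` of the flat connection. Since `∇` is torsion-free, `S` is symmetric, so `S = -ρ_s /
(m - 1)`, and the functions `φ (c + l ∘ h)` realize every 1-jet.

On a connected manifold, unique continuation embeds global solutions into germs. If all germ spaces
are full, the local solutions form a local system, which has no monodromy on a simply connected
manifold (`exists_global_section`).

For geodesics, the derivative of `φ² (h ∘ γ)'` is `φ² dh(∇_{γ'} γ')`. So along a geodesic `(h ∘ γ)'`
has a fixed direction, and a curve in a line becomes a geodesic once it is parametrized so that `φ²
(h ∘ γ)'` is constant. -/

/-- The coordinates at `y` of a tangent vector in the preferred chart at `P`. -/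
def coordVec (P y : M) : TangentSpace (𝓡 m) y →L[ℝ] EuclideanSpace ℝ (Fin m) :=
  (trivializationAt (EuclideanSpace ℝ (Fin m)) (TangentSpace (𝓡 m)) P).continuousLinearMapAt ℝ y

/-- The tangent vector at `y` with given coordinates in the preferred chart at `P`. -/
def frameVec (P y : M) : EuclideanSpace ℝ (Fin m) →L[ℝ] TangentSpace (𝓡 m) y :=
  (trivializationAt (EuclideanSpace ℝ (Fin m)) (TangentSpace (𝓡 m)) P).symmL ℝ y

/-- The field with constant coordinates `v` in the preferred chart at `P`. -/
def frameField (P : M) (v : EuclideanSpace ℝ (Fin m)) (y : M) : TangentSpace (𝓡 m) y :=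
  frameVec P y v

/-- A vector field in the preferred chart at `P`. -/
def coordRep (P : M) (σ : (x : M) → TangentSpace (𝓡 m) x) (x : EuclideanSpace ℝ (Fin m)) :
    EuclideanSpace ℝ (Fin m) :=
  coordVec P ((extChartAt (𝓡 m) P).symm x) (σ ((extChartAt (𝓡 m) P).symm x))

variable {P y : M}

lemma coordVec_frameVec (hy : y ∈ (chartAt (EuclideanSpace ℝ (Fin m)) P).source)
    (v : EuclideanSpace ℝ (Fin m)) : coordVec P y (frameVec P y v) = v :=
  Bundle.Trivialization.continuousLinearMapAt_symmL _ hy v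

lemma frameVec_coordVec (hy : y ∈ (chartAt (EuclideanSpace ℝ (Fin m)) P).source)
    (v : TangentSpace (𝓡 m) y) : frameVec P y (coordVec P y v) = v :=
  Bundle.Trivialization.symmL_continuousLinearMapAt _ hy v

/-- The tangent space at `P` is modelled by the preferred chart at `P`, whose derivative there is
the identity. -/
lemma coordVec_self (v : TangentSpace (𝓡 m) P) : coordVec P P v = v := by
  unfold coordVec
  rw [TangentBundle.continuousLinearMapAt_trivializationAt (by simp)]
  exact congrArg (fun L : EuclideanSpace ℝ (Fin m) →L[ℝ] EuclideanSpace ℝ (Fin m) => L v)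
    (mfderiv_extChartAt_self (I := 𝓡 m) (x := P))

lemma coordField_eq_frameField (v : TangentSpace (𝓡 m) P)
    (hy : y ∈ (chartAt (EuclideanSpace ℝ (Fin m)) P).source) :
    coordField v y = frameField P (tangentCoords v) y := by
  have h := coordVec_self v
  unfold coordVec at h
  rw [Bundle.Trivialization.continuousLinearMapAt_apply,
    Bundle.Trivialization.linearMapAt_apply] at h
  rw [if_pos (FiberBundle.mem_baseSet_trivializationAt' P)] at h
  change (trivializationAt (EuclideanSpace ℝ (Fin m)) (TangentSpace (𝓡 m)) P).symm y _ = _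
  rw [h]
  exact (Bundle.Trivialization.symmL_apply _ hy _).symm

lemma contMDiffAt_iff_coord {F : Type*} [NormedAddCommGroup F] [NormedSpace ℝ F] {n : ℕ∞ω}
    (hn : n ≤ ∞)
    (hy : y ∈ (chartAt (EuclideanSpace ℝ (Fin m)) P).source) {g : M → F} :
    ContMDiffAt (𝓡 m) 𝓘(ℝ, F) n g y ↔
      ContDiffAt ℝ n (g ∘ (extChartAt (𝓡 m) P).symm) (extChartAt (𝓡 m) P y) := by
  have : IsManifold (𝓡 m) n M := .of_le hn
  rw [contMDiffAt_iff_source_of_mem_source hy]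
  simp [contMDiffWithinAt_iff_contDiffWithinAt, contDiffWithinAt_univ]

lemma mvfderiv_eq_coord {F : Type*} [NormedAddCommGroup F] [NormedSpace ℝ F]
    (hy : y ∈ (chartAt (EuclideanSpace ℝ (Fin m)) P).source) {g : M → F}
    (hg : MDifferentiableAt (𝓡 m) 𝓘(ℝ, F) g y) (w : TangentSpace (𝓡 m) y) :
    mvfderiv (𝓡 m) g y w =
      fderiv ℝ (g ∘ (extChartAt (𝓡 m) P).symm) (extChartAt (𝓡 m) P y) (coordVec P y w) := by
  have hy' : y ∈ (extChartAt (𝓡 m) P).source := by rwa [extChartAt_source]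
  have h1 : MDifferentiableAt 𝓘(ℝ, EuclideanSpace ℝ (Fin m)) 𝓘(ℝ, F)
      (g ∘ (extChartAt (𝓡 m) P).symm) (extChartAt (𝓡 m) P y) := by
    have := (mdifferentiableAt_iff_source_of_mem_source hy).1 hg
    simpa [mdifferentiableWithinAt_univ] using this
  have h2 : MDifferentiableAt (𝓡 m) 𝓘(ℝ, EuclideanSpace ℝ (Fin m)) (extChartAt (𝓡 m) P) y :=
    mdifferentiableAt_extChartAt hy
  have h3 := mfderiv_comp y h1 h2
  have h4 : (g ∘ (extChartAt (𝓡 m) P).symm) ∘ extChartAt (𝓡 m) P =ᶠ[𝓝 y] g := by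
    filter_upwards [extChartAt_source_mem_nhds' hy'] with z hz
    exact congrArg g ((extChartAt (𝓡 m) P).left_inv hz)
  rw [h4.mfderiv_eq, mfderiv_eq_fderiv] at h3
  unfold mvfderiv coordVec
  rw [TangentBundle.continuousLinearMapAt_trivializationAt hy]
  exact congrArg (fun L : EuclideanSpace ℝ (Fin m) →L[ℝ] F => L w) h3

lemma contDiffAt_coordRep {n : ℕ∞ω} (hn : n ≤ ∞)
    (hy : y ∈ (chartAt (EuclideanSpace ℝ (Fin m)) P).source)
    {σ : (x : M) → TangentSpace (𝓡 m) x} :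
    ContMDiffAt (𝓡 m) (𝓡 m).tangent n
      (fun x => (⟨x, σ x⟩ : TangentBundle (𝓡 m) M)) y ↔
    ContDiffAt ℝ n (coordRep P σ) (extChartAt (𝓡 m) P y) := by
  have hy' : y ∈ (extChartAt (𝓡 m) P).source := by rwa [extChartAt_source]
  have : IsManifold (𝓡 m) (n + 1) M := .of_le (n := ∞) (by
    simpa using add_le_add_left hn (1 : ℕ∞ω))
  have := TangentBundle.contMDiffVectorBundle (n := n) (I := 𝓡 m) (M := M)
  rw [Bundle.Trivialization.contMDiffAt_section_iff
    (trivializationAt (EuclideanSpace ℝ (Fin m)) (TangentSpace (𝓡 m)) P) hy,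
    contMDiffAt_iff_coord hn hy]
  have key : ((fun x => ((trivializationAt (EuclideanSpace ℝ (Fin m)) (TangentSpace (𝓡 m)) P)
      ⟨x, σ x⟩).2) ∘ (extChartAt (𝓡 m) P).symm) =ᶠ[𝓝 (extChartAt (𝓡 m) P y)] coordRep P σ := by
    filter_upwards [extChartAt_target_mem_nhds' ((extChartAt (𝓡 m) P).map_source hy')] with x hx
    have hx' := (extChartAt (𝓡 m) P).map_target hx
    rw [extChartAt_source] at hx'
    simp only [Function.comp, coordRep, coordVec]
    rw [Bundle.Trivialization.continuousLinearMapAt_apply,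
      Bundle.Trivialization.linearMapAt_apply]
    exact (if_pos hx').symm
  exact ⟨fun h => h.congr_of_eventuallyEq key.symm, fun h => h.congr_of_eventuallyEq key⟩

end

/-! ### Christoffel symbols and the covariant derivative in a chart -/

section

variable {m : ℕ} {M : Type*} [TopologicalSpace M]
  [ChartedSpace (EuclideanSpace ℝ (Fin m)) M] [IsManifold (𝓡 m) ∞ M]

variable {P y : M}

lemma mdifferentiableAt_iff_coord {F : Type*} [NormedAddCommGroup F] [NormedSpace ℝ F]
    (hy : y ∈ (chartAt (EuclideanSpace ℝ (Fin m)) P).source) {g : M → F} :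
    MDifferentiableAt (𝓡 m) 𝓘(ℝ, F) g y ↔
      DifferentiableAt ℝ (g ∘ (extChartAt (𝓡 m) P).symm) (extChartAt (𝓡 m) P y) := by
  rw [mdifferentiableAt_iff_source_of_mem_source hy]
  simp [mdifferentiableWithinAt_univ, mdifferentiableAt_iff_differentiableAt]

lemma mem_extChartAt_source (hy : y ∈ (chartAt (EuclideanSpace ℝ (Fin m)) P).source) :
    y ∈ (extChartAt (𝓡 m) P).source := by
  rwa [extChartAt_source]

lemma symm_extChartAt (hy : y ∈ (chartAt (EuclideanSpace ℝ (Fin m)) P).source) :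
    (extChartAt (𝓡 m) P).symm (extChartAt (𝓡 m) P y) = y :=
  (extChartAt (𝓡 m) P).left_inv (mem_extChartAt_source hy)

lemma symm_mem_source {x : EuclideanSpace ℝ (Fin m)} (hx : x ∈ (extChartAt (𝓡 m) P).target) :
    (extChartAt (𝓡 m) P).symm x ∈ (chartAt (EuclideanSpace ℝ (Fin m)) P).source := by
  have := (extChartAt (𝓡 m) P).map_target hx
  rwa [extChartAt_source] at this

lemma extChartAt_target_mem (hy : y ∈ (chartAt (EuclideanSpace ℝ (Fin m)) P).source) :
    (extChartAt (𝓡 m) P).target ∈ 𝓝 (extChartAt (𝓡 m) P y) :=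
  extChartAt_target_mem_nhds' ((extChartAt (𝓡 m) P).map_source (mem_extChartAt_source hy))

lemma eventually_coord_iff (hy : y ∈ (chartAt (EuclideanSpace ℝ (Fin m)) P).source)
    {p : M → Prop} :
    (∀ᶠ x in 𝓝 (extChartAt (𝓡 m) P y), p ((extChartAt (𝓡 m) P).symm x)) ↔ ∀ᶠ z in 𝓝 y, p z := by
  constructor
  · intro h
    filter_upwards [(continuousAt_extChartAt' (mem_extChartAt_source hy)).eventually h,
      (chartAt (EuclideanSpace ℝ (Fin m)) P).open_source.mem_nhds hy] with z hz hz'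
    rwa [symm_extChartAt hz'] at hz
  · intro h
    refine (continuousAt_extChartAt_symm' (mem_extChartAt_source hy)).eventually ?_
    rwa [symm_extChartAt hy]

lemma coordRep_apply (hy : y ∈ (chartAt (EuclideanSpace ℝ (Fin m)) P).source)
    (σ : (x : M) → TangentSpace (𝓡 m) x) :
    coordRep P σ (extChartAt (𝓡 m) P y) = coordVec P y (σ y) := by
  unfold coordRep
  rw [symm_extChartAt hy]

lemma coordRep_congr (hy : y ∈ (chartAt (EuclideanSpace ℝ (Fin m)) P).source)
    {σ τ : (x : M) → TangentSpace (𝓡 m) x} (h : ∀ᶠ z in 𝓝 y, σ z = τ z) :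
    coordRep P σ =ᶠ[𝓝 (extChartAt (𝓡 m) P y)] coordRep P τ := by
  filter_upwards [(eventually_coord_iff hy).2 h] with x hx
  simp only [coordRep, hx]

lemma coordRep_frameField (hy : y ∈ (chartAt (EuclideanSpace ℝ (Fin m)) P).source)
    (v : EuclideanSpace ℝ (Fin m)) :
    coordRep P (frameField P v) =ᶠ[𝓝 (extChartAt (𝓡 m) P y)] fun _ => v := by
  filter_upwards [extChartAt_target_mem hy] with x hx
  exact coordVec_frameVec (symm_mem_source hx) v

lemma differentiableAt_coordRep (hy : y ∈ (chartAt (EuclideanSpace ℝ (Fin m)) P).source)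
    {σ : (x : M) → TangentSpace (𝓡 m) x}
    (hσ : MDifferentiableAt (𝓡 m) (𝓡 m).tangent
      (fun x => (⟨x, σ x⟩ : TangentBundle (𝓡 m) M)) y) :
    DifferentiableAt ℝ (coordRep P σ) (extChartAt (𝓡 m) P y) := by
  rw [Bundle.Trivialization.mdifferentiableAt_section_iff (𝓡 m)
    (trivializationAt (EuclideanSpace ℝ (Fin m)) (TangentSpace (𝓡 m)) P) σ hy,
    mdifferentiableAt_iff_coord hy] at hσ
  refine hσ.congr_of_eventuallyEq ?_
  filter_upwards [extChartAt_target_mem hy] with x hx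
  simp only [Function.comp, coordRep, coordVec]
  rw [Bundle.Trivialization.continuousLinearMapAt_apply,
    Bundle.Trivialization.linearMapAt_apply]
  exact if_pos (symm_mem_source hx)

lemma contMDiffAt_frameField (hy : y ∈ (chartAt (EuclideanSpace ℝ (Fin m)) P).source)
    (v : EuclideanSpace ℝ (Fin m)) :
    ContMDiffAt (𝓡 m) (𝓡 m).tangent ∞
      (fun x => (⟨x, frameField P v x⟩ : TangentBundle (𝓡 m) M)) y :=
  (contDiffAt_coordRep le_rfl hy).2
    (contDiffAt_const.congr_of_eventuallyEq (coordRep_frameField hy v))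

lemma mdifferentiableAt_frameField (hy : y ∈ (chartAt (EuclideanSpace ℝ (Fin m)) P).source)
    (v : EuclideanSpace ℝ (Fin m)) :
    MDifferentiableAt (𝓡 m) (𝓡 m).tangent
      (fun x => (⟨x, frameField P v x⟩ : TangentBundle (𝓡 m) M)) y :=
  (contMDiffAt_frameField hy v).mdifferentiableAt (by simp)

/-- The Christoffel symbols of a connection in the preferred chart at `P`. The first vector is
the field, the second one is the direction in which it is differentiated. -/
def christoffel (cov : FieldDerivation m M) (P : M) (x : EuclideanSpace ℝ (Fin m)) :
    EuclideanSpace ℝ (Fin m) →L[ℝ] EuclideanSpace ℝ (Fin m) →L[ℝ] EuclideanSpace ℝ (Fin m) :=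
  ∑ j : Fin m, (EuclideanSpace.proj j : EuclideanSpace ℝ (Fin m) →L[ℝ] ℝ).smulRight
    (coordVec P ((extChartAt (𝓡 m) P).symm x) ∘L
      cov (frameField P (EuclideanSpace.single j 1)) ((extChartAt (𝓡 m) P).symm x) ∘L
        frameVec P ((extChartAt (𝓡 m) P).symm x))

/-- In `∇_w σ` minus the derivative of the components of `σ` the Leibniz terms cancel, so the
difference is tensorial in `σ`. It may be evaluated on the combination of frame fields with
coefficients frozen at `y`, which is what the Christoffel symbols record. -/
lemma coordVec_cov {cov : FieldDerivation m M} {U : Set M}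
    (hcov : IsCovariantDerivativeOn (EuclideanSpace ℝ (Fin m)) cov U)
    (hy : y ∈ (chartAt (EuclideanSpace ℝ (Fin m)) P).source) (hyU : y ∈ U)
    {σ : (x : M) → TangentSpace (𝓡 m) x}
    (hσ : MDifferentiableAt (𝓡 m) (𝓡 m).tangent
      (fun x => (⟨x, σ x⟩ : TangentBundle (𝓡 m) M)) y) (w : TangentSpace (𝓡 m) y) :
    coordVec P y (cov σ y w) =
      fderiv ℝ (coordRep P σ) (extChartAt (𝓡 m) P y) (coordVec P y w) +
        christoffel cov P (extChartAt (𝓡 m) P y) (coordVec P y (σ y)) (coordVec P y w) := by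
  set x := extChartAt (𝓡 m) P y with hx
  let Φ : ((x : M) → TangentSpace (𝓡 m) x) → EuclideanSpace ℝ (Fin m) := fun τ =>
    coordVec P y (cov τ y w) - fderiv ℝ (coordRep P τ) x (coordVec P y w)
  have hΦ : TensorialAt (𝓡 m) (EuclideanSpace ℝ (Fin m)) Φ y := by
    constructor
    · intro f τ hf hτ
      have h1 : coordRep P (f • τ) = (f ∘ (extChartAt (𝓡 m) P).symm) • coordRep P τ := by
        ext1 z
        exact map_smul (coordVec P _) _ _
      have h2 := (mdifferentiableAt_iff_coord hy).1 hf
      have h3 := differentiableAt_coordRep hy hτ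
      have h4 := mvfderiv_eq_coord hy hf w
      simp only [Φ, hcov.leibniz hτ hf hyU]
      rw [h1, fderiv_smul h2 h3]
      simp only [add_apply, smul_apply,
        ContinuousLinearMap.smulRight_apply, map_add, map_smul, h4]
      simp only [Function.comp, hx, symm_extChartAt hy, coordRep_apply hy, smul_sub]
      abel
    · intro τ τ' hτ hτ'
      have h1 : coordRep P (τ + τ') = coordRep P τ + coordRep P τ' := by
        ext1 z
        exact map_add (coordVec P _) _ _
      simp only [Φ, hcov.add hτ hτ' hyU]
      rw [h1, fderiv_add (differentiableAt_coordRep hy hτ) (differentiableAt_coordRep hy hτ')]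
      simp only [add_apply, map_add]
      abel
  set v := coordVec P y (σ y) with hv
  have h5 : ∀ j : Fin m, MDifferentiableAt (𝓡 m) (𝓡 m).tangent
      (fun x => (⟨x, ((fun _ => v j : M → ℝ) • frameField P (EuclideanSpace.single j 1)) x⟩ :
        TangentBundle (𝓡 m) M)) y := fun j =>
    mdifferentiableAt_const.smul_section (mdifferentiableAt_frameField hy _)
  have h6 : Φ σ = ∑ j : Fin m, v j • Φ (frameField P (EuclideanSpace.single j 1)) := by
    have e1 : Φ σ = Φ (fun z => ∑ j : Fin m,
        ((fun _ => v j : M → ℝ) • frameField P (EuclideanSpace.single j 1)) z) := by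
      refine hΦ.pointwise hσ (MDifferentiableAt.sum_section fun j _ => h5 j) ?_
      have : σ y = frameVec P y v := (frameVec_coordVec hy _).symm
      rw [this]
      conv_lhs => rw [← (EuclideanSpace.basisFun (Fin m) ℝ).sum_repr v]
      simp [frameField]
    rw [e1, hΦ.sum _ (fun j _ => h5 j)]
    refine Finset.sum_congr rfl fun j _ => ?_
    exact hΦ.smul mdifferentiableAt_const (mdifferentiableAt_frameField hy _)
  have h7 : ∀ j : Fin m, Φ (frameField P (EuclideanSpace.single j 1)) =
      coordVec P y (cov (frameField P (EuclideanSpace.single j 1)) y w) := by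
    intro j
    simp only [Φ]
    rw [(coordRep_frameField hy _).fderiv_eq]
    simp
  have h8 : christoffel cov P x v (coordVec P y w) = Φ σ := by
    rw [h6]
    simp only [christoffel, h7]
    rw [hx, symm_extChartAt hy]
    simp only [sum_apply, ContinuousLinearMap.smulRight_apply, smul_apply,
      ContinuousLinearMap.comp_apply, frameVec_coordVec hy]
    rfl
  rw [h8]
  simp [Φ]

end

/-! ### Smoothness of Christoffel symbols and covariant derivatives -/

section

variable {m : ℕ} {M : Type*} [TopologicalSpace M]
  [ChartedSpace (EuclideanSpace ℝ (Fin m)) M] [IsManifold (𝓡 m) ∞ M]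

variable {P y : M}

/-- A field of endomorphisms of the tangent bundle in the preferred chart at `P`. -/
def endRep (P : M) (A : (x : M) → TangentSpace (𝓡 m) x →L[ℝ] TangentSpace (𝓡 m) x)
    (x : EuclideanSpace ℝ (Fin m)) :
    EuclideanSpace ℝ (Fin m) →L[ℝ] EuclideanSpace ℝ (Fin m) :=
  coordVec P ((extChartAt (𝓡 m) P).symm x) ∘L A ((extChartAt (𝓡 m) P).symm x) ∘L
    frameVec P ((extChartAt (𝓡 m) P).symm x)

/-- The trivialization of the endomorphism bundle at `P` is conjugation by that of the tangent
bundle, so `endRep` is its fibre component by definition. -/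
lemma contMDiffAt_end_iff_coord (hy : y ∈ (chartAt (EuclideanSpace ℝ (Fin m)) P).source)
    {A : (x : M) → TangentSpace (𝓡 m) x →L[ℝ] TangentSpace (𝓡 m) x} :
    ContMDiffAt (𝓡 m)
      ((𝓡 m).prod 𝓘(ℝ, EuclideanSpace ℝ (Fin m) →L[ℝ] EuclideanSpace ℝ (Fin m))) ∞
      (fun x => (⟨x, A x⟩ : Bundle.TotalSpace
        (EuclideanSpace ℝ (Fin m) →L[ℝ] EuclideanSpace ℝ (Fin m))
        fun x : M => TangentSpace (𝓡 m) x →L[ℝ] TangentSpace (𝓡 m) x)) y ↔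
    ContDiffAt ℝ ∞ (endRep P A) (extChartAt (𝓡 m) P y) := by
  have hb : y ∈ (trivializationAt (EuclideanSpace ℝ (Fin m) →L[ℝ] EuclideanSpace ℝ (Fin m))
      (fun x : M => TangentSpace (𝓡 m) x →L[ℝ] TangentSpace (𝓡 m) x) P).baseSet := ⟨hy, hy⟩
  rw [Bundle.Trivialization.contMDiffAt_section_iff _ hb, contMDiffAt_iff_coord le_rfl hy]
  rfl

/-- Multiplication by a bump function supported in `U`; on a Hausdorff manifold it is globally
smooth. Conditions that are tested only on fields smooth on a whole open set thereby apply to local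
fields. -/
lemma exists_smooth_extension [T2Space M] {U : Set M} (hU : IsOpen U) (hy : y ∈ U)
    {σ : (x : M) → TangentSpace (𝓡 m) x} (hσ : SmoothFieldOn σ U) :
    ∃ τ : (x : M) → TangentSpace (𝓡 m) x, SmoothFieldOn τ Set.univ ∧ ∀ᶠ z in 𝓝 y, τ z = σ z := by
  obtain ⟨f, -, hf⟩ := (SmoothBumpFunction.nhds_basis_tsupport (I := 𝓡 m) y).mem_iff.1
    (hU.mem_nhds hy)
  refine ⟨(f : M → ℝ) • σ, ?_, ?_⟩
  · exact (ContMDiffOn.smul_section_of_tsupport f.contMDiff.contMDiffOn hU hf hσ).contMDiffOn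
  · filter_upwards [f.eventuallyEq_one] with z hz
    simp [hz]

lemma exists_smooth_extension_frameField [T2Space M]
    (hy : y ∈ (chartAt (EuclideanSpace ℝ (Fin m)) P).source) (v : EuclideanSpace ℝ (Fin m)) :
    ∃ τ : (x : M) → TangentSpace (𝓡 m) x, SmoothFieldOn τ Set.univ ∧
      ∀ᶠ z in 𝓝 y, τ z = frameField P v z :=
  exists_smooth_extension (chartAt (EuclideanSpace ℝ (Fin m)) P).open_source hy
    fun _ hz => (contMDiffAt_frameField hz v).contMDiffWithinAt

lemma mdifferentiableAt_of_smoothFieldOn {U : Set M} (hU : U ∈ 𝓝 y)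
    {σ : (x : M) → TangentSpace (𝓡 m) x} (hσ : SmoothFieldOn σ U) :
    MDifferentiableAt (𝓡 m) (𝓡 m).tangent
      (fun x => (⟨x, σ x⟩ : TangentBundle (𝓡 m) M)) y :=
  (hσ.contMDiffAt hU).mdifferentiableAt (by simp)

/-- Smoothness of the connection on `U` only speaks of fields smooth on all of `U`. A field given
near `y` is replaced by a global one with the same germ, and `∇` depends only on germs. -/
lemma contMDiffAt_cov [T2Space M] {cov : FieldDerivation m M} {U : Set M} (hU : IsOpen U)
    (hcov : IsCovariantDerivativeOn (EuclideanSpace ℝ (Fin m)) cov U)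
    (hsm : ContMDiffCovariantDerivativeOn (EuclideanSpace ℝ (Fin m)) ∞ cov U)
    (hyU : y ∈ U) {V : Set M} (hV : IsOpen V) (hyV : y ∈ V)
    {σ : (x : M) → TangentSpace (𝓡 m) x} (hσ : SmoothFieldOn σ V) :
    ContMDiffAt (𝓡 m)
      ((𝓡 m).prod 𝓘(ℝ, EuclideanSpace ℝ (Fin m) →L[ℝ] EuclideanSpace ℝ (Fin m))) ∞
      (fun x => (⟨x, cov σ x⟩ : Bundle.TotalSpace
        (EuclideanSpace ℝ (Fin m) →L[ℝ] EuclideanSpace ℝ (Fin m))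
        fun x : M => TangentSpace (𝓡 m) x →L[ℝ] TangentSpace (𝓡 m) x)) y := by
  obtain ⟨τ, hτ, hτσ⟩ := exists_smooth_extension hV hyV hσ
  have h1 := (hsm.contMDiff (σ := τ) (hτ.mono (Set.subset_univ U))).contMDiffAt (hU.mem_nhds hyU)
  refine h1.congr_of_eventuallyEq ?_
  filter_upwards [hτσ.eventually_nhds, hU.mem_nhds hyU, hV.mem_nhds hyV] with z hz hzU hzV
  have : cov σ z = cov τ z := by
    refine hcov.congr_of_eventuallyEq (mdifferentiableAt_of_smoothFieldOn (hV.mem_nhds hzV) hσ)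
      (mdifferentiableAt_of_smoothFieldOn Filter.univ_mem hτ) (hU.mem_nhds hzU) ?_
    filter_upwards [hz] with x hx using hx.symm
  rw [this]

lemma contDiffAt_christoffel [T2Space M] {cov : FieldDerivation m M} {U : Set M} (hU : IsOpen U)
    (hcov : IsCovariantDerivativeOn (EuclideanSpace ℝ (Fin m)) cov U)
    (hsm : ContMDiffCovariantDerivativeOn (EuclideanSpace ℝ (Fin m)) ∞ cov U)
    (hy : y ∈ (chartAt (EuclideanSpace ℝ (Fin m)) P).source) (hyU : y ∈ U) :
    ContDiffAt ℝ ∞ (christoffel cov P) (extChartAt (𝓡 m) P y) := by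
  unfold christoffel
  refine ContDiffAt.sum fun j _ => ?_
  have h1 := (contMDiffAt_end_iff_coord hy).1 (contMDiffAt_cov hU hcov hsm hyU
    (chartAt (EuclideanSpace ℝ (Fin m)) P).open_source hy
    (σ := frameField P (EuclideanSpace.single j 1))
    fun _ hz => (contMDiffAt_frameField hz _).contMDiffWithinAt)
  exact contDiffAt_const.smulRight h1

/-- The field `∇_τ σ` in coordinates. -/
lemma coordRep_cov {cov : FieldDerivation m M} {U : Set M} (hU : IsOpen U)
    (hcov : IsCovariantDerivativeOn (EuclideanSpace ℝ (Fin m)) cov U)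
    (hy : y ∈ (chartAt (EuclideanSpace ℝ (Fin m)) P).source) (hyU : y ∈ U)
    {σ τ : (x : M) → TangentSpace (𝓡 m) x}
    (hσ : ∀ᶠ z in 𝓝 y, MDifferentiableAt (𝓡 m) (𝓡 m).tangent
      (fun x => (⟨x, σ x⟩ : TangentBundle (𝓡 m) M)) z) :
    coordRep P (fun z => cov σ z (τ z)) =ᶠ[𝓝 (extChartAt (𝓡 m) P y)] fun x =>
      fderiv ℝ (coordRep P σ) x (coordRep P τ x) +
        christoffel cov P x (coordRep P σ x) (coordRep P τ x) := by
  filter_upwards [(eventually_coord_iff hy).2 hσ, extChartAt_target_mem hy,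
    (eventually_coord_iff hy).2 (hU.mem_nhds hyU)] with x hx hx' hxU
  have := coordVec_cov hcov (symm_mem_source hx') hxU hx (τ ((extChartAt (𝓡 m) P).symm x))
  rw [(extChartAt (𝓡 m) P).right_inv hx'] at this
  exact this

end

/-! ### Second derivatives, Hessian and Lie bracket in a chart -/

section

variable {m : ℕ} {M : Type*} [TopologicalSpace M]
  [ChartedSpace (EuclideanSpace ℝ (Fin m)) M] [IsManifold (𝓡 m) ∞ M]

variable {P y : M}

lemma mvfderiv_field_eq_coord {F : Type*} [NormedAddCommGroup F] [NormedSpace ℝ F]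
    (hy : y ∈ (chartAt (EuclideanSpace ℝ (Fin m)) P).source) {f : M → F}
    (hf : ContMDiffAt (𝓡 m) 𝓘(ℝ, F) 2 f y) (W : (x : M) → TangentSpace (𝓡 m) x) :
    (fun z => mvfderiv (𝓡 m) f z (W z)) ∘ (extChartAt (𝓡 m) P).symm
      =ᶠ[𝓝 (extChartAt (𝓡 m) P y)] fun x =>
        fderiv ℝ (f ∘ (extChartAt (𝓡 m) P).symm) x (coordRep P W x) := by
  have h := contMDiffAt_iff_contMDiffAt_nhds (by simp) |>.1 hf
  filter_upwards [(eventually_coord_iff hy).2 h, extChartAt_target_mem hy] with x hx hx'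
  have := mvfderiv_eq_coord (symm_mem_source hx') (hx.mdifferentiableAt two_ne_zero)
    (W ((extChartAt (𝓡 m) P).symm x))
  rw [(extChartAt (𝓡 m) P).right_inv hx'] at this
  exact this

/-- The second derivative `V (W f)` in coordinates. -/
lemma mvfderiv_mvfderiv_eq_coord {F : Type*} [NormedAddCommGroup F] [NormedSpace ℝ F]
    (hy : y ∈ (chartAt (EuclideanSpace ℝ (Fin m)) P).source) {f : M → F}
    (hf : ContMDiffAt (𝓡 m) 𝓘(ℝ, F) 2 f y) {W : (x : M) → TangentSpace (𝓡 m) x}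
    (hW : MDifferentiableAt (𝓡 m) (𝓡 m).tangent
      (fun x => (⟨x, W x⟩ : TangentBundle (𝓡 m) M)) y) (v : TangentSpace (𝓡 m) y) :
    mvfderiv (𝓡 m) (fun z => mvfderiv (𝓡 m) f z (W z)) y v =
      fderiv ℝ (fderiv ℝ (f ∘ (extChartAt (𝓡 m) P).symm)) (extChartAt (𝓡 m) P y)
        (coordVec P y v) (coordVec P y (W y)) +
      fderiv ℝ (f ∘ (extChartAt (𝓡 m) P).symm) (extChartAt (𝓡 m) P y)
        (fderiv ℝ (coordRep P W) (extChartAt (𝓡 m) P y) (coordVec P y v)) := by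
  have h1 := mvfderiv_field_eq_coord hy hf W
  have h2 : DifferentiableAt ℝ (fderiv ℝ (f ∘ (extChartAt (𝓡 m) P).symm))
      (extChartAt (𝓡 m) P y) :=
    (((contMDiffAt_iff_coord two_le_infty hy).1 hf).fderiv_right (m := 1) le_rfl).differentiableAt
      one_ne_zero
  have h3 := differentiableAt_coordRep hy hW
  have h4 : MDifferentiableAt (𝓡 m) 𝓘(ℝ, F) (fun z => mvfderiv (𝓡 m) f z (W z)) y :=
    (mdifferentiableAt_iff_coord hy).2 ((h2.clm_apply h3).congr_of_eventuallyEq h1)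
  rw [mvfderiv_eq_coord hy h4, h1.fderiv_eq, fderiv_clm_apply h2 h3]
  simp only [add_apply, ContinuousLinearMap.comp_apply, ContinuousLinearMap.flip_apply,
    coordRep_apply hy]
  abel

/-- The Hessian in coordinates. -/
lemma hessian_eq_coord {cov : FieldDerivation m M} {U : Set M}
    (hcov : IsCovariantDerivativeOn (EuclideanSpace ℝ (Fin m)) cov U)
    (hy : y ∈ (chartAt (EuclideanSpace ℝ (Fin m)) P).source) (hyU : y ∈ U) {f : M → ℝ}
    (hf : ContMDiffAt (𝓡 m) 𝓘(ℝ, ℝ) 2 f y) (u v : TangentSpace (𝓡 m) y) :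
    hessian cov f y u v =
      fderiv ℝ (fderiv ℝ (f ∘ (extChartAt (𝓡 m) P).symm)) (extChartAt (𝓡 m) P y)
        (coordVec P y u) (coordVec P y v) -
      fderiv ℝ (f ∘ (extChartAt (𝓡 m) P).symm) (extChartAt (𝓡 m) P y)
        (christoffel cov P (extChartAt (𝓡 m) P y) (coordVec P y v) (coordVec P y u)) := by
  have hV : MDifferentiableAt (𝓡 m) (𝓡 m).tangent
      (fun x => (⟨x, coordField v x⟩ : TangentBundle (𝓡 m) M)) y :=
    FiberBundle.mdifferentiableAt_extend (𝓡 m) (EuclideanSpace ℝ (Fin m)) v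
  have hV' : coordField v y = v := FiberBundle.extend_apply_self _ v
  unfold hessian
  rw [mvfderiv_mvfderiv_eq_coord hy hf hV,
    mvfderiv_eq_coord hy (hf.mdifferentiableAt two_ne_zero), coordVec_cov hcov hy hyU hV, hV',
    map_add]
  abel

/-- The manifold bracket at `y` is defined by pulling back through the preferred chart at `y`, so in
that chart the formula is the definition. Other charts are reached through
`lieBracket_coord_derivation`. -/
lemma coordVec_mlieBracket_self (V W : (x : M) → TangentSpace (𝓡 m) x) :
    coordVec y y (VectorField.mlieBracket (𝓡 m) V W y) =
      VectorField.lieBracket ℝ (coordRep y V) (coordRep y W) (extChartAt (𝓡 m) y y) := by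
  have key : ∀ X : (x : M) → TangentSpace (𝓡 m) x, 
      (VectorField.mpullbackWithin 𝓘(ℝ, EuclideanSpace ℝ (Fin m)) (𝓡 m)
        (extChartAt (𝓡 m) y).symm X (Set.range (𝓡 m)) :
          EuclideanSpace ℝ (Fin m) → EuclideanSpace ℝ (Fin m))
        =ᶠ[𝓝 (extChartAt (𝓡 m) y y)] coordRep y X := by
    intro X
    filter_upwards [extChartAt_target_mem (mem_chart_source _ y)] with x hx
    have h1 : (mfderivWithin 𝓘(ℝ, EuclideanSpace ℝ (Fin m)) (𝓡 m) (extChartAt (𝓡 m) y).symm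
        (Set.range (𝓡 m)) x).inverse =
        mfderiv (𝓡 m) 𝓘(ℝ, EuclideanSpace ℝ (Fin m)) (extChartAt (𝓡 m) y)
          ((extChartAt (𝓡 m) y).symm x) :=
      ContinuousLinearMap.inverse_eq (mfderivWithin_extChartAt_symm_comp_mfderiv_extChartAt hx)
        (mfderiv_extChartAt_comp_mfderivWithin_extChartAt_symm hx)
    rw [VectorField.mpullbackWithin_apply, h1]
    unfold coordRep coordVec
    rw [TangentBundle.continuousLinearMapAt_trivializationAt (symm_mem_source hx)]
    rfl
  have h2 : ∀ w : EuclideanSpace ℝ (Fin m),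
      (mfderiv (𝓡 m) 𝓘(ℝ, EuclideanSpace ℝ (Fin m)) (extChartAt (𝓡 m) y) y).inverse w = w := by
    intro w
    rw [mfderiv_extChartAt_self]
    exact congrArg (fun L : EuclideanSpace ℝ (Fin m) →L[ℝ] EuclideanSpace ℝ (Fin m) => L w)
      ContinuousLinearMap.inverse_id
  rw [← VectorField.mlieBracketWithin_univ, VectorField.mlieBracketWithin_apply, coordVec_self,
    Set.preimage_univ, Set.univ_inter]
  refine (h2 _).trans ?_
  rw [← (key V).lieBracket_vectorField_eq (key W)]
  simp only [modelWithCornersSelf_coe, Set.range_id]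
  exact congrFun (VectorField.lieBracketWithin_univ (E := EuclideanSpace ℝ (Fin m))) _

/-- Second derivatives of `f` in the chart at `y` are symmetric and cancel. Vector values are
allowed so that `f` can itself be a chart. -/
lemma lieBracket_coord_derivation {F : Type*} [NormedAddCommGroup F] [NormedSpace ℝ F]
    {f : M → F} (hf : ContMDiffAt (𝓡 m) 𝓘(ℝ, F) 2 f y) {V W : (x : M) → TangentSpace (𝓡 m) x}
    (hV : MDifferentiableAt (𝓡 m) (𝓡 m).tangent
      (fun x => (⟨x, V x⟩ : TangentBundle (𝓡 m) M)) y)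
    (hW : MDifferentiableAt (𝓡 m) (𝓡 m).tangent
      (fun x => (⟨x, W x⟩ : TangentBundle (𝓡 m) M)) y) :
    mvfderiv (𝓡 m) f y (VectorField.mlieBracket (𝓡 m) V W y) =
      mvfderiv (𝓡 m) (fun z => mvfderiv (𝓡 m) f z (W z)) y (V y) -
        mvfderiv (𝓡 m) (fun z => mvfderiv (𝓡 m) f z (V z)) y (W y) := by
  have hy := mem_chart_source (EuclideanSpace ℝ (Fin m)) y
  have hs : IsSymmSndFDerivAt ℝ (f ∘ (extChartAt (𝓡 m) y).symm) (extChartAt (𝓡 m) y y) :=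
    ((contMDiffAt_iff_coord two_le_infty hy).1 hf).isSymmSndFDerivAt (by simp)
  rw [mvfderiv_eq_coord hy (hf.mdifferentiableAt two_ne_zero), coordVec_mlieBracket_self,
    mvfderiv_mvfderiv_eq_coord hy hf hV, mvfderiv_mvfderiv_eq_coord hy hf hW, hs.eq,
    VectorField.lieBracket, map_sub, coordRep_apply hy, coordRep_apply hy]
  abel

/-- The Lie bracket in coordinates. -/
lemma coordVec_mlieBracket (hy : y ∈ (chartAt (EuclideanSpace ℝ (Fin m)) P).source)
    {V W : (x : M) → TangentSpace (𝓡 m) x}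
    (hV : MDifferentiableAt (𝓡 m) (𝓡 m).tangent
      (fun x => (⟨x, V x⟩ : TangentBundle (𝓡 m) M)) y)
    (hW : MDifferentiableAt (𝓡 m) (𝓡 m).tangent
      (fun x => (⟨x, W x⟩ : TangentBundle (𝓡 m) M)) y) :
    coordVec P y (VectorField.mlieBracket (𝓡 m) V W y) =
      fderiv ℝ (coordRep P W) (extChartAt (𝓡 m) P y) (coordVec P y (V y)) -
        fderiv ℝ (coordRep P V) (extChartAt (𝓡 m) P y) (coordVec P y (W y)) := by
  -- The chart at `P` serves as the test function: in its own coordinates it is the identity, so the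
  -- derivation rule returns the components of the bracket.
  have hf : ContMDiffAt (𝓡 m) 𝓘(ℝ, EuclideanSpace ℝ (Fin m)) 2 (extChartAt (𝓡 m) P) y := by
    have := contMDiffAt_extChartAt' (I := 𝓡 m) (n := ∞) hy
    exact this.of_le two_le_infty
  have he : extChartAt (𝓡 m) P ∘ (extChartAt (𝓡 m) P).symm
      =ᶠ[𝓝 (extChartAt (𝓡 m) P y)] id := by
    filter_upwards [extChartAt_target_mem hy] with x hx using (extChartAt (𝓡 m) P).right_inv hx
  have hs : IsSymmSndFDerivAt ℝ (extChartAt (𝓡 m) P ∘ (extChartAt (𝓡 m) P).symm)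
      (extChartAt (𝓡 m) P y) :=
    ((contMDiffAt_iff_coord two_le_infty hy).1 hf).isSymmSndFDerivAt (by simp)
  have h := lieBracket_coord_derivation hf hV hW
  rw [mvfderiv_mvfderiv_eq_coord hy hf hV, mvfderiv_mvfderiv_eq_coord hy hf hW, hs.eq,
    mvfderiv_eq_coord hy (hf.mdifferentiableAt two_ne_zero), he.fderiv_eq, fderiv_id] at h
  simpa using h

lemma mlieBracket_coordField (u v : TangentSpace (𝓡 m) y) :
    VectorField.mlieBracket (𝓡 m) (coordField u : (x : M) → TangentSpace (𝓡 m) x)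
      (coordField v) y = 0 := by
  have key : ∀ w : TangentSpace (𝓡 m) y, coordRep y (coordField w)
      =ᶠ[𝓝 (extChartAt (𝓡 m) y y)] fun _ => tangentCoords w := by
    intro w
    have hy := mem_chart_source (EuclideanSpace ℝ (Fin m)) y
    refine (coordRep_congr hy ?_).trans (coordRep_frameField hy _)
    filter_upwards [(chartAt (EuclideanSpace ℝ (Fin m)) y).open_source.mem_nhds hy] with z hz
    exact coordField_eq_frameField w hz
  have h := coordVec_mlieBracket_self (y := y) (coordField u) (coordField v)
  rw [coordVec_self, VectorField.lieBracket, (key u).fderiv_eq, (key v).fderiv_eq] at h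
  exact h.trans (by simp; rfl)

end

section

section LocalGeometry

/-! ### Connections on an open set of a vector space -/

variable {E : Type*} [NormedAddCommGroup E] [NormedSpace ℝ E]

/-- The curvature `R(u, v) w` of the connection with Christoffel symbols `A`. -/
def localCurvature (A : E → E →L[ℝ] E →L[ℝ] E) (x u v w : E) : E :=
  fderiv ℝ A x u w v - fderiv ℝ A x v w u + A x (A x w v) u - A x (A x w u) v

/-- The endomorphism `w ↦ R(w, u) v`. -/
def localCurvatureEnd (A : E → E →L[ℝ] E →L[ℝ] E) (x u v : E) : E →L[ℝ] E :=
  ((fderiv ℝ A x).flip v).flip u - fderiv ℝ A x u v + A x (A x v u) - (A x).flip u ∘L A x v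

lemma localCurvatureEnd_apply (A : E → E →L[ℝ] E →L[ℝ] E) (x u v w : E) :
    localCurvatureEnd A x u v w = localCurvature A x w u v := rfl

variable [FiniteDimensional ℝ E]

variable (E) in
/-- The trace of an endomorphism, as a continuous linear map. -/
def traceCLM : (E →L[ℝ] E) →L[ℝ] ℝ :=
  (LinearMap.trace ℝ E ∘ₗ (ContinuousLinearMap.coeLM ℝ : (E →L[ℝ] E) →ₗ[ℝ] E →ₗ[ℝ] E)
    ).toContinuousLinearMap

lemma traceCLM_apply (L : E →L[ℝ] E) : traceCLM E L = LinearMap.trace ℝ E (L : E →ₗ[ℝ] E) := rfl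

/-- The Ricci tensor of the connection with Christoffel symbols `A`. -/
def localRicci (A : E → E →L[ℝ] E →L[ℝ] E) (x : E) : E →L[ℝ] E →L[ℝ] ℝ :=
  (LinearMap.mk₂ ℝ (fun u v => traceCLM E (localCurvatureEnd A x u v))
    (fun u u' v => by
      rw [← map_add]
      congr 1
      ext1 w
      simp only [localCurvatureEnd_apply, localCurvature, map_add, add_apply]
      abel)
    (fun c u v => by
      rw [← map_smul]
      congr 1
      ext1 w
      simp only [localCurvatureEnd_apply, localCurvature, map_smul, smul_apply, smul_sub,
        smul_add])
    (fun u v v' => by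
      rw [← map_add]
      congr 1
      ext1 w
      simp only [localCurvatureEnd_apply, localCurvature, map_add, add_apply]
      abel)
    (fun c u v => by
      rw [← map_smul]
      congr 1
      ext1 w
      simp only [localCurvatureEnd_apply, localCurvature, map_smul, smul_apply, smul_sub,
        smul_add])).toContinuousBilinearMap

lemma localRicci_apply (A : E → E →L[ℝ] E →L[ℝ] E) (x u v : E) :
    localRicci A x u v = traceCLM E (localCurvatureEnd A x u v) :=
  rfl

/-- The symmetrised Ricci tensor of the connection with Christoffel symbols `A`. -/
def localRicciSymm (A : E → E →L[ℝ] E →L[ℝ] E) (x : E) : E →L[ℝ] E →L[ℝ] ℝ :=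
  (1 / 2 : ℝ) • (localRicci A x + (localRicci A x).flip)

lemma localRicciSymm_apply (A : E → E →L[ℝ] E →L[ℝ] E) (x u v : E) :
    localRicciSymm A x u v = (1 / 2) * (localRicci A x u v + localRicci A x v u) := rfl

lemma contDiffOn_localRicci {T : Set E} (hT : IsOpen T) {A : E → E →L[ℝ] E →L[ℝ] E}
    (hA : ContDiffOn ℝ ∞ A T) : ContDiffOn ℝ ∞ (localRicci A) T := by
  have hD : ContDiffOn ℝ ∞ (fderiv ℝ A) T := hA.fderiv_of_isOpen hT (by simp)
  have hc : ∀ w : E, ContDiffOn ℝ ∞ (fun _ : E => w) T := fun w => contDiffOn_const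
  refine contDiffOn_clm_apply.2 fun u => contDiffOn_clm_apply.2 fun v => ?_
  simp only [localRicci_apply]
  refine (traceCLM E).contDiff.comp_contDiffOn (contDiffOn_clm_apply.2 fun w => ?_)
  simp only [localCurvatureEnd_apply, localCurvature]
  exact (((((hD.clm_apply (hc w)).clm_apply (hc v)).clm_apply (hc u)).sub
    (((hD.clm_apply (hc u)).clm_apply (hc v)).clm_apply (hc w))).add
    ((hA.clm_apply ((hA.clm_apply (hc v)).clm_apply (hc u))).clm_apply (hc w))).sub
    ((hA.clm_apply ((hA.clm_apply (hc v)).clm_apply (hc w))).clm_apply (hc u))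

lemma contDiffOn_localRicciSymm {T : Set E} (hT : IsOpen T) {A : E → E →L[ℝ] E →L[ℝ] E}
    (hA : ContDiffOn ℝ ∞ A T) : ContDiffOn ℝ ∞ (localRicciSymm A) T := by
  have h := contDiffOn_localRicci hT hA
  refine contDiffOn_clm_apply.2 fun u => contDiffOn_clm_apply.2 fun v => ?_
  simp only [localRicciSymm_apply]
  exact contDiffOn_const.mul (((h.clm_apply contDiffOn_const).clm_apply contDiffOn_const).add
    ((h.clm_apply contDiffOn_const).clm_apply contDiffOn_const))

/-- The Ricci identity for a solution of `∇² f = f S` which vanishes at `x`. -/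
lemma fderiv_localCurvature_of_solution {A : E → E →L[ℝ] E →L[ℝ] E} {S : E → E →L[ℝ] E →L[ℝ] ℝ}
    {f : E → ℝ} {x : E} (hA : DifferentiableAt ℝ A x) (hS : DifferentiableAt ℝ S x)
    (hf : ContDiffAt ℝ 3 f x)
    (h : ∀ᶠ z in 𝓝 x, ∀ u v, fderiv ℝ (fderiv ℝ f) z u v =
      fderiv ℝ f z (A z v u) + f z * S z u v) (hfx : f x = 0) (w u v : E) :
    fderiv ℝ f x (localCurvature A x w u v) =
      fderiv ℝ f x u * S x w v - fderiv ℝ f x w * S x u v := by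
  have hf1 : ContDiffAt ℝ 2 (fderiv ℝ f) x := hf.fderiv_right (by norm_num)
  have hf2 : ContDiffAt ℝ 1 (fderiv ℝ (fderiv ℝ f)) x := hf1.fderiv_right (by norm_num)
  have d0 : DifferentiableAt ℝ f x := hf.differentiableAt (by norm_num)
  have d1 : DifferentiableAt ℝ (fderiv ℝ f) x := hf1.differentiableAt (by norm_num)
  have d2 : DifferentiableAt ℝ (fderiv ℝ (fderiv ℝ f)) x := hf2.differentiableAt (by norm_num)
  have hs : IsSymmSndFDerivAt ℝ (fderiv ℝ f) x := hf1.isSymmSndFDerivAt (by simp)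
  -- The equation is differentiated once more. The derivative of `S` appears only multiplied by `f x
  -- = 0`; exchanging the first two arguments of the third derivative then yields the curvature.
  have key : ∀ a b c : E, fderiv ℝ (fderiv ℝ (fderiv ℝ f)) x a b c =
      fderiv ℝ (fderiv ℝ f) x a (A x c b) + fderiv ℝ f x (fderiv ℝ A x a c b) +
        fderiv ℝ f x a * S x b c := by
    intro a b c
    have e : (fun z => fderiv ℝ (fderiv ℝ f) z b c) =ᶠ[𝓝 x]
        fun z => fderiv ℝ f z (A z c b) + f z * S z b c := h.mono fun z hz => hz b c
    have e1 := congrArg (fun L : E →L[ℝ] ℝ => L a) e.fderiv_eq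
    have dA : DifferentiableAt ℝ (fun z => A z c b) x :=
      (hA.clm_apply (differentiableAt_const c)).clm_apply (differentiableAt_const b)
    have dS : DifferentiableAt ℝ (fun z => S z b c) x :=
      (hS.clm_apply (differentiableAt_const b)).clm_apply (differentiableAt_const c)
    rw [fderiv_fun_add (d1.clm_apply dA) (d0.fun_mul dS), fderiv_clm_apply d1 dA,
      fderiv_fun_mul d0 dS,
      fderiv_clm_apply (d2.clm_apply (differentiableAt_const b)) (differentiableAt_const c),
      fderiv_clm_apply d2 (differentiableAt_const b),
      fderiv_clm_apply (hA.clm_apply (differentiableAt_const c)) (differentiableAt_const b),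
      fderiv_clm_apply hA (differentiableAt_const c)] at e1
    simp [hfx] at e1
    rw [e1]
    ring
  have hx := h.self_of_nhds
  have h1 := key w u v
  have h2 := key u w v
  rw [hs.eq w u, h2, hx, hx, hfx] at h1
  simp only [localCurvature, map_add, map_sub]
  linarith

end LocalGeometry

end

/-! ### Curvature, Ricci tensor and the equation in a chart -/

section

variable {m : ℕ} {M : Type*} [TopologicalSpace M]
  [ChartedSpace (EuclideanSpace ℝ (Fin m)) M] [IsManifold (𝓡 m) ∞ M]

variable {P y : M}

/-- The curvature in coordinates. -/
lemma curvature_eq_coord [T2Space M] {cov : FieldDerivation m M} {U : Set M} (hU : IsOpen U)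
    (hcov : IsCovariantDerivativeOn (EuclideanSpace ℝ (Fin m)) cov U)
    (hsm : ContMDiffCovariantDerivativeOn (EuclideanSpace ℝ (Fin m)) ∞ cov U)
    (hy : y ∈ (chartAt (EuclideanSpace ℝ (Fin m)) P).source) (hyU : y ∈ U)
    (u v w : TangentSpace (𝓡 m) y) :
    coordVec P y (curvature cov y u v w) = localCurvature (christoffel cov P)
      (extChartAt (𝓡 m) P y) (coordVec P y u) (coordVec P y v) (coordVec P y w) := by
  set x := extChartAt (𝓡 m) P y with hx
  set A := christoffel cov P with hA
  have hsmooth : ∀ z : TangentSpace (𝓡 m) y, ContMDiffAt (𝓡 m) (𝓡 m).tangent ∞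
      (fun x => (⟨x, coordField z x⟩ : TangentBundle (𝓡 m) M)) y := fun z => by
    have := FiberBundle.contMDiffAt_extend (𝓡 m) (EuclideanSpace ℝ (Fin m)) (k := ∞) z
    exact this
  have hd : ∀ z : TangentSpace (𝓡 m) y, ContDiffAt ℝ ∞ (coordRep P (coordField z)) x :=
    fun z => (contDiffAt_coordRep le_rfl hy).1 (hsmooth z)
  have hm : ∀ z : TangentSpace (𝓡 m) y, MDifferentiableAt (𝓡 m) (𝓡 m).tangent
      (fun x => (⟨x, coordField z x⟩ : TangentBundle (𝓡 m) M)) y := fun z =>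
    (hsmooth z).mdifferentiableAt (by simp)
  have hm' : ∀ z : TangentSpace (𝓡 m) y, ∀ᶠ p in 𝓝 y, MDifferentiableAt (𝓡 m) (𝓡 m).tangent
      (fun x => (⟨x, coordField z x⟩ : TangentBundle (𝓡 m) M)) p := by
    intro z
    filter_upwards [(contMDiffAt_iff_contMDiffAt_nhds (by simp)).1 ((hsmooth z).of_le
      two_le_infty)] with p hp using hp.mdifferentiableAt two_ne_zero
  have hself : ∀ z : TangentSpace (𝓡 m) y, coordField z y = z := fun z =>
    FiberBundle.extend_apply_self _ z
  have hself' : ∀ z : TangentSpace (𝓡 m) y, coordRep P (coordField z) x = coordVec P y z :=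
    fun z => by rw [hx, coordRep_apply hy, hself]
  have hAx : DifferentiableAt ℝ A x :=
    (contDiffAt_christoffel hU hcov hsm hy hyU).differentiableAt (by simp)
  -- The coordinate fields are constant in the chart at `y`, not in the chart at `P`; there only the
  -- vanishing of their bracket is available.
  have hcomm : fderiv ℝ (coordRep P (coordField v)) x (coordVec P y u) =
      fderiv ℝ (coordRep P (coordField u)) x (coordVec P y v) := by
    have h := coordVec_mlieBracket hy (hm u) (hm v)
    rw [mlieBracket_coordField, hself, hself, map_zero] at h
    exact (sub_eq_zero.1 h.symm)
  have hsym : IsSymmSndFDerivAt ℝ (coordRep P (coordField w)) x :=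
    (hd w).isSymmSndFDerivAt (by simp; exact two_le_infty)
  -- By `hcomm` and `hsym`, everything except the term with the derivative of `A` and the term
  -- quadratic in `A` is symmetric in `a`, `b`, and drops out of the commutator.
  have key : ∀ a b : TangentSpace (𝓡 m) y,
      coordVec P y (cov (fun z => cov (coordField w) z (coordField b z)) y a) =
        fderiv ℝ (fderiv ℝ (coordRep P (coordField w))) x (coordVec P y a) (coordVec P y b) +
        fderiv ℝ (coordRep P (coordField w)) x
          (fderiv ℝ (coordRep P (coordField b)) x (coordVec P y a)) +
        (fderiv ℝ A x (coordVec P y a) (coordVec P y w) (coordVec P y b) +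
        A x (fderiv ℝ (coordRep P (coordField w)) x (coordVec P y a)) (coordVec P y b) +
        A x (coordVec P y w) (fderiv ℝ (coordRep P (coordField b)) x (coordVec P y a))) +
        A x (fderiv ℝ (coordRep P (coordField w)) x (coordVec P y b)) (coordVec P y a) +
        A x (A x (coordVec P y w) (coordVec P y b)) (coordVec P y a) := by
    intro a b
    have h1 := coordRep_cov hU hcov hy hyU (τ := coordField b) (hm' w)
    have hw1 : DifferentiableAt ℝ (fderiv ℝ (coordRep P (coordField w))) x :=
      ((hd w).fderiv_right (m := ∞) (by simp)).differentiableAt (by simp)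
    have hw0 := (hd w).differentiableAt (by simp)
    have hb0 := (hd b).differentiableAt (by simp)
    have h2 : MDifferentiableAt (𝓡 m) (𝓡 m).tangent (fun p =>
        (⟨p, cov (coordField w) p (coordField b p)⟩ : TangentBundle (𝓡 m) M)) y := by
      obtain ⟨V, hV, hwV⟩ := FiberBundle.exists_contMDiffOn_extend (𝓡 m)
        (EuclideanSpace ℝ (Fin m)) (k := ∞) w
      obtain ⟨V', hV', hoV', hyV'⟩ := mem_nhds_iff.1 hV
      have h3 := contMDiffAt_cov hU hcov hsm hyU hoV' hyV' (hwV.mono hV')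
      exact (ContMDiffAt.clm_bundle_apply (F₁ := EuclideanSpace ℝ (Fin m))
        (F₂ := EuclideanSpace ℝ (Fin m)) (E₁ := TangentSpace (𝓡 m)) (E₂ := TangentSpace (𝓡 m))
        h3 (hsmooth b)).mdifferentiableAt (by simp)
    rw [coordVec_cov hcov hy hyU h2, ← hx, h1.fderiv_eq,
      fderiv_fun_add (hw1.clm_apply hb0) ((hAx.clm_apply hw0).clm_apply hb0),
      fderiv_clm_apply hw1 hb0, fderiv_clm_apply (hAx.clm_apply hw0) hb0,
      fderiv_clm_apply hAx hw0, coordVec_cov hcov hy hyU (hm w), ← hx]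
    simp only [add_apply, ContinuousLinearMap.comp_apply, ContinuousLinearMap.flip_apply,
      hself', hself, map_add]
    abel
  unfold curvature curvatureOfFields localCurvature
  rw [mlieBracket_coordField, map_zero, sub_zero, map_sub, hself, hself, key, key, hcomm, hsym.eq]
  abel

/-- The Ricci tensor in coordinates. -/
lemma ricci_eq_coord [T2Space M] {cov : FieldDerivation m M} {U : Set M} (hU : IsOpen U)
    (hcov : IsCovariantDerivativeOn (EuclideanSpace ℝ (Fin m)) cov U)
    (hsm : ContMDiffCovariantDerivativeOn (EuclideanSpace ℝ (Fin m)) ∞ cov U)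
    (hy : y ∈ (chartAt (EuclideanSpace ℝ (Fin m)) P).source) (hyU : y ∈ U)
    (u v : TangentSpace (𝓡 m) y) :
    ricci cov y u v = localRicci (christoffel cov P) (extChartAt (𝓡 m) P y)
      (coordVec P y u) (coordVec P y v) := by
  let T : EuclideanSpace ℝ (Fin m) →ₗ[ℝ] EuclideanSpace ℝ (Fin m) :=
    (coordVec (m := m) P y).toLinearMap
  let F : EuclideanSpace ℝ (Fin m) →ₗ[ℝ] EuclideanSpace ℝ (Fin m) :=
    (frameVec (m := m) P y).toLinearMap
  let R : EuclideanSpace ℝ (Fin m) →ₗ[ℝ] EuclideanSpace ℝ (Fin m) :=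
    (localCurvatureEnd (christoffel cov P) (extChartAt (𝓡 m) P y)
      (coordVec P y u) (coordVec P y v) : EuclideanSpace ℝ (Fin m) →L[ℝ] EuclideanSpace ℝ (Fin m))
  -- The trace is cyclic, so this one-sided inverse is enough to remove the conjugation by the
  -- frame.
  have hTF : T ∘ₗ F = LinearMap.id := LinearMap.ext fun z => coordVec_frameVec hy z
  have h1 : ∀ i : Fin m, curvature cov y (tangentBasis y i) u v =
      (F ∘ₗ R ∘ₗ T) (EuclideanSpace.single i 1) := by
    intro i
    have := curvature_eq_coord (P := P) hU hcov hsm hy hyU (tangentBasis y i) u v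
    rw [← frameVec_coordVec hy (curvature cov y (tangentBasis y i) u v), this]
    rfl
  have h2 : ricci cov y u v = LinearMap.trace ℝ (EuclideanSpace ℝ (Fin m)) (F ∘ₗ R ∘ₗ T) := by
    rw [LinearMap.trace_eq_sum_inner _ (EuclideanSpace.basisFun (Fin m) ℝ)]
    unfold ricci
    refine Finset.sum_congr rfl fun i _ => ?_
    rw [h1 i]
    simp [tangentCoords, EuclideanSpace.inner_single_left]
  rw [h2, LinearMap.trace_comp_comm', LinearMap.comp_assoc, hTF, LinearMap.comp_id]
  rfl

lemma ricciSymm_eq_coord [T2Space M] {cov : FieldDerivation m M} {U : Set M} (hU : IsOpen U)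
    (hcov : IsCovariantDerivativeOn (EuclideanSpace ℝ (Fin m)) cov U)
    (hsm : ContMDiffCovariantDerivativeOn (EuclideanSpace ℝ (Fin m)) ∞ cov U)
    (hy : y ∈ (chartAt (EuclideanSpace ℝ (Fin m)) P).source) (hyU : y ∈ U)
    (u v : TangentSpace (𝓡 m) y) :
    ricciSymm cov y u v = localRicciSymm (christoffel cov P) (extChartAt (𝓡 m) P y)
      (coordVec P y u) (coordVec P y v) := by
  unfold ricciSymm
  rw [ricci_eq_coord hU hcov hsm hy hyU, ricci_eq_coord hU hcov hsm hy hyU, localRicciSymm_apply]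

lemma coordVec_surjective (hy : y ∈ (chartAt (EuclideanSpace ℝ (Fin m)) P).source) :
    Function.Surjective (coordVec (m := m) P y) := fun v => ⟨frameVec P y v, coordVec_frameVec hy v⟩

lemma coordVec_injective (hy : y ∈ (chartAt (EuclideanSpace ℝ (Fin m)) P).source) :
    Function.Injective (coordVec (m := m) P y) := fun u v h => by
  rw [← frameVec_coordVec hy u, h, frameVec_coordVec hy]

/-- The quasi-Einstein equation in coordinates. -/
lemma solvesAt_iff_coord [T2Space M] {cov : FieldDerivation m M} {U : Set M} (hU : IsOpen U)
    (hcov : IsCovariantDerivativeOn (EuclideanSpace ℝ (Fin m)) cov U)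
    (hsm : ContMDiffCovariantDerivativeOn (EuclideanSpace ℝ (Fin m)) ∞ cov U)
    (hy : y ∈ (chartAt (EuclideanSpace ℝ (Fin m)) P).source) (hyU : y ∈ U) {μ : ℝ} {f : M → ℝ}
    (hf : ContMDiffAt (𝓡 m) 𝓘(ℝ, ℝ) 2 f y) :
    SolvesAt cov μ f y ↔ ∀ u v : EuclideanSpace ℝ (Fin m),
      fderiv ℝ (fderiv ℝ (f ∘ (extChartAt (𝓡 m) P).symm)) (extChartAt (𝓡 m) P y) u v =
        fderiv ℝ (f ∘ (extChartAt (𝓡 m) P).symm) (extChartAt (𝓡 m) P y)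
          (christoffel cov P (extChartAt (𝓡 m) P y) v u) +
        f y * (μ * localRicciSymm (christoffel cov P) (extChartAt (𝓡 m) P y) u v) := by
  unfold SolvesAt
  rw [(coordVec_surjective hy).forall₂]
  refine forall₂_congr fun u v => ?_
  rw [hessian_eq_coord hcov hy hyU hf, ricciSymm_eq_coord hU hcov hsm hy hyU, sub_eq_iff_eq_add',
    mul_assoc, mul_left_comm]

/-- Frame fields of one chart commute, so vanishing torsion on them is the symmetry of the
Christoffel symbols. -/
lemma christoffel_symm (cov : CovariantDerivative (𝓡 m) (EuclideanSpace ℝ (Fin m))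
      (TangentSpace (𝓡 m) : M → Type _)) (htorsion : cov.torsion = 0)
    (hy : y ∈ (chartAt (EuclideanSpace ℝ (Fin m)) P).source) (u v : EuclideanSpace ℝ (Fin m)) :
    christoffel cov.toFun P (extChartAt (𝓡 m) P y) u v =
      christoffel cov.toFun P (extChartAt (𝓡 m) P y) v u := by
  have hu := mdifferentiableAt_frameField hy u
  have hv := mdifferentiableAt_frameField hy v
  have h := (cov.torsion_eq_zero_iff.1 htorsion) hu hv
  have h0 := coordVec_mlieBracket hy hu hv
  rw [← h, map_sub, coordVec_cov cov.isCovariantDerivativeOnUniv hy trivial hu,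
    coordVec_cov cov.isCovariantDerivativeOnUniv hy trivial hv,
    (coordRep_frameField hy u).fderiv_eq, (coordRep_frameField hy v).fderiv_eq] at h0
  simp [frameField, coordVec_frameVec hy] at h0
  exact (sub_eq_zero.1 h0).symm

end

section

section Frobenius

/-! ### Overdetermined linear systems -/

variable {E : Type*} [NormedAddCommGroup E] [NormedSpace ℝ E]
  {F : Type*} [NormedAddCommGroup F] [NormedSpace ℝ F]
  {G : Type*} [NormedAddCommGroup G] [NormedSpace ℝ G]

/-- The derivative of `B` is locally Lipschitz, which makes the Taylor bounds uniform in both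
points. This uniformity is needed to compare the equations along two neighbouring rays. -/
lemma exists_taylor_bound {B : E → G} {x₀ : E} (hB : ContDiffAt ℝ 2 B x₀) :
    ∃ K > 0, ∃ ε > 0, ∀ y ∈ Metric.ball x₀ ε, DifferentiableAt ℝ B y ∧ ‖B y‖ ≤ K ∧
      ∀ z ∈ Metric.ball x₀ ε, ‖B z - B y‖ ≤ K * ‖z - y‖ ∧
        ‖B z - B y - fderiv ℝ B y (z - y)‖ ≤ K * ‖z - y‖ ^ 2 := by
  have h1 : ContDiffAt ℝ 1 (fderiv ℝ B) x₀ := hB.fderiv_right (by norm_num)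
  obtain ⟨L, t, ht, hL⟩ := h1.exists_lipschitzOnWith
  have h2 : ∀ᶠ y in 𝓝 x₀, DifferentiableAt ℝ B y := by
    filter_upwards [hB.eventually (by simp)] with y hy using hy.differentiableAt two_ne_zero
  have h3 : ∀ᶠ y in 𝓝 x₀, ‖B y‖ < ‖B x₀‖ + 1 :=
    hB.continuousAt.norm.eventually (gt_mem_nhds (lt_add_one _))
  have h4 : ∀ᶠ y in 𝓝 x₀, ‖fderiv ℝ B y‖ < ‖fderiv ℝ B x₀‖ + 1 :=
    h1.continuousAt.norm.eventually (gt_mem_nhds (lt_add_one _))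
  obtain ⟨ε, hε, hb⟩ := Metric.eventually_nhds_iff_ball.1 (h2.and (h3.and (h4.and ht)))
  set K : ℝ := L + (‖B x₀‖ + 1) + (‖fderiv ℝ B x₀‖ + 1) with hK
  have hL0 : (0 : ℝ) ≤ L := L.2
  have n1 := norm_nonneg (B x₀)
  have n2 := norm_nonneg (fderiv ℝ B x₀)
  refine ⟨K, by positivity, ε, hε, fun y hy => ⟨(hb y hy).1, ?_, fun z hz => ⟨?_, ?_⟩⟩⟩
  · linarith [(hb y hy).2.1]
  · refine (convex_ball x₀ ε).norm_image_sub_le_of_norm_fderiv_le (𝕜 := ℝ)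
      (fun w hw => (hb w hw).1) (fun w hw => ?_) hy hz
    linarith [(hb w hw).2.2.1]
  · have hseg : segment ℝ y z ⊆ Metric.ball x₀ ε := (convex_ball x₀ ε).segment_subset hy hz
    rw [pow_two, ← mul_assoc]
    refine (convex_segment y z).norm_image_sub_le_of_norm_fderiv_le' (𝕜 := ℝ)
      (fun w hw => (hb w (hseg hw)).1) (fun w hw => ?_) (left_mem_segment ℝ y z)
      (right_mem_segment ℝ y z)
    have e1 := hL.dist_le_mul w (hb w (hseg hw)).2.2.2 y (hb y hy).2.2.2
    rw [dist_eq_norm, dist_eq_norm] at e1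
    have e2 : ‖w - y‖ ≤ ‖z - y‖ := by
      rw [segment_eq_image'] at hw
      obtain ⟨a, ⟨ha0, ha1⟩, rfl⟩ := hw
      simp only [add_sub_cancel_left, norm_smul, Real.norm_eq_abs, abs_of_nonneg ha0]
      exact mul_le_of_le_one_left (norm_nonneg _) ha1
    refine e1.trans (mul_le_mul ?_ e2 (norm_nonneg _) (by positivity))
    linarith

/-- Linear differential equations with small coefficients have solutions on `[0, 1]`. -/
lemma exists_linear_ode_solution [CompleteSpace F] {b : ℝ → F →L[ℝ] F}
    (hb : ContinuousOn b (Set.Icc 0 1)) (hn : ∀ t ∈ Set.Icc (0 : ℝ) 1, ‖b t‖ ≤ 1 / 2) (f₀ : F) :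
    ∃ u : ℝ → F, u 0 = f₀ ∧
      ∀ t ∈ Set.Icc (0 : ℝ) 1, HasDerivWithinAt u (b t (u t)) (Set.Icc 0 1) t := by
  -- On the ball of radius `a` about `f₀` the speed is at most `(2 ‖f₀‖ + 1) / 2 ≤ a`, so a solution
  -- cannot leave the ball within time 1.
  set a : NNReal := ‖f₀‖₊ + 1 with ha
  have hpl : IsPicardLindelof (fun t => b t) (⟨0, by simp⟩ : Set.Icc (0 : ℝ) 1) f₀ a 0 a (1 / 2) := by
    refine ⟨fun t ht => ?_, fun x _ => hb.clm_apply continuousOn_const, fun t ht x hx => ?_, ?_⟩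
    · refine ((b t).lipschitz.weaken ?_).lipschitzOnWith
      have := hn t ht
      rw [← NNReal.coe_le_coe]
      simpa using this
    · have h1 := (b t).le_of_opNorm_le (hn t ht) x
      have h2 : ‖x‖ ≤ ‖f₀‖ + a := by
        have h3 := mem_closedBall_iff_norm.1 hx
        have := norm_le_norm_add_norm_sub' x f₀
        linarith
      have h3 : (a : ℝ) = ‖f₀‖ + 1 := by simp [ha]
      rw [h3] at h2 ⊢
      linarith
    · simp
  obtain ⟨u, hu0, hu⟩ := hpl.exists_eq_forall_mem_Icc_hasDerivWithinAt₀
  exact ⟨u, hu0, hu⟩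

/-- Grönwall's inequality, with the time in the bound replaced by its maximum 1. It is used with `e
= 0` for a priori bounds and uniqueness, and with an `e` of second order for differentiability. -/
lemma norm_le_of_linear_ode {b : ℝ → F →L[ℝ] F} {u e : ℝ → F} {K ε : ℝ} (hK : 0 < K)
    (hn : ∀ t ∈ Set.Icc (0 : ℝ) 1, ‖b t‖ ≤ K) (he : ∀ t ∈ Set.Icc (0 : ℝ) 1, ‖e t‖ ≤ ε)
    (hu : ∀ t ∈ Set.Icc (0 : ℝ) 1, HasDerivWithinAt u (b t (u t) + e t) (Set.Icc 0 1) t) :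
    ∀ t ∈ Set.Icc (0 : ℝ) 1, ‖u t‖ ≤ ‖u 0‖ * Real.exp K + ε / K * (Real.exp K - 1) := by
  intro t ht
  have h := norm_le_gronwallBound_of_norm_deriv_right_le (f := u) (f' := fun t => b t (u t) + e t)
    (δ := ‖u 0‖) (K := K) (ε := ε) (a := 0) (b := 1)
    (fun s hs => (hu s hs).continuousWithinAt)
    (fun s hs => (hu s (Set.Ico_subset_Icc_self hs)).mono_of_mem_nhdsWithin
      (Filter.mem_of_superset (Icc_mem_nhdsGE hs.2) (Set.Icc_subset_Icc_left hs.1)))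
    le_rfl (fun s hs => by
      have hs := Set.Ico_subset_Icc_self hs
      exact (norm_add_le _ _).trans (add_le_add ((b s).le_of_opNorm_le (hn s hs) _) (he s hs))) t ht
  rw [gronwallBound_of_K_ne_0 hK.ne', sub_zero] at h
  have hε : 0 ≤ ε := (norm_nonneg _).trans (he 0 (by simp))
  have hexp : Real.exp (K * t) ≤ Real.exp K :=
    Real.exp_le_exp.2 (mul_le_of_le_one_right hK.le ht.2)
  refine h.trans (add_le_add (mul_le_mul_of_nonneg_left hexp (norm_nonneg _))
    (mul_le_mul_of_nonneg_left (sub_le_sub_right hexp 1) (by positivity)))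

/-- The Frobenius theorem for overdetermined linear systems `DS(x) h = B(x) h (S(x))`. -/
theorem exists_solution_of_integrable [CompleteSpace F] {B : E → E →L[ℝ] F →L[ℝ] F} {x₀ : E}
    (hB : ContDiffAt ℝ 2 B x₀)
    (hint : ∀ᶠ x in 𝓝 x₀, ∀ (p h : E) (f : F), fderiv ℝ B x p h f + B x h (B x p f) =
      fderiv ℝ B x h p f + B x p (B x h f)) (f₀ : F) :
    ∃ S : E → F, S x₀ = f₀ ∧ ∀ᶠ x in 𝓝 x₀, HasFDerivAt S ((B x).flip (S x)) x := by
  obtain ⟨K, hK, ε, hε, hb⟩ := exists_taylor_bound hB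
  obtain ⟨ε', hε', hint⟩ := Metric.eventually_nhds_iff_ball.1 hint
  -- `ε` and `ε'` are the radii of the Taylor bounds and of integrability; 1 bounds the vectors from
  -- `x₀`; `1 / (2 * K)` brings the coefficients along rays below `1 / 2`.
  set δ : ℝ := min (min ε ε') (min 1 (1 / (2 * K))) with hδ
  have hδ0 : 0 < δ := by positivity
  have hδε : δ ≤ ε := (min_le_left _ _).trans (min_le_left _ _)
  have hδε' : δ ≤ ε' := (min_le_left _ _).trans (min_le_right _ _)
  have hδ1 : δ ≤ 1 := (min_le_right _ _).trans (min_le_left _ _)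
  have hδK : K * δ ≤ 1 / 2 := by
    have h1 : δ ≤ 1 / (2 * K) := (min_le_right _ _).trans (min_le_right _ _)
    calc K * δ ≤ K * (1 / (2 * K)) := mul_le_mul_of_nonneg_left h1 hK.le
      _ = 1 / 2 := by field_simp
  have hc : ∀ x ∈ Metric.ball x₀ δ, ∀ t ∈ Set.Icc (0 : ℝ) 1,
      x₀ + t • (x - x₀) ∈ Metric.ball x₀ δ := fun x hx t ht => by
    rw [mem_ball_iff_norm, add_sub_cancel_left, norm_smul, Real.norm_eq_abs, abs_of_nonneg ht.1]
    exact (mul_le_of_le_one_left (norm_nonneg _) ht.2).trans_lt (mem_ball_iff_norm.1 hx)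
  have hcd : ∀ x ∈ Metric.ball x₀ δ, ∀ t ∈ Set.Icc (0 : ℝ) 1,
      HasDerivWithinAt (fun t : ℝ => B (x₀ + t • (x - x₀)))
        (fderiv ℝ B (x₀ + t • (x - x₀)) (x - x₀)) (Set.Icc 0 1) t := fun x hx t ht => by
    have h1 : HasDerivWithinAt (fun t : ℝ => x₀ + t • (x - x₀)) (x - x₀) (Set.Icc 0 1) t := by
      simpa using ((hasDerivAt_id t).smul_const (x - x₀)).const_add x₀ |>.hasDerivWithinAt
    exact (hb _ (Metric.ball_subset_ball hδε (hc x hx t ht))).1.hasFDerivAt.comp_hasDerivWithinAt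
      t h1
  have hbn : ∀ x ∈ Metric.ball x₀ δ, ∀ t ∈ Set.Icc (0 : ℝ) 1,
      ‖B (x₀ + t • (x - x₀)) (x - x₀)‖ ≤ 1 / 2 := fun x hx t ht => by
    refine ((B _).le_of_opNorm_le (hb _ (Metric.ball_subset_ball hδε (hc x hx t ht))).2.1 _).trans
      (le_trans ?_ hδK)
    exact mul_le_mul_of_nonneg_left (mem_ball_iff_norm.1 hx).le hK.le
  -- The value of the solution at `x` is obtained by integrating the system along the ray from `x₀`
  -- to `x`, up to time 1.
  have hex : ∀ x ∈ Metric.ball x₀ δ, ∃ u : ℝ → F, u 0 = f₀ ∧ ∀ t ∈ Set.Icc (0 : ℝ) 1,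
      HasDerivWithinAt u (B (x₀ + t • (x - x₀)) (x - x₀) (u t)) (Set.Icc 0 1) t := fun x hx =>
    exists_linear_ode_solution (b := fun t => B (x₀ + t • (x - x₀)) (x - x₀))
      (ContinuousOn.clm_apply (fun t ht => (hcd x hx t ht).continuousWithinAt) continuousOn_const)
      (hbn x hx) f₀
  choose! u hu0 hu using hex
  set U : ℝ := ‖f₀‖ * Real.exp (1 / 2) with hU
  have hU0 : 0 ≤ U := by positivity
  have hub : ∀ x ∈ Metric.ball x₀ δ, ∀ t ∈ Set.Icc (0 : ℝ) 1, ‖u x t‖ ≤ U := fun x hx t ht => by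
    have := norm_le_of_linear_ode (b := fun t => B (x₀ + t • (x - x₀)) (x - x₀)) (e := 0) (ε := 0)
      (K := 1 / 2) (by norm_num) (hbn x hx) (by simp) (by simpa using hu x hx) t ht
    simpa [hu0 x hx, hU] using this
  refine ⟨fun x => u x 1, ?_, ?_⟩
  · have hx₀ : x₀ ∈ Metric.ball x₀ δ := Metric.mem_ball_self hδ0
    have := norm_le_of_linear_ode (b := fun _ => (0 : F →L[ℝ] F)) (u := fun t => u x₀ t - f₀)
      (e := 0) (ε := 0) (K := 1) one_pos (by simp) (by simp)
      (fun t ht => by simpa using (hu x₀ hx₀ t ht).sub_const f₀) 1 (by simp)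
    simpa [hu0 x₀ hx₀, sub_eq_zero] using this
  set C : ℝ := (2 * K + 2 * K * K) * U with hC
  -- A quadratic remainder at every point `x` of the ball shows that the system holds in all
  -- directions, not only radially.
  have hquad : ∀ x ∈ Metric.ball x₀ δ, ∀ x' ∈ Metric.ball x₀ δ,
      ‖u x' 1 - u x 1 - B x (x' - x) (u x 1)‖ ≤ C / K * (Real.exp K - 1) * ‖x' - x‖ ^ 2 := by
    intro x hx x' hx'
    set p := x - x₀ with hp
    set h := x' - x with hh
    have hph : x' - x₀ = p + h := by rw [hp, hh]; abel
    have hpn : ‖p‖ ≤ 1 := (mem_ball_iff_norm.1 hx).le.trans hδ1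
    have hphn : ‖p + h‖ ≤ 1 := by rw [← hph]; exact (mem_ball_iff_norm.1 hx').le.trans hδ1
    set c : ℝ → E := fun t => x₀ + t • p with hcdef
    set c' : ℝ → E := fun t => x₀ + t • (p + h) with hc'def
    have hcc : ∀ t, c' t - c t = t • h := fun t => by simp only [hcdef, hc'def, smul_add]; abel
    -- At time `t` the rays to `x` and `x'` differ by `t • h`, so the subtracted term is the
    -- variation predicted by the system. Thus `e` starts at 0, ends at the wanted remainder, and
    -- satisfies a linear equation with an error `r` of order `‖h‖ ^ 2`.
    set e : ℝ → F := fun t => u x' t - u x t - t • B (c t) h (u x t) with he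
    set r : ℝ → F := fun t =>
      (B (c' t) - B (c t) - fderiv ℝ B (c t) (t • h)) p (u x t) + (B (c' t) - B (c t)) h (u x t) +
        t • ((B (c' t) - B (c t)) p (B (c t) h (u x t)) + B (c' t) h (B (c t) h (u x t))) with hr
    have hder : ∀ t ∈ Set.Icc (0 : ℝ) 1,
        HasDerivWithinAt e (B (c' t) (p + h) (e t) + r t) (Set.Icc 0 1) t := by
      intro t ht
      have h1 := hu x' hx' t ht
      have h2 := hu x hx t ht
      have h3 := hcd x hx t ht
      rw [hph] at h1
      have h4 := (h1.sub h2).sub ((hasDerivWithinAt_id t (Set.Icc 0 1)).smul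
        ((h3.clm_apply (hasDerivWithinAt_const t _ h)).clm_apply h2))
      refine h4.congr_deriv ?_
      -- Differentiating the predicted variation produces the derivative of `B` along `p`, applied
      -- to `h`. Integrability trades it for the derivative along `h`, applied to `p`, which is the
      -- first-order change of `B` from one ray to the other.
      have hi := hint (c t) (Metric.ball_subset_ball hδε' (hc x hx t ht)) p h (u x t)
      rw [← eq_sub_iff_add_eq] at hi
      simp only [he, hr, ← hp] at hi ⊢
      change B (c' t) (p + h) (u x' t) - B (c t) p (u x t) -
        (t • ((fderiv ℝ B (c t) p h + B (c t) 0) (u x t) + B (c t) h (B (c t) p (u x t))) +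
          (1 : ℝ) • B (c t) h (u x t)) = _
      simp only [map_zero, add_zero, hi, map_sub, map_add, map_smul, add_apply, sub_apply,
        smul_apply]
      module
    have hrn : ∀ t ∈ Set.Icc (0 : ℝ) 1, ‖r t‖ ≤ C * ‖h‖ ^ 2 := by
      intro t ht
      have hct := Metric.ball_subset_ball hδε (hc x hx t ht)
      have hc't := Metric.ball_subset_ball hδε (hc x' hx' t ht)
      rw [hph] at hc't
      obtain ⟨-, n1, n2⟩ := hb _ hct
      obtain ⟨n3, n4⟩ := n2 _ hc't
      obtain ⟨-, n5, -⟩ := hb _ hc't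
      rw [show x₀ + t • (p + h) - (x₀ + t • p) = t • h from hcc t] at n3 n4
      have hth : ‖t • h‖ ≤ ‖h‖ := by
        rw [norm_smul, Real.norm_eq_abs, abs_of_nonneg ht.1]
        exact mul_le_of_le_one_left (norm_nonneg _) ht.2
      have n3 : ‖B (c' t) - B (c t)‖ ≤ K * ‖h‖ := n3.trans (mul_le_mul_of_nonneg_left hth hK.le)
      have n4 : ‖B (c' t) - B (c t) - fderiv ℝ B (c t) (t • h)‖ ≤ K * ‖h‖ ^ 2 :=
        n4.trans (by gcongr)
      have hun := hub x hx t ht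
      have hh0 := norm_nonneg h
      have q0 : ‖B (c t) h (u x t)‖ ≤ K * ‖h‖ * U :=
        (ContinuousLinearMap.le_opNorm₂ _ _ _).trans (by gcongr)
      have q1 : ‖(B (c' t) - B (c t) - fderiv ℝ B (c t) (t • h)) p (u x t)‖ ≤
          K * ‖h‖ ^ 2 * 1 * U := (ContinuousLinearMap.le_opNorm₂ _ _ _).trans (by gcongr)
      have q2 : ‖(B (c' t) - B (c t)) h (u x t)‖ ≤ K * ‖h‖ * ‖h‖ * U :=
        (ContinuousLinearMap.le_opNorm₂ _ _ _).trans (by gcongr)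
      have q3 : ‖(B (c' t) - B (c t)) p (B (c t) h (u x t))‖ ≤ K * ‖h‖ * 1 * (K * ‖h‖ * U) :=
        (ContinuousLinearMap.le_opNorm₂ _ _ _).trans (by gcongr)
      have q4 : ‖B (c' t) h (B (c t) h (u x t))‖ ≤ K * ‖h‖ * (K * ‖h‖ * U) :=
        (ContinuousLinearMap.le_opNorm₂ _ _ _).trans (by gcongr)
      have q5 : ‖t • ((B (c' t) - B (c t)) p (B (c t) h (u x t)) +
          B (c' t) h (B (c t) h (u x t)))‖ ≤
          K * ‖h‖ * 1 * (K * ‖h‖ * U) + K * ‖h‖ * (K * ‖h‖ * U) := by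
        rw [norm_smul, Real.norm_eq_abs, abs_of_nonneg ht.1]
        exact (mul_le_of_le_one_left (norm_nonneg _) ht.2).trans (norm_add_le_of_le q3 q4)
      refine (norm_add_le_of_le (norm_add_le_of_le q1 q2) q5).trans (le_of_eq ?_)
      rw [hC]
      ring
    have hfin := norm_le_of_linear_ode (b := fun t => B (c' t) (p + h)) (e := r) (u := e)
      (ε := C * ‖h‖ ^ 2) hK (fun t ht => by
        have hc't := Metric.ball_subset_ball hδε (hc x' hx' t ht)
        rw [hph] at hc't
        exact ((B (c' t)).le_of_opNorm_le (hb _ hc't).2.1 _).trans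
          (mul_le_of_le_one_right hK.le hphn)) hrn hder 1 (by simp)
    have he0 : e 0 = 0 := by simp [he, hu0 x hx, hu0 x' hx']
    have he1 : e 1 = u x' 1 - u x 1 - B x h (u x 1) := by simp [he, hcdef, hp]
    rw [he0, he1, norm_zero, zero_mul, zero_add] at hfin
    exact hfin.trans (le_of_eq (by ring))
  filter_upwards [Metric.ball_mem_nhds x₀ hδ0] with x hx
  have hO : (fun x' => u x' 1 - u x 1 - B x (x' - x) (u x 1)) =O[𝓝 x] fun x' => ‖x' - x‖ ^ 2 := by
    refine Asymptotics.IsBigO.of_bound (C / K * (Real.exp K - 1)) ?_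
    filter_upwards [Metric.isOpen_ball.mem_nhds hx] with x' hx'
    simpa using hquad x hx x' hx'
  have h0 := hO.hasFDerivAt (𝕜 := ℝ) one_lt_two
  have h1 : HasFDerivAt (fun x' => u x 1 + (B x).flip (u x 1) (x' - x)) ((B x).flip (u x 1)) x :=
    (((B x).flip (u x 1)).hasFDerivAt.comp x ((hasFDerivAt_id x).sub_const x)).const_add _
  refine ((h0.add h1).congr_fderiv (zero_add _)).congr_of_eventuallyEq
    (Filter.Eventually.of_forall fun x' => ?_)
  simp

/-- Solutions of a linear system with smooth coefficients are smooth. -/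
lemma contDiffOn_of_linear_system {B : E → E →L[ℝ] F →L[ℝ] F} {S : E → F} {T : Set E}
    (hT : IsOpen T) (hB : ContDiffOn ℝ ∞ B T)
    (hS : ∀ x ∈ T, HasFDerivAt S ((B x).flip (S x)) x) : ContDiffOn ℝ ∞ S T := by
  -- Bootstrapping: the derivative of `S` is bilinear in `B` and `S`, hence as regular as `S`
  -- itself.
  refine contDiffOn_infty.2 fun n => ?_
  induction n with
  | zero => exact contDiffOn_zero.2 fun x hx => (hS x hx).continuousAt.continuousWithinAt
  | succ n ih =>
    rw [Nat.cast_add, Nat.cast_one, contDiffOn_succ_iff_fderiv_of_isOpen hT]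
    refine ⟨fun x hx => (hS x hx).differentiableAt.differentiableWithinAt, by simp, ?_⟩
    have hB' : ContDiffOn ℝ n (fun x => (B x).flip) T :=
      (ContinuousLinearMap.flipₗᵢ ℝ E F F).contDiff.comp_contDiffOn
        (hB.of_le (by exact_mod_cast le_top))
    exact (hB'.clm_apply ih).congr fun x hx => (hS x hx).fderiv

/-- Solutions of linear systems are determined near a point by their value there. -/
lemma eventually_eq_zero_of_linear_system {B : E → E →L[ℝ] F →L[ℝ] F} {S : E → F} {x₀ : E}
    (hB : ContinuousAt B x₀) (hS : ∀ᶠ x in 𝓝 x₀, HasFDerivAt S ((B x).flip (S x)) x)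
    (h0 : S x₀ = 0) : ∀ᶠ x in 𝓝 x₀, S x = 0 := by
  have h1 := hB.norm.eventually (gt_mem_nhds (lt_add_one _))
  obtain ⟨ε, hε, hb⟩ := Metric.eventually_nhds_iff_ball.1 (hS.and h1)
  filter_upwards [Metric.ball_mem_nhds x₀ hε] with x hx
  have hc : ∀ t ∈ Set.Icc (0 : ℝ) 1, x₀ + t • (x - x₀) ∈ Metric.ball x₀ ε := fun t ht => by
    rw [mem_ball_iff_norm, add_sub_cancel_left, norm_smul, Real.norm_eq_abs, abs_of_nonneg ht.1]
    exact (mul_le_of_le_one_left (norm_nonneg _) ht.2).trans_lt (mem_ball_iff_norm.1 hx)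
  -- The first `+ 1` is the local bound on `B`; the second keeps the Grönwall constant positive at
  -- `x = x₀`.
  have hpos : 0 < (‖B x₀‖ + 1) * (‖x - x₀‖ + 1) := by positivity
  have := norm_le_of_linear_ode (b := fun t => B (x₀ + t • (x - x₀)) (x - x₀))
    (u := fun t => S (x₀ + t • (x - x₀))) (e := 0) (ε := 0)
    (K := (‖B x₀‖ + 1) * (‖x - x₀‖ + 1)) hpos
    (fun t ht => ((B _).le_of_opNorm_le (hb _ (hc t ht)).2.le _).trans
      (mul_le_mul_of_nonneg_left (lt_add_one _).le (by positivity))) (by simp)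
    (fun t ht => by
      have h2 : HasDerivWithinAt (fun t : ℝ => x₀ + t • (x - x₀)) (x - x₀) (Set.Icc 0 1) t := by
        simpa using ((hasDerivAt_id t).smul_const (x - x₀)).const_add x₀ |>.hasDerivWithinAt
      exact ((hb _ (hc t ht)).1.comp_hasDerivWithinAt t h2).congr_deriv (by simp)) 1 (by simp)
  simpa [h0] using this

end Frobenius

end

section

section HessianSystem

/-! ### The Hessian equation as a linear system for the 1-jet -/

variable {E : Type*} [NormedAddCommGroup E] [NormedSpace ℝ E] [FiniteDimensional ℝ E]
  {G : Type*} [NormedAddCommGroup G] [NormedSpace ℝ G] [FiniteDimensional ℝ G]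
  {A : E → E →L[ℝ] E →L[ℝ] E} {S : E → E →L[ℝ] E →L[ℝ] ℝ} {x₀ : E} {T : Set E}

/-- `f` solves `∇² f = f S` at `x`, for the connection with Christoffel symbols `A`. -/
def HessianEqAt (A : E → E →L[ℝ] E →L[ℝ] E) (S : E → E →L[ℝ] E →L[ℝ] ℝ) (f : E → G) (x : E) :
    Prop :=
  ∀ u v : E, fderiv ℝ (fderiv ℝ f) x u v = fderiv ℝ f x (A x v u) + S x u v • f x

variable (G) in
/-- The coefficients of the linear system for the 1-jets of solutions of `∇² f = f S`. -/
def jetSystem (A : E → E →L[ℝ] E →L[ℝ] E) (S : E → E →L[ℝ] E →L[ℝ] ℝ) (x : E) :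
    E →L[ℝ] (G × (E →L[ℝ] G)) →L[ℝ] (G × (E →L[ℝ] G)) :=
  (LinearMap.mk₂ ℝ (fun (u : E) (q : G × (E →L[ℝ] G)) =>
      (q.2 u, q.2 ∘L (A x).flip u + (S x u).smulRight q.1))
    (fun u u' q => by ext <;> simp [add_smul]; abel)
    (fun c u q => by ext <;> simp [smul_smul])
    (fun u q q' => by ext <;> simp; abel)
    (fun c u q => by ext <;> simp [smul_comm c])).toContinuousBilinearMap

lemma jetSystem_apply (x u : E) (q : G × (E →L[ℝ] G)) :
    jetSystem G A S x u q = (q.2 u, q.2 ∘L (A x).flip u + (S x u).smulRight q.1) := rfl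

lemma contDiffOn_jetSystem (hA : ContDiffOn ℝ ∞ A T) (hS : ContDiffOn ℝ ∞ S T) :
    ContDiffOn ℝ ∞ (jetSystem G A S) T := by
  refine contDiffOn_clm_apply.2 fun u => contDiffOn_clm_apply.2 fun q => ?_
  simp only [jetSystem_apply]
  refine contDiffOn_const.prodMk (contDiffOn_clm_apply.2 fun v => ?_)
  simp only [add_apply, ContinuousLinearMap.comp_apply, ContinuousLinearMap.flip_apply,
    ContinuousLinearMap.smulRight_apply]
  exact (q.2.contDiff.comp_contDiffOn ((hA.clm_apply contDiffOn_const).clm_apply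
    contDiffOn_const)).add (((hS.clm_apply contDiffOn_const).clm_apply contDiffOn_const).smul
      contDiffOn_const)

/-- The right-hand side of the Hessian equation involves only `f` and `df`, so the equation closes
up on the 1-jet. Regularity and uniqueness of solutions follow from those of linear systems. -/
lemma HessianEqAt.hasFDerivAt_jet {f : E → G} {x : E} (hf : ContDiffAt ℝ 2 f x)
    (h : HessianEqAt A S f x) :
    HasFDerivAt (fun z => (f z, fderiv ℝ f z))
      ((jetSystem G A S x).flip (f x, fderiv ℝ f x)) x := by
  have h1 : HasFDerivAt f (fderiv ℝ f x) x := (hf.differentiableAt two_ne_zero).hasFDerivAt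
  have h2 : HasFDerivAt (fderiv ℝ f) (fderiv ℝ (fderiv ℝ f) x) x :=
    ((hf.fderiv_right (m := 1) (by norm_num)).differentiableAt one_ne_zero).hasFDerivAt
  have h3 : (jetSystem G A S x).flip (f x, fderiv ℝ f x) =
      (fderiv ℝ f x).prod (fderiv ℝ (fderiv ℝ f) x) := by
    refine ContinuousLinearMap.ext fun u => ?_
    rw [ContinuousLinearMap.flip_apply, jetSystem_apply, ContinuousLinearMap.prod_apply]
    have h4 : fderiv ℝ f x ∘L (A x).flip u + (S x u).smulRight (f x) =
        fderiv ℝ (fderiv ℝ f) x u := ContinuousLinearMap.ext fun v => (h u v).symm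
    rw [h4]
  rw [h3]
  exact h1.prodMk h2

/-- `C²` solutions of the Hessian equation are smooth. -/
lemma contDiffOn_of_hessianEqAt {f : E → G} (hT : IsOpen T) (hA : ContDiffOn ℝ ∞ A T)
    (hS : ContDiffOn ℝ ∞ S T) (hf : ∀ x ∈ T, ContDiffAt ℝ 2 f x)
    (h : ∀ x ∈ T, HessianEqAt A S f x) : ContDiffOn ℝ ∞ f T := by
  have h1 : ContDiffOn ℝ ∞ (fun z => (f z, fderiv ℝ f z)) T :=
    contDiffOn_of_linear_system (B := jetSystem G A S) hT (contDiffOn_jetSystem hA hS)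
      fun x hx => (h x hx).hasFDerivAt_jet (hf x hx)
  exact h1.fst

lemma eventually_eq_zero_of_hessianEqAt {f : E → G} (hT : IsOpen T) (hx₀ : x₀ ∈ T)
    (hA : ContDiffOn ℝ ∞ A T) (hS : ContDiffOn ℝ ∞ S T)
    (h : ∀ᶠ x in 𝓝 x₀, ContDiffAt ℝ 2 f x ∧ HessianEqAt A S f x)
    (h0 : f x₀ = 0) (h1 : fderiv ℝ f x₀ = 0) : ∀ᶠ x in 𝓝 x₀, f x = 0 := by
  have hB := ((contDiffOn_jetSystem (G := G) hA hS).contDiffAt (hT.mem_nhds hx₀)).continuousAt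
  filter_upwards [eventually_eq_zero_of_linear_system hB
    (h.mono fun x hx => hx.2.hasFDerivAt_jet hx.1) (by simp [h0, h1])] with x hx
  exact congrArg Prod.fst hx

/-- Needed to write out the integrability condition of the system with `S = 0`. It is computed
componentwise, on fixed arguments, to avoid differentiating operator-valued maps. -/
lemma fderiv_jetSystem_zero {x : E} (hT : IsOpen T) (hx : x ∈ T) (hA : ContDiffOn ℝ ∞ A T)
    (p u : E) (q : G × (E →L[ℝ] G)) :
    fderiv ℝ (jetSystem G A 0) x p u q = (0, q.2 ∘L (fderiv ℝ A x p).flip u) := by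
  have hd : DifferentiableAt ℝ (jetSystem G A 0) x :=
    ((contDiffOn_jetSystem (G := G) hA (contDiffOn_const (c := 0))).contDiffAt
      (hT.mem_nhds hx)).differentiableAt (by simp)
  have hAd : DifferentiableAt ℝ A x :=
    (hA.contDiffAt (hT.mem_nhds hx)).differentiableAt (by simp)
  have hq : DifferentiableAt ℝ (fun y => jetSystem G A 0 y u q) x :=
    (hd.clm_apply (differentiableAt_const u)).clm_apply (differentiableAt_const q)
  have h1 : fderiv ℝ (jetSystem G A 0) x p u q = fderiv ℝ (fun y => jetSystem G A 0 y u q) x p := by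
    rw [fderiv_clm_apply (hd.clm_apply (differentiableAt_const u)) (differentiableAt_const q),
      fderiv_clm_apply hd (differentiableAt_const u)]
    simp
  rw [h1]
  refine Prod.ext ?_ (ContinuousLinearMap.ext fun v => ?_)
  · have := (ContinuousLinearMap.fst ℝ G (E →L[ℝ] G)).hasFDerivAt.comp x hq.hasFDerivAt
    exact congrArg (fun L : E →L[ℝ] G => L p)
      (this.unique (hasFDerivAt_const (q.2 u) x))
  · have h2 := (((ContinuousLinearMap.apply ℝ G v).comp
      (ContinuousLinearMap.snd ℝ G (E →L[ℝ] G))).hasFDerivAt.comp x hq.hasFDerivAt)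
    have h3 : HasFDerivAt (fun y => q.2 (A y v u)) _ x :=
      q.2.hasFDerivAt.comp x ((hAd.clm_apply (differentiableAt_const v)).clm_apply
        (differentiableAt_const u)).hasFDerivAt
    have h4 : (fun y => q.2 (A y v u)) = (ContinuousLinearMap.apply ℝ G v).comp
      (ContinuousLinearMap.snd ℝ G (E →L[ℝ] G)) ∘ fun y => jetSystem G A 0 y u q := by
      funext y
      simp [jetSystem_apply]
    rw [← h4] at h2
    have h5 := congrArg (fun L : E →L[ℝ] G => L p) (h2.unique h3)
    rw [fderiv_clm_apply (hAd.clm_apply (differentiableAt_const v)) (differentiableAt_const u),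
      fderiv_clm_apply hAd (differentiableAt_const v)] at h5
    simpa using h5

/-- A flat torsion-free connection has affine functions with arbitrary 1-jet. -/
lemma exists_affine_of_flat (hT : IsOpen T) (hx₀ : x₀ ∈ T) (hA : ContDiffOn ℝ ∞ A T)
    (hsymm : ∀ x ∈ T, ∀ u v, A x u v = A x v u)
    (hflat : ∀ x ∈ T, ∀ u v w, localCurvature A x u v w = 0) (g₀ : G) (L₀ : E →L[ℝ] G) :
    ∃ h : E → G, h x₀ = g₀ ∧ fderiv ℝ h x₀ = L₀ ∧
      ∀ᶠ x in 𝓝 x₀, ContDiffAt ℝ ∞ h x ∧ HessianEqAt A 0 h x := by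
  have hB := contDiffOn_jetSystem (G := G) hA (contDiffOn_const (c := 0))
  have hG : CompleteSpace (G × (E →L[ℝ] G)) := FiniteDimensional.complete ℝ _
  obtain ⟨S, hS0, hS⟩ := exists_solution_of_integrable (B := jetSystem G A 0) (x₀ := x₀)
    ((hB.contDiffAt (hT.mem_nhds hx₀)).of_le two_le_infty) (by
      filter_upwards [hT.mem_nhds hx₀] with x hx p u q
      rw [fderiv_jetSystem_zero hT hx hA, fderiv_jetSystem_zero hT hx hA]
      simp only [jetSystem_apply]
      -- Integrability has two components: for the value it is the symmetry of `A`, for the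
      -- differential it is the vanishing of the curvature.
      refine Prod.ext ?_ (ContinuousLinearMap.ext fun v => ?_)
      · simp [hsymm x hx p u]
      · have h1 := congrArg q.2 (hflat x hx p u v)
        simp only [localCurvature, map_sub, map_add, map_zero] at h1
        simp
        rw [← sub_eq_zero, ← h1]
        abel) (g₀, L₀)
  obtain ⟨V, hV, hoV, hxV⟩ := mem_nhds_iff.1 (hS.and (hT.mem_nhds hx₀))
  have hsmooth : ContDiffOn ℝ ∞ S V :=
    contDiffOn_of_linear_system hoV (hB.mono fun x hx => (hV hx).2) fun x hx => (hV hx).1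
  have hfst : ∀ x ∈ V, HasFDerivAt (fun z => (S z).1) (S x).2 x := fun x hx =>
    ((ContinuousLinearMap.fst ℝ G (E →L[ℝ] G)).hasFDerivAt.comp x (hV hx).1).congr_fderiv
      (ContinuousLinearMap.ext fun u => rfl)
  refine ⟨fun z => (S z).1, by simp [hS0], by rw [(hfst x₀ hxV).fderiv, hS0], ?_⟩
  filter_upwards [hoV.mem_nhds hxV] with x hx
  refine ⟨contDiffAt_fst.comp x (hsmooth.contDiffAt (hoV.mem_nhds hx)), fun u v => ?_⟩
  have h1 : fderiv ℝ (fun z => (S z).1) =ᶠ[𝓝 x] fun z => (S z).2 := by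
    filter_upwards [hoV.mem_nhds hx] with z hz using (hfst z hz).fderiv
  rw [h1.fderiv_eq, h1.self_of_nhds]
  have h2 : HasFDerivAt (fun z => (S z).2) _ x :=
    (ContinuousLinearMap.snd ℝ G (E →L[ℝ] G)).hasFDerivAt.comp x (hV hx).1
  rw [h2.fderiv]
  simp [jetSystem_apply]

end HessianSystem

end

section

section ProjectiveChange

lemma three_le_infty : (3 : ℕ∞ω) ≤ ∞ := ENat.LEInfty.out

/-! ### Projective changes of a connection on an open set of a vector space -/

variable {E : Type*} [NormedAddCommGroup E] [NormedSpace ℝ E]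
  {G : Type*} [NormedAddCommGroup G] [NormedSpace ℝ G]
  {A : E → E →L[ℝ] E →L[ℝ] E} {S : E → E →L[ℝ] E →L[ℝ] ℝ} {x : E} {φ : E → ℝ} {h : E → E}

lemma fderiv_fderiv_smul {φ : E → ℝ} {g : E → G} (hφ : ContDiffAt ℝ 2 φ x)
    (hg : ContDiffAt ℝ 2 g x) (u v : E) :
    fderiv ℝ (fderiv ℝ (fun z => φ z • g z)) x u v =
      fderiv ℝ (fderiv ℝ φ) x u v • g x + fderiv ℝ φ x v • fderiv ℝ g x u +
        fderiv ℝ φ x u • fderiv ℝ g x v + φ x • fderiv ℝ (fderiv ℝ g) x u v := by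
  have h1 : fderiv ℝ (fun z => φ z • g z) =ᶠ[𝓝 x]
      fun z => φ z • fderiv ℝ g z + (fderiv ℝ φ z).smulRight (g z) := by
    filter_upwards [hφ.eventually (by simp), hg.eventually (by simp)] with z hz hz'
    exact fderiv_fun_smul (hz.differentiableAt two_ne_zero) (hz'.differentiableAt two_ne_zero)
  have d1 : HasFDerivAt φ (fderiv ℝ φ x) x := (hφ.differentiableAt two_ne_zero).hasFDerivAt
  have d2 : HasFDerivAt g (fderiv ℝ g x) x := (hg.differentiableAt two_ne_zero).hasFDerivAt
  have d3 : HasFDerivAt (fderiv ℝ φ) (fderiv ℝ (fderiv ℝ φ) x) x :=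
    ((hφ.fderiv_right (m := 1) (by norm_num)).differentiableAt one_ne_zero).hasFDerivAt
  have d4 : HasFDerivAt (fderiv ℝ g) (fderiv ℝ (fderiv ℝ g) x) x :=
    ((hg.fderiv_right (m := 1) (by norm_num)).differentiableAt one_ne_zero).hasFDerivAt
  have h2 : HasFDerivAt (fun z => fderiv ℝ φ z v • g z + φ z • fderiv ℝ g z v) _ x :=
    ((d3.clm_apply (hasFDerivAt_const v x)).smul d2).add
      (d1.smul (d4.clm_apply (hasFDerivAt_const v x)))
  have h3 : (fun z => fderiv ℝ (fun z => φ z • g z) z v) =ᶠ[𝓝 x]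
      fun z => fderiv ℝ φ z v • g z + φ z • fderiv ℝ g z v := by
    filter_upwards [h1] with z hz
    rw [hz]
    simp [add_comm]
  have h4 : DifferentiableAt ℝ (fderiv ℝ (fun z => φ z • g z)) x :=
    (((hφ.smul hg).fderiv_right (m := 1) (by norm_num)).differentiableAt one_ne_zero)
  have h5 := congrArg (fun L : E →L[ℝ] G => L u) (h3.fderiv_eq.trans h2.fderiv)
  rw [fderiv_clm_apply h4 (differentiableAt_const v)] at h5
  simp at h5
  rw [h5]
  abel

lemma HessianEqAt.clm_comp {G' : Type*} [NormedAddCommGroup G'] [NormedSpace ℝ G'] {f : E → G}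
    (hf : ContDiffAt ℝ 2 f x) (h : HessianEqAt A S f x) (L : G →L[ℝ] G') :
    HessianEqAt A S (fun z => L (f z)) x := by
  intro u v
  have h1 : fderiv ℝ (fun z => L (f z)) =ᶠ[𝓝 x] fun z => L ∘L fderiv ℝ f z := by
    filter_upwards [hf.eventually (by simp)] with z hz
    exact (L.hasFDerivAt.comp z (hz.differentiableAt two_ne_zero).hasFDerivAt).fderiv
  have d4 : HasFDerivAt (fderiv ℝ f) (fderiv ℝ (fderiv ℝ f) x) x :=
    ((hf.fderiv_right (m := 1) (by norm_num)).differentiableAt one_ne_zero).hasFDerivAt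
  have h2 : HasFDerivAt (fun z => L ∘L fderiv ℝ f z) _ x :=
    ((ContinuousLinearMap.compL ℝ E G G') L).hasFDerivAt.comp x d4
  rw [h1.fderiv_eq, h1.self_of_nhds, h2.fderiv]
  simp [h u v]

lemma HessianEqAt.congr {f g : E → G} (h : HessianEqAt A S f x) (hfg : g =ᶠ[𝓝 x] f) :
    HessianEqAt A S g x := by
  intro u v
  rw [hfg.fderiv.fderiv_eq, hfg.fderiv_eq, hfg.self_of_nhds, h u v]

/-- Up to the factor `φ`, the function `h` has vanishing Hessian for the projectively changed
connection `∇_u v - θ(u) v - θ(v) u`, `θ = d log φ`, at the point `x`, and is an immersion. -/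
structure IsProjectivelyAffineAt (A : E → E →L[ℝ] E →L[ℝ] E) (φ : E → ℝ) (h : E → E) (x : E) :
    Prop where
  ne_zero : φ x ≠ 0
  contDiffAt_factor : ContDiffAt ℝ ∞ φ x
  contDiffAt : ContDiffAt ℝ ∞ h x
  injective : Function.Injective (fderiv ℝ h x)
  hessian_eq : ∀ u v, φ x • fderiv ℝ (fderiv ℝ h) x u v =
    φ x • fderiv ℝ h x (A x v u) - fderiv ℝ φ x u • fderiv ℝ h x v
      - fderiv ℝ φ x v • fderiv ℝ h x u

/-- The tensor `S` with `∇² φ = φ S`. -/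
def inducedPotential (A : E → E →L[ℝ] E →L[ℝ] E) (φ : E → ℝ) (x : E) : E →L[ℝ] E →L[ℝ] ℝ :=
  (φ x)⁻¹ • (fderiv ℝ (fderiv ℝ φ) x -
    ((ContinuousLinearMap.compL ℝ E E ℝ (fderiv ℝ φ x)) ∘L A x).flip)

lemma inducedPotential_apply (u v : E) : inducedPotential A φ x u v =
    (φ x)⁻¹ * (fderiv ℝ (fderiv ℝ φ) x u v - fderiv ℝ φ x (A x v u)) := rfl

lemma HessianEqAt.inducedPotential_eq (hx : φ x ≠ 0) (h : HessianEqAt A S φ x) :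
    inducedPotential A φ x = S x := by
  ext u v
  rw [inducedPotential_apply, h u v, add_sub_cancel_left, smul_eq_mul, mul_comm, mul_assoc,
    mul_inv_cancel₀ hx, mul_one]

lemma inducedPotential_symm (hφ : ContDiffAt ℝ 2 φ x) (hA : ∀ u v, A x u v = A x v u) (u v : E) :
    inducedPotential A φ x u v = inducedPotential A φ x v u := by
  have hs : IsSymmSndFDerivAt ℝ φ x := hφ.isSymmSndFDerivAt (by simp)
  rw [inducedPotential_apply, inducedPotential_apply, hs.eq, hA u v]

lemma differentiableAt_inducedPotential (hA : DifferentiableAt ℝ A x) (hφ : ContDiffAt ℝ ∞ φ x)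
    (hx : φ x ≠ 0) : DifferentiableAt ℝ (inducedPotential A φ) x := by
  have d1 : DifferentiableAt ℝ (fderiv ℝ φ) x :=
    (hφ.fderiv_right (m := ∞) (by simp)).differentiableAt (by simp)
  have d2 : DifferentiableAt ℝ (fderiv ℝ (fderiv ℝ φ)) x :=
    ((hφ.fderiv_right (m := ∞) (by simp)).fderiv_right (m := ∞) (by simp)).differentiableAt
      (by simp)
  have d3 : DifferentiableAt ℝ (fun x => (ContinuousLinearMap.compL ℝ E E ℝ (fderiv ℝ φ x)) ∘L A x)
      x := ((ContinuousLinearMap.compL ℝ E E ℝ).differentiableAt.comp x d1).clm_comp hA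
  have d4 := (ContinuousLinearMap.flipₗᵢ ℝ E E ℝ).differentiableAt.comp x d3
  exact ((hφ.differentiableAt (by simp)).inv hx).smul (d2.sub d4)

namespace IsProjectivelyAffineAt

/-- The mixed first-order terms of the product rule cancel against those in the Hessian of `h`,
leaving the Hessian of `φ` times `c + l ∘ h`. So the one tensor `S` serves all `c` and `l`. -/
lemma hessianEqAt (H : IsProjectivelyAffineAt A φ h x) (c : ℝ) (l : E →L[ℝ] ℝ) :
    HessianEqAt A (inducedPotential A φ) (fun z => φ z • (c + l (h z))) x := by
  intro u v
  have hφ := H.contDiffAt_factor.of_le two_le_infty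
  have hh := H.contDiffAt.of_le two_le_infty
  have hg : ContDiffAt ℝ 2 (fun z => c + l (h z)) x :=
    contDiffAt_const.add (l.contDiff.contDiffAt.comp x hh)
  have g1 : fderiv ℝ (fun z => c + l (h z)) =ᶠ[𝓝 x] fun z => l ∘L fderiv ℝ h z := by
    filter_upwards [hh.eventually (by simp)] with z hz
    exact ((l.hasFDerivAt.comp z (hz.differentiableAt two_ne_zero).hasFDerivAt).const_add c).fderiv
  have d4 : HasFDerivAt (fderiv ℝ h) (fderiv ℝ (fderiv ℝ h) x) x :=
    ((hh.fderiv_right (m := 1) (by norm_num)).differentiableAt one_ne_zero).hasFDerivAt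
  have h2 : HasFDerivAt (fun z => l ∘L fderiv ℝ h z) _ x :=
    ((ContinuousLinearMap.compL ℝ E E ℝ) l).hasFDerivAt.comp x d4
  have hl := congrArg l (H.hessian_eq u v)
  have hf : fderiv ℝ (fun z => φ z • (c + l (h z))) x =
      φ x • (l ∘L fderiv ℝ h x) + (fderiv ℝ φ x).smulRight (c + l (h x)) := by
    rw [fderiv_fun_smul (hφ.differentiableAt two_ne_zero) (hg.differentiableAt two_ne_zero),
      g1.self_of_nhds]
  rw [fderiv_fderiv_smul hφ hg, g1.fderiv_eq, g1.self_of_nhds, h2.fderiv, inducedPotential_apply,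
    hf]
  simp at hl ⊢
  rw [hl]
  have := H.ne_zero
  field_simp
  ring

/-- The curvature of a projectively flat connection. -/
lemma localCurvature_eq [FiniteDimensional ℝ E] (hA : DifferentiableAt ℝ A x)
    (H : ∀ᶠ z in 𝓝 x, IsProjectivelyAffineAt A φ h z) (w u v : E) :
    localCurvature A x w u v = inducedPotential A φ x w v • u - inducedPotential A φ x u v • w := by
  have Hx := H.self_of_nhds
  -- As `dh` is injective, it suffices to test with `l ∘ dh` for all covectors `l`. Up to the factor
  -- `φ x`, this is the differential at `x` of the solution `φ (-l(h x) + l ∘ h)`, which vanishes at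
  -- `x`, so the Ricci identity applies.
  apply Hx.injective
  refine (SeparatingDual.eq_iff_forall_dual_eq (R := ℝ)).2 fun l => ?_
  have hd : HasFDerivAt (fun z => φ z • (-(l (h x)) + l (h z))) (φ x • (l ∘L fderiv ℝ h x)) x := by
    have h1 := (Hx.contDiffAt_factor.differentiableAt (by simp)).hasFDerivAt.fun_smul
      ((l.hasFDerivAt.comp x (Hx.contDiffAt.differentiableAt (by simp)).hasFDerivAt).const_add
        (-(l (h x))))
    refine h1.congr_fderiv ?_
    ext z
    simp
  have := fderiv_localCurvature_of_solution (f := fun z => φ z • (-(l (h x)) + l (h z))) hA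
    (differentiableAt_inducedPotential hA Hx.contDiffAt_factor Hx.ne_zero)
    ((Hx.contDiffAt_factor.smul (contDiffAt_const.add
      (l.contDiff.contDiffAt.comp x Hx.contDiffAt))).of_le three_le_infty)
    (H.mono fun z hz u v => (hz.hessianEqAt _ l u v).trans
      (by rw [smul_eq_mul, mul_comm (inducedPotential _ _ _ _ _)])) (by simp) w u v
  rw [hd.fderiv] at this
  simp at this ⊢
  have h0 := Hx.ne_zero
  refine mul_left_cancel₀ h0 (this.trans ?_)
  ring

/-- The trace of `w ↦ S(w, v) u - S(u, v) w`: the first summand has rank at most one and trace `S(u,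
v)`, the second is a multiple of the identity. -/
lemma localRicci_eq [FiniteDimensional ℝ E] (hA : DifferentiableAt ℝ A x)
    (H : ∀ᶠ z in 𝓝 x, IsProjectivelyAffineAt A φ h z) (u v : E) :
    localRicci A x u v = inducedPotential A φ x u v - Module.finrank ℝ E * inducedPotential A φ x u v := by
  have h1 : localCurvatureEnd A x u v =
      ((inducedPotential A φ x).flip v).smulRight u -
        inducedPotential A φ x u v • ContinuousLinearMap.id ℝ E := by
    ext w
    rw [localCurvatureEnd_apply, localCurvature_eq hA H]
    simp
  rw [localRicci_apply, h1, map_sub, map_smul, traceCLM_apply, traceCLM_apply]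
  have h2 : LinearMap.trace ℝ E ((ContinuousLinearMap.id ℝ E : E →L[ℝ] E) : E →ₗ[ℝ] E) =
      Module.finrank ℝ E := LinearMap.trace_id ℝ E
  have h3 : LinearMap.trace ℝ E ((((inducedPotential A φ x).flip v).smulRight u : E →L[ℝ] E) :
      E →ₗ[ℝ] E) = inducedPotential A φ x u v :=
    LinearMap.trace_smulRight ((inducedPotential A φ x).flip v : E →ₗ[ℝ] ℝ) u
  rw [h2, h3, smul_eq_mul, mul_comm]

end IsProjectivelyAffineAt

/-- Quotients of solutions are projectively affine. -/
lemma isProjectivelyAffineAt_quotient {ψ : E → E} (hx : φ x ≠ 0) (hφ : ContDiffAt ℝ ∞ φ x)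
    (hψ : ContDiffAt ℝ ∞ ψ x) (h1 : HessianEqAt A S φ x) (h2 : HessianEqAt A S ψ x)
    (hinj : Function.Injective (fderiv ℝ (fun z => (φ z)⁻¹ • ψ z) x)) :
    IsProjectivelyAffineAt A φ (fun z => (φ z)⁻¹ • ψ z) x := by
  set h : E → E := fun z => (φ z)⁻¹ • ψ z with hh
  have hc : ContDiffAt ℝ ∞ h x := (hφ.inv hx).smul hψ
  refine ⟨hx, hφ, hc, hinj, fun u v => ?_⟩
  -- The product rule for `φ h` is compared with the equations for `ψ` and `φ`; the terms containing
  -- `S` cancel, since both solve the same equation.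
  have he : ψ =ᶠ[𝓝 x] fun z => φ z • h z := by
    filter_upwards [hφ.continuousAt.eventually_ne hx] with z hz
    rw [hh, smul_inv_smul₀ hz]
  have h3 := (h2.congr he.symm) u v
  rw [fderiv_fderiv_smul (hφ.of_le two_le_infty) (hc.of_le two_le_infty), h1 u v,
    fderiv_fun_smul (hφ.differentiableAt (by simp)) (hc.differentiableAt (by simp))] at h3
  simp [add_smul] at h3
  rw [smul_comm (S x u v), mul_smul] at h3
  have h4 : φ x • fderiv ℝ (fderiv ℝ h) x u v = (φ x • (fderiv ℝ h x) (A x v u) +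
    (fderiv ℝ φ x) (A x v u) • h x + φ x • S x u v • h x) - (((fderiv ℝ φ x) (A x v u) • h x +
      S x u v • φ x • h x) + fderiv ℝ φ x v • fderiv ℝ h x u +
        fderiv ℝ φ x u • fderiv ℝ h x v) := by
    rw [← h3]
    module
  rw [h4]
  module

/-- The bilinear map `(v, u) ↦ θ(v) u + θ(u) v`. -/
def symmProd (θ : E →L[ℝ] ℝ) : E →L[ℝ] E →L[ℝ] E :=
  θ.smulRight (ContinuousLinearMap.id ℝ E) + (θ.smulRight (ContinuousLinearMap.id ℝ E)).flip

lemma symmProd_apply (θ : E →L[ℝ] ℝ) (v u : E) : symmProd θ v u = θ v • u + θ u • v := rfl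

/-- The projective change by `d log φ` is flat. -/
lemma localCurvature_eq_zero_of_projectivelyAffine [FiniteDimensional ℝ E]
    {A' : E → E →L[ℝ] E →L[ℝ] E} (hA' : DifferentiableAt ℝ A' x)
    (hAA' : ∀ᶠ z in 𝓝 x, A' z = A z - symmProd ((φ z)⁻¹ • fderiv ℝ φ z))
    (H : ∀ᶠ z in 𝓝 x, IsProjectivelyAffineAt A φ h z) (w u v : E) :
    localCurvature A' x w u v = 0 := by
  have Hx := H.self_of_nhds
  apply Hx.injective
  refine (SeparatingDual.eq_iff_forall_dual_eq (R := ℝ)).2 fun l => ?_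
  rw [map_zero, map_zero]
  -- Divided by `φ`, the condition on `h` says that its Hessian for `A'` vanishes. The Ricci
  -- identity with `S = 0` then annihilates the curvature.
  have H' : ∀ᶠ z in 𝓝 x, ContDiffAt ℝ ∞ h z ∧ HessianEqAt A' 0 h z := by
    filter_upwards [H, hAA'] with z hz hz'
    refine ⟨hz.contDiffAt, fun u v => ?_⟩
    rw [hz']
    have h1 := congrArg (fun y => (φ z)⁻¹ • y) (hz.hessian_eq u v)
    simp only [smul_sub, inv_smul_smul₀ hz.ne_zero] at h1
    rw [h1]
    simp [symmProd_apply, mul_smul]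
    abel
  have hd : ∀ z, ContDiffAt ℝ ∞ h z → HasFDerivAt (fun z => -(l (h x)) + l (h z))
      (l ∘L fderiv ℝ h z) z := fun z hz =>
    (l.hasFDerivAt.comp z (hz.differentiableAt (by simp)).hasFDerivAt).const_add _
  have hd1 : fderiv ℝ (fun z => -(l (h x)) + l (h z)) = fderiv ℝ (fun z => l (h z)) := by
    funext z
    exact fderiv_const_add _
  have := fderiv_localCurvature_of_solution (f := fun z => -(l (h x)) + l (h z)) hA'
    (S := 0) (differentiableAt_const 0)
    ((contDiffAt_const.add (l.contDiff.contDiffAt.comp x Hx.contDiffAt)).of_le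
      three_le_infty)
    (H'.mono fun z hz u v => by
      rw [hd1]
      simpa using hz.2.clm_comp (hz.1.of_le two_le_infty) l u v) (by simp) w u v
  rw [(hd x Hx.contDiffAt).fderiv] at this
  simpa using this

/-- A closed form is locally the logarithmic derivative of a function. -/
lemma exists_exponential_primitive {θ : E → E →L[ℝ] ℝ} {T : Set E} (hT : IsOpen T) (hx : x ∈ T)
    (hθ : ContDiffOn ℝ ∞ θ T) (hclosed : ∀ z ∈ T, ∀ u v, fderiv ℝ θ z u v = fderiv ℝ θ z v u) :
    ∃ φ : E → ℝ, φ x = 1 ∧ ∀ᶠ z in 𝓝 x, ContDiffAt ℝ ∞ φ z ∧ fderiv ℝ φ z = φ z • θ z := by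
  -- The system is `dφ = φ θ`. The quadratic terms of its integrability condition commute, and what
  -- remains is that `θ` is closed.
  set B : E → E →L[ℝ] ℝ →L[ℝ] ℝ := fun z => (θ z).smulRight (ContinuousLinearMap.id ℝ ℝ) with hB
  let Λ : (E →L[ℝ] ℝ) →L[ℝ] (E →L[ℝ] ℝ →L[ℝ] ℝ) :=
    (ContinuousLinearMap.smulRightL ℝ E (ℝ →L[ℝ] ℝ)).flip (ContinuousLinearMap.id ℝ ℝ)
  have hBΛ : B = fun z => Λ (θ z) := rfl
  have hBs : ContDiffOn ℝ ∞ B T := Λ.contDiff.comp_contDiffOn hθ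
  have hBd : ∀ z ∈ T, fderiv ℝ B z = Λ ∘L fderiv ℝ θ z := fun z hz =>
    (Λ.hasFDerivAt.comp z
      ((hθ.contDiffAt (hT.mem_nhds hz)).differentiableAt (by simp)).hasFDerivAt).fderiv
  obtain ⟨φ, hφ1, hφ⟩ := exists_solution_of_integrable (B := B) (x₀ := x)
    ((hBs.contDiffAt (hT.mem_nhds hx)).of_le two_le_infty) (by
      filter_upwards [hT.mem_nhds hx] with z hz p u f
      rw [hBd z hz]
      change fderiv ℝ θ z p u * f + θ z u * (θ z p * f) =
        fderiv ℝ θ z u p * f + θ z p * (θ z u * f)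
      rw [hclosed z hz p u]
      ring) 1
  obtain ⟨V, hV, hoV, hxV⟩ := mem_nhds_iff.1 (hφ.and (hT.mem_nhds hx))
  have hsmooth : ContDiffOn ℝ ∞ φ V :=
    contDiffOn_of_linear_system hoV (hBs.mono fun x hx => (hV hx).2) fun x hx => (hV hx).1
  refine ⟨φ, hφ1, ?_⟩
  filter_upwards [hoV.mem_nhds hxV] with z hz
  refine ⟨hsmooth.contDiffAt (hoV.mem_nhds hz), ?_⟩
  rw [(hV hz).1.fderiv]
  ext u
  exact mul_comm _ _

/-- A connection which is projectively equivalent to a flat one, by means of a closed form, has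
projectively affine coordinates. -/
lemma exists_projectivelyAffine [FiniteDimensional ℝ E] {A' : E → E →L[ℝ] E →L[ℝ] E}
    {θ : E → E →L[ℝ] ℝ} {T : Set E} (hT : IsOpen T) (hx : x ∈ T)
    (hθ : ContDiffOn ℝ ∞ θ T) (hclosed : ∀ z ∈ T, ∀ u v, fderiv ℝ θ z u v = fderiv ℝ θ z v u)
    (hA' : ContDiffOn ℝ ∞ A' T) (hsymm : ∀ z ∈ T, ∀ u v, A' z u v = A' z v u)
    (hflat : ∀ z ∈ T, ∀ u v w, localCurvature A' z u v w = 0)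
    (hAA' : ∀ z ∈ T, A z = A' z + symmProd (θ z)) :
    ∃ (φ : E → ℝ) (h : E → E), φ x = 1 ∧ h x = 0 ∧ fderiv ℝ h x = ContinuousLinearMap.id ℝ E ∧
      ∀ᶠ z in 𝓝 x, IsProjectivelyAffineAt A φ h z := by
  obtain ⟨φ, hφ1, hφ⟩ := exists_exponential_primitive hT hx hθ hclosed
  obtain ⟨h, h0, h1, hh⟩ := exists_affine_of_flat hT hx hA' hsymm hflat (0 : E)
    (ContinuousLinearMap.id ℝ E)
  refine ⟨φ, h, hφ1, h0, h1, ?_⟩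
  have hne : ∀ᶠ z in 𝓝 x, φ z ≠ 0 :=
    hφ.self_of_nhds.1.continuousAt.eventually_ne (by rw [hφ1]; exact one_ne_zero)
  have hcd : ContinuousAt (fderiv ℝ h) x :=
    (hh.self_of_nhds.1.fderiv_right (m := ∞) (by simp)).continuousAt
  have hinj : ∀ᶠ z in 𝓝 x, Function.Injective (fderiv ℝ h z) := by
    have : IsUnit (fderiv ℝ h x) := by rw [h1]; exact isUnit_one
    have hG : CompleteSpace E := FiniteDimensional.complete ℝ E
    filter_upwards [hcd.eventually (Units.isOpen.mem_nhds this)] with z hz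
    obtain ⟨e, he⟩ := hz
    intro a b hab
    rw [← he] at hab
    have := congrArg (e⁻¹ : (E →L[ℝ] E)ˣ).1 hab
    simpa [← mul_apply_eq_comp] using this
  filter_upwards [hne, hφ, hh, hinj, hT.mem_nhds hx] with z z1 z2 z3 z4 z5
  refine ⟨z1, z2.1, z3.1, z4, fun u v => ?_⟩
  rw [z3.2 u v, hAA' z z5, z2.2]
  simp [symmProd_apply, mul_smul]
  module

end ProjectiveChange

end

section

variable {m : ℕ} {M : Type*} [TopologicalSpace M]
  [ChartedSpace (EuclideanSpace ℝ (Fin m)) M] [IsManifold (𝓡 m) ∞ M]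

/-! ### Solutions, their germs and their 1-jets -/

/-- A function in the preferred chart at `P`. -/
abbrev localRep {F : Type*} (P : M) (f : M → F) : EuclideanSpace ℝ (Fin m) → F :=
  f ∘ (extChartAt (𝓡 m) P).symm

/-- The tensor `μ ρ_s` in the preferred chart at `P`. -/
def localPotential (cov : FieldDerivation m M) (μ : ℝ) (P : M) (x : EuclideanSpace ℝ (Fin m)) :
    EuclideanSpace ℝ (Fin m) →L[ℝ] EuclideanSpace ℝ (Fin m) →L[ℝ] ℝ :=
  μ • localRicciSymm (christoffel cov P) x

variable {P y : M}

lemma localRep_apply (hy : y ∈ (chartAt (EuclideanSpace ℝ (Fin m)) P).source) {F : Type*}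
    (f : M → F) : localRep (m := m) P f (extChartAt (𝓡 m) P y) = f y :=
  congrArg f (symm_extChartAt hy)

lemma localRep_eventuallyEq (hy : y ∈ (chartAt (EuclideanSpace ℝ (Fin m)) P).source) {F : Type*}
    {f g : M → F} : localRep (m := m) P f =ᶠ[𝓝 (extChartAt (𝓡 m) P y)] localRep (m := m) P g ↔
      f =ᶠ[𝓝 y] g :=
  eventually_coord_iff hy (p := fun z => f z = g z)

variable [T2Space M] {cov : CovariantDerivative (𝓡 m) (EuclideanSpace ℝ (Fin m))
      (TangentSpace (𝓡 m) : M → Type _)}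
    [hsm : CovariantDerivative.ContMDiffCovariantDerivative cov ∞] {μ : ℝ}

lemma contDiffOn_christoffel {cov : FieldDerivation m M} {U : Set M} (hU : IsOpen U)
    (hcov : IsCovariantDerivativeOn (EuclideanSpace ℝ (Fin m)) cov U)
    (hsm : ContMDiffCovariantDerivativeOn (EuclideanSpace ℝ (Fin m)) ∞ cov U) :
    ContDiffOn ℝ ∞ (christoffel cov P)
      ((extChartAt (𝓡 m) P).target ∩ (extChartAt (𝓡 m) P).symm ⁻¹' U) := by
  intro x hx
  have := contDiffAt_christoffel hU hcov hsm (symm_mem_source hx.1) hx.2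
  rw [(extChartAt (𝓡 m) P).right_inv hx.1] at this
  exact this.contDiffWithinAt

variable (cov) in
lemma contDiffOn_christoffel_target :
    ContDiffOn ℝ ∞ (christoffel cov.toFun P) (extChartAt (𝓡 m) P).target := by
  simpa using contDiffOn_christoffel (P := P) isOpen_univ cov.isCovariantDerivativeOnUniv
    hsm.contMDiff

variable (cov μ) in
lemma contDiffOn_localPotential :
    ContDiffOn ℝ ∞ (localPotential cov.toFun μ P) (extChartAt (𝓡 m) P).target :=
  (contDiffOn_localRicciSymm (isOpen_extChartAt_target P)
    (contDiffOn_christoffel_target cov)).const_smul μ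

lemma solvesAt_iff_hessianEqAt (hy : y ∈ (chartAt (EuclideanSpace ℝ (Fin m)) P).source)
    {f : M → ℝ} (hf : ContMDiffAt (𝓡 m) 𝓘(ℝ, ℝ) 2 f y) :
    SolvesAt cov.toFun μ f y ↔ HessianEqAt (christoffel cov.toFun P) (localPotential cov.toFun μ P)
      (localRep P f) (extChartAt (𝓡 m) P y) := by
  rw [solvesAt_iff_coord isOpen_univ cov.isCovariantDerivativeOnUniv hsm.contMDiff hy trivial hf]
  refine forall₂_congr fun u v => ?_
  rw [localRep_apply hy, smul_eq_mul, mul_comm (localPotential _ _ _ _ _ _)]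
  rfl

/-- The equation near a point, in coordinates. -/
lemma solvesNear_iff (hy : y ∈ (chartAt (EuclideanSpace ℝ (Fin m)) P).source) {f : M → ℝ} :
    SolvesNear cov.toFun μ f y ↔ ∀ᶠ x in 𝓝 (extChartAt (𝓡 m) P y),
      ContDiffAt ℝ ∞ (localRep P f) x ∧ HessianEqAt (christoffel cov.toFun P)
        (localPotential cov.toFun μ P) (localRep P f) x := by
  unfold SolvesNear
  rw [← eventually_coord_iff hy]
  refine Filter.eventually_congr ?_
  filter_upwards [extChartAt_target_mem hy] with x hx
  have hs := symm_mem_source hx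
  have h1 := contMDiffAt_iff_coord (n := ∞) le_rfl hs (g := f)
  rw [(extChartAt (𝓡 m) P).right_inv hx] at h1
  rw [h1]
  refine and_congr_right fun h => ?_
  rw [solvesAt_iff_hessianEqAt hs ((h1.2 h).of_le two_le_infty),
    (extChartAt (𝓡 m) P).right_inv hx]

/-- `C²` solutions are smooth. -/
lemma contMDiff_of_mem_solutionSpace {f : M → ℝ} (hf : f ∈ solutionSpace cov.toFun μ) :
    ContMDiff (𝓡 m) 𝓘(ℝ, ℝ) ∞ f := by
  intro y
  have hy := mem_chart_source (EuclideanSpace ℝ (Fin m)) y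
  have hs : ∀ x ∈ (extChartAt (𝓡 m) y).target, ContDiffAt ℝ 2 (localRep y f) x := fun x hx => by
    have := (contMDiffAt_iff_coord two_le_infty (symm_mem_source hx)).1 (hf.1 _)
    rwa [(extChartAt (𝓡 m) y).right_inv hx] at this
  rw [contMDiffAt_iff_coord le_rfl hy]
  refine (contDiffOn_of_hessianEqAt (isOpen_extChartAt_target y)
    (contDiffOn_christoffel_target cov) (contDiffOn_localPotential cov μ) hs
    fun x hx => ?_).contDiffAt (extChartAt_target_mem hy)
  have := (solvesAt_iff_hessianEqAt (symm_mem_source hx) (hf.1 _)).1 (hf.2 _)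
  rwa [(extChartAt (𝓡 m) y).right_inv hx] at this

lemma solvesNear_of_mem_solutionSpace {f : M → ℝ} (hf : f ∈ solutionSpace cov.toFun μ) (P : M) :
    SolvesNear cov.toFun μ f P :=
  Filter.Eventually.of_forall fun y => ⟨contMDiff_of_mem_solutionSpace hf y, hf.2 y⟩

/-- A solution with vanishing 1-jet vanishes near the point. -/
lemma SolvesNear.eventually_eq_zero (hy : y ∈ (chartAt (EuclideanSpace ℝ (Fin m)) P).source)
    {f : M → ℝ} (hf : SolvesNear cov.toFun μ f y) (h0 : f y = 0)
    (h1 : fderiv ℝ (localRep P f) (extChartAt (𝓡 m) P y) = 0) : f =ᶠ[𝓝 y] 0 := by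
  have := eventually_eq_zero_of_hessianEqAt (isOpen_extChartAt_target P)
    (mem_of_mem_nhds (extChartAt_target_mem hy))
    (contDiffOn_christoffel_target cov) (contDiffOn_localPotential cov μ)
    (((solvesNear_iff hy).1 hf).mono fun x hx => ⟨hx.1.of_le two_le_infty, hx.2⟩)
    ((localRep_apply hy f).trans h0) h1
  exact (localRep_eventuallyEq hy (g := 0)).1 this

variable (P cov μ) in
/-- The 1-jet at `P` of a germ of solutions. -/
def jet : solutionGerms cov.toFun P μ →ₗ[ℝ] ℝ × (EuclideanSpace ℝ (Fin m) →L[ℝ] ℝ) where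
  toFun φ := (φ.2.choose P, fderiv ℝ (localRep P φ.2.choose) (extChartAt (𝓡 m) P P))
  map_add' φ ψ := by
    have hP := mem_chart_source (EuclideanSpace ℝ (Fin m)) P
    have e : (φ + ψ).2.choose =ᶠ[𝓝 P] φ.2.choose + ψ.2.choose := by
      refine Filter.Germ.coe_eq.1 ?_
      rw [(φ + ψ).2.choose_spec.2, Filter.Germ.coe_add, φ.2.choose_spec.2, ψ.2.choose_spec.2]
      rfl
    have h1 := ((solvesNear_iff hP).1 φ.2.choose_spec.1).self_of_nhds.1.differentiableAt (by simp)
    have h2 := ((solvesNear_iff hP).1 ψ.2.choose_spec.1).self_of_nhds.1.differentiableAt (by simp)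
    refine Prod.ext e.self_of_nhds ?_
    exact ((localRep_eventuallyEq hP).2 e).fderiv_eq.trans (fderiv_add h1 h2)
  map_smul' c φ := by
    have hP := mem_chart_source (EuclideanSpace ℝ (Fin m)) P
    have e : (c • φ).2.choose =ᶠ[𝓝 P] c • φ.2.choose := by
      refine Filter.Germ.coe_eq.1 ?_
      rw [(c • φ).2.choose_spec.2, Filter.Germ.coe_smul, φ.2.choose_spec.2]
      rfl
    have h1 := ((solvesNear_iff hP).1 φ.2.choose_spec.1).self_of_nhds.1.differentiableAt (by simp)
    refine Prod.ext e.self_of_nhds ?_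
    exact ((localRep_eventuallyEq hP).2 e).fderiv_eq.trans (fderiv_const_smul h1 c)

/-- The germ of a solution. -/
def SolvesNear.germ {f : M → ℝ} (hf : SolvesNear cov.toFun μ f P) : solutionGerms cov.toFun P μ :=
  ⟨(f : Filter.Germ (𝓝 P) ℝ), f, hf, rfl⟩

/-- `jet` is defined with a chosen representative; this removes the choice. -/
lemma jet_eq {φ : solutionGerms cov.toFun P μ} {f : M → ℝ}
    (h : (f : Filter.Germ (𝓝 P) ℝ) = φ) :
    jet P cov μ φ = (f P, fderiv ℝ (localRep P f) (extChartAt (𝓡 m) P P)) := by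
  have hP := mem_chart_source (EuclideanSpace ℝ (Fin m)) P
  have e : φ.2.choose =ᶠ[𝓝 P] f := Filter.Germ.coe_eq.1 (φ.2.choose_spec.2.trans h.symm)
  exact Prod.ext e.self_of_nhds ((localRep_eventuallyEq hP).2 e).fderiv_eq

lemma jet_injective : Function.Injective (jet P cov μ) := by
  rw [← LinearMap.ker_eq_bot, LinearMap.ker_eq_bot']
  intro φ hφ
  obtain ⟨f, hf, hfφ⟩ := φ.2
  rw [jet_eq hfφ, Prod.mk_eq_zero] at hφ
  have hP := mem_chart_source (EuclideanSpace ℝ (Fin m)) P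
  apply Subtype.ext
  rw [← hfφ]
  exact Filter.Germ.coe_eq.2 (hf.eventually_eq_zero hP hφ.1 hφ.2)

lemma finrank_jets : Module.finrank ℝ (ℝ × (EuclideanSpace ℝ (Fin m) →L[ℝ] ℝ)) = m + 1 := by
  have h1 : Module.finrank ℝ (EuclideanSpace ℝ (Fin m) →L[ℝ] ℝ) = m := by
    rw [← (LinearMap.toContinuousLinearMap :
      (EuclideanSpace ℝ (Fin m) →ₗ[ℝ] ℝ) ≃ₗ[ℝ] _).finrank_eq]
    simp
  rw [Module.finrank_prod, h1, Module.finrank_self, add_comm]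

instance finiteDimensional_solutionGerms : FiniteDimensional ℝ (solutionGerms cov.toFun P μ) :=
  FiniteDimensional.of_injective (jet P cov μ) jet_injective

lemma finrank_solutionGerms_le : Module.finrank ℝ (solutionGerms cov.toFun P μ) ≤ m + 1 := by
  have := LinearMap.finrank_le_finrank_of_injective (jet_injective (cov := cov) (μ := μ) (P := P))
  rwa [finrank_jets] at this

/-- The jet map is injective into a space of dimension `m + 1`. Maximal dimension is used, and
established, as the existence of solutions with arbitrary 1-jet. -/
lemma jet_surjective_iff : Function.Surjective (jet P cov μ) ↔
    Module.finrank ℝ (solutionGerms cov.toFun P μ) = m + 1 := by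
  constructor
  · intro h
    rw [← finrank_jets]
    exact (LinearEquiv.ofBijective _ ⟨jet_injective, h⟩).finrank_eq
  · intro h
    exact (LinearMap.injective_iff_surjective_of_finrank_eq_finrank
      (h.trans finrank_jets.symm)).1 jet_injective

variable (P cov μ) in
/-- The germ at `P` of a global solution. -/
def toGerm : solutionSpace cov.toFun μ →ₗ[ℝ] solutionGerms cov.toFun P μ where
  toFun f := (solvesNear_of_mem_solutionSpace f.2 P).germ
  map_add' _ _ := rfl
  map_smul' _ _ := rfl

/-- Unique continuation. -/
lemma eventually_eq_zero_of_preconnected {V : Set M} (hVc : IsPreconnected V)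
    {f : M → ℝ} (hf : ∀ y ∈ V, SolvesNear cov.toFun μ f y) (hP : P ∈ V) (h0 : f =ᶠ[𝓝 P] 0) :
    ∀ y ∈ V, f =ᶠ[𝓝 y] 0 := by
  -- `Z` is open by definition. At a point of its closure `f` and its differential vanish by
  -- continuity, so uniqueness for the 1-jet puts the point back into `Z`.
  set Z : Set M := {y | f =ᶠ[𝓝 y] 0} with hZ
  have hZo : IsOpen Z := isOpen_iff_mem_nhds.2 fun y hy => eventually_eventually_nhds.2 hy
  refine hVc.subset_of_closure_inter_subset hZo ⟨P, hP, h0⟩ ?_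
  rintro y ⟨hy : y ∈ closure Z, hyV⟩
  have hys := mem_chart_source (EuclideanSpace ℝ (Fin m)) y
  have hc := ((solvesNear_iff hys).1 (hf y hyV)).self_of_nhds.1
  have hfr : ∃ᶠ x in 𝓝 (extChartAt (𝓡 m) y y),
      localRep y f x = 0 ∧ fderiv ℝ (localRep y f) x = 0 := by
    rw [mem_closure_iff_frequently] at hy
    intro hn
    refine hy ?_
    filter_upwards [(continuousAt_extChartAt (I := 𝓡 m) y).eventually hn,
      (chartAt (EuclideanSpace ℝ (Fin m)) y).open_source.mem_nhds hys] with z hz hzs hzZ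
    have e := (localRep_eventuallyEq hzs (g := 0)).2 hzZ
    exact hz ⟨e.self_of_nhds, e.fderiv_eq.trans (fderiv_const_apply (0 : ℝ))⟩
  have h2 : localRep y f (extChartAt (𝓡 m) y y) = 0 := by
    by_contra hne
    obtain ⟨x, hx, hx'⟩ := (hfr.and_eventually (hc.continuousAt.eventually_ne hne)).exists
    exact hx' hx.1
  have h3 : fderiv ℝ (localRep y f) (extChartAt (𝓡 m) y y) = 0 := by
    by_contra hne
    obtain ⟨x, hx, hx'⟩ := (hfr.and_eventually
      ((hc.fderiv_right (m := ∞) (by simp)).continuousAt.eventually_ne hne)).exists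
    exact hx' hx.2
  exact (hf y hyV).eventually_eq_zero hys ((localRep_apply hys f).symm.trans h2) h3

lemma toGerm_injective [PreconnectedSpace M] : Function.Injective (toGerm P cov μ) := by
  rw [← LinearMap.ker_eq_bot, LinearMap.ker_eq_bot']
  intro f hf
  have h0 : (f : M → ℝ) =ᶠ[𝓝 P] 0 := Filter.Germ.coe_eq.1 (congrArg Subtype.val hf)
  ext y
  exact (eventually_eq_zero_of_preconnected isPreconnected_univ
    (fun y _ => solvesNear_of_mem_solutionSpace f.2 y) trivial h0 y trivial).self_of_nhds

/-- Global solutions embed into germs by unique continuation, and germs have dimension at most `m +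
1`. The global claims thus follow from the pointwise ones at every `P`. -/
lemma finrank_solutionGerms_of_global [PreconnectedSpace M]
    (h : Module.finrank ℝ (solutionSpace cov.toFun μ) = m + 1) (P : M) :
    Module.finrank ℝ (solutionGerms cov.toFun P μ) = m + 1 := by
  have := LinearMap.finrank_le_finrank_of_injective (toGerm_injective (cov := cov) (μ := μ) (P := P))
  exact le_antisymm finrank_solutionGerms_le (h ▸ this)

end

section

variable {m : ℕ} {M : Type*} [TopologicalSpace M]
  [ChartedSpace (EuclideanSpace ℝ (Fin m)) M] [IsManifold (𝓡 m) ∞ M]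

/-! ### Projectively affine coordinates from a basis of germs -/

section Components

variable {E : Type*} [NormedAddCommGroup E] [NormedSpace ℝ E]
  {A : E → E →L[ℝ] E →L[ℝ] E} {S : E → E →L[ℝ] E →L[ℝ] ℝ} {x : E} {n : ℕ}

lemma fderiv_fderiv_component {ψ : E → EuclideanSpace ℝ (Fin n)} (hψ : ContDiffAt ℝ 2 ψ x)
    (i : Fin n) (u v : E) : fderiv ℝ (fderiv ℝ fun z => ψ z i) x u v =
      fderiv ℝ (fderiv ℝ ψ) x u v i := by
  let L : EuclideanSpace ℝ (Fin n) →L[ℝ] ℝ := EuclideanSpace.proj i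
  have h1 : fderiv ℝ (fun z => ψ z i) =ᶠ[𝓝 x] fun z => L ∘L fderiv ℝ ψ z := by
    filter_upwards [hψ.eventually (by simp)] with z hz
    exact (L.hasFDerivAt.comp z (hz.differentiableAt two_ne_zero).hasFDerivAt).fderiv
  have d4 : HasFDerivAt (fderiv ℝ ψ) (fderiv ℝ (fderiv ℝ ψ) x) x :=
    ((hψ.fderiv_right (m := 1) (by norm_num)).differentiableAt one_ne_zero).hasFDerivAt
  have h2 : HasFDerivAt (fun z => L ∘L fderiv ℝ ψ z) _ x :=
    ((ContinuousLinearMap.compL ℝ E _ ℝ) L).hasFDerivAt.comp x d4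
  rw [h1.fderiv_eq, h2.fderiv]
  rfl

lemma fderiv_component {ψ : E → EuclideanSpace ℝ (Fin n)} (hψ : DifferentiableAt ℝ ψ x)
    (i : Fin n) (u : E) : fderiv ℝ (fun z => ψ z i) x u = fderiv ℝ ψ x u i := by
  let L : EuclideanSpace ℝ (Fin n) →L[ℝ] ℝ := EuclideanSpace.proj i
  have h1 : HasFDerivAt (fun z => ψ z i) _ x := L.hasFDerivAt.comp x hψ.hasFDerivAt
  rw [h1.fderiv]
  rfl

lemma HessianEqAt.of_components {ψ : E → EuclideanSpace ℝ (Fin n)} (hψ : ContDiffAt ℝ 2 ψ x)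
    (h : ∀ i, HessianEqAt A S (fun z => ψ z i) x) : HessianEqAt A S ψ x := by
  intro u v
  ext i
  have h1 := h i u v
  rw [fderiv_fderiv_component hψ, fderiv_component (hψ.differentiableAt two_ne_zero)] at h1
  simpa using h1

/-- In finite dimension injective endomorphisms are the invertible ones, which form an open set. -/
lemma eventually_injective_fderiv [FiniteDimensional ℝ E] {h : E → E}
    (hc : ContinuousAt (fderiv ℝ h) x) (hinj : Function.Injective (fderiv ℝ h x)) :
    ∀ᶠ z in 𝓝 x, Function.Injective (fderiv ℝ h z) := by
  have hE : CompleteSpace E := FiniteDimensional.complete ℝ E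
  have hu : IsUnit (fderiv ℝ h x) := ContinuousLinearMap.isUnit_iff_bijective.2
    ⟨hinj, LinearMap.injective_iff_surjective.1 hinj⟩
  filter_upwards [hc.eventually (Units.isOpen.mem_nhds hu)] with z hz
  exact (ContinuousLinearMap.isUnit_iff_bijective.1 hz).1

end Components

variable {P y : M} [T2Space M] {cov : CovariantDerivative (𝓡 m) (EuclideanSpace ℝ (Fin m))
      (TangentSpace (𝓡 m) : M → Type _)}
    [hsm : CovariantDerivative.ContMDiffCovariantDerivative cov ∞] {μ : ℝ}

/-- The functions `f_1, …, f_m` as one vector valued function. -/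
def tailMap (f : Fin (m + 1) → M → ℝ) (y : M) : EuclideanSpace ℝ (Fin m) :=
  WithLp.toLp 2 fun i => f i.succ y

/-- The quotients `f_1 / f_0, …, f_m / f_0`. -/
def ratioMap (f : Fin (m + 1) → M → ℝ) (y : M) : EuclideanSpace ℝ (Fin m) :=
  (f 0 y)⁻¹ • tailMap f y

lemma contDiffAt_localRep_tailMap {f : Fin (m + 1) → M → ℝ} {x : EuclideanSpace ℝ (Fin m)}
    (h : ∀ i, ContDiffAt ℝ ∞ (localRep P (f i)) x) : ContDiffAt ℝ ∞ (localRep P (tailMap f)) x :=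
  (contDiffAt_euclidean (𝕜 := ℝ)).2 fun i => h i.succ

/-- The basis consists of the solutions with 1-jets `(1, 0)` and `(0, dx^i)`. -/
lemma exists_normalized_basis (h : Module.finrank ℝ (solutionGerms cov.toFun P μ) = m + 1) :
    ∃ φ : Module.Basis (Fin (m + 1)) ℝ (solutionGerms cov.toFun P μ),
      IsNormalizedAt (fun i => (φ i : Filter.Germ (𝓝 P) ℝ)) := by
  have hs := jet_surjective_iff.2 h
  choose g hg using hs
  let w : Fin (m + 1) → ℝ × (EuclideanSpace ℝ (Fin m) →L[ℝ] ℝ) :=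
    Fin.cons (1, 0) fun i => (0, EuclideanSpace.proj i)
  have hw : LinearIndependent ℝ (fun i => g (w i)) := by
    rw [Fintype.linearIndependent_iff]
    intro c hc
    have h1 := congrArg (jet P cov μ) hc
    rw [map_sum] at h1
    simp only [map_smul, hg, map_zero] at h1
    simp only [Fin.sum_univ_succ, w, Fin.cons_zero, Fin.cons_succ] at h1
    have h2 := congrArg Prod.fst h1
    have h3 := congrArg Prod.snd h1
    simp [Prod.fst_sum, Prod.snd_sum] at h2 h3
    refine Fin.cases h2 fun j => ?_
    have h4 := congrArg (fun L : EuclideanSpace ℝ (Fin m) →L[ℝ] ℝ =>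
      L (EuclideanSpace.single j 1)) h3
    simpa [sum_apply] using h4
  have hval : ∀ φ : solutionGerms cov.toFun P μ, (φ : Filter.Germ (𝓝 P) ℝ).value =
      (jet P cov μ φ).1 := by
    intro φ
    obtain ⟨f, hf, hfφ⟩ := φ.2
    rw [jet_eq hfφ, ← hfφ]
    rfl
  refine ⟨basisOfLinearIndependentOfCardEqFinrank hw (by simp [h]), ?_, fun i => ?_⟩
  · simp [hval, hg, w]
  · simp [hval, hg, w]

/-- Representatives of a normalized basis of germs provide projectively affine coordinates. -/
lemma eventually_isProjectivelyAffineAt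
    (φ : Module.Basis (Fin (m + 1)) ℝ (solutionGerms cov.toFun P μ))
    (hφ : IsNormalizedAt (fun i => (φ i : Filter.Germ (𝓝 P) ℝ))) {f : Fin (m + 1) → M → ℝ}
    (hf : ∀ i, SolvesNear cov.toFun μ (f i) P)
    (hfφ : ∀ i, (f i : Filter.Germ (𝓝 P) ℝ) = φ i) :
    ∀ᶠ x in 𝓝 (extChartAt (𝓡 m) P P),
      IsProjectivelyAffineAt (christoffel cov.toFun P) (localRep P (f 0))
        (localRep P (ratioMap f)) x ∧
      inducedPotential (christoffel cov.toFun P) (localRep P (f 0)) x =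
        localPotential cov.toFun μ P x := by
  have hP := mem_chart_source (EuclideanSpace ℝ (Fin m)) P
  set x₀ := extChartAt (𝓡 m) P P with hx₀
  have hsol : ∀ᶠ x in 𝓝 x₀, ∀ i, ContDiffAt ℝ ∞ (localRep P (f i)) x ∧
      HessianEqAt (christoffel cov.toFun P) (localPotential cov.toFun μ P) (localRep P (f i)) x :=
    Filter.eventually_all.2 fun i => (solvesNear_iff hP).1 (hf i)
  have hval : ∀ i, (φ i : Filter.Germ (𝓝 P) ℝ).value = f i P := fun i => by
    rw [← hfφ i]
    rfl
  have h0 : f 0 P ≠ 0 := by rw [← hval]; exact hφ.1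
  have hi0 : tailMap f P = 0 := by
    ext i
    exact (hval i.succ).symm.trans (hφ.2 i)
  have h0' : localRep P (f 0) x₀ ≠ 0 := by rwa [localRep_apply hP]
  have hψ := contDiffAt_localRep_tailMap fun i => (hsol.self_of_nhds i).1
  have hfin : Module.finrank ℝ (solutionGerms cov.toFun P μ) = m + 1 := by
    rw [Module.finrank_eq_card_basis φ, Fintype.card_fin]
  have hh : ContDiffAt ℝ ∞ (localRep P (ratioMap f)) x₀ :=
    ((hsol.self_of_nhds 0).1.inv h0').smul hψ
  -- The derivative of `1 / f_0` is multiplied by `f_i(P) = 0`, so only the differentials of the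
  -- `f_i` survive.
  have hder : fderiv ℝ (localRep P (ratioMap f)) x₀ =
      (f 0 P)⁻¹ • fderiv ℝ (localRep P (tailMap f)) x₀ := by
    have h1 := (((hsol.self_of_nhds 0).1.inv h0').differentiableAt (by simp)).hasFDerivAt.fun_smul
      (hψ.differentiableAt (by simp)).hasFDerivAt
    have h2 : localRep P (tailMap f) x₀ = 0 := (localRep_apply hP _).trans hi0
    have h3 : (localRep P (f 0))⁻¹ x₀ = (f 0 P)⁻¹ := congrArg (·⁻¹) (localRep_apply hP _)
    rw [h2, ContinuousLinearMap.smulRight_zero, add_zero, h3] at h1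
    exact h1.fderiv
  have hinj : Function.Injective (fderiv ℝ (localRep P (ratioMap f)) x₀) := by
    refine (injective_iff_map_eq_zero _).2 fun v hv => ?_
    rw [hder, smul_apply, smul_eq_zero_iff_right (inv_ne_zero h0)] at hv
    have hvi : ∀ i : Fin m, fderiv ℝ (localRep P (f i.succ)) x₀ v = 0 := fun i => by
      have := fderiv_component (hψ.differentiableAt (by simp)) i v
      rw [hv] at this
      exact this
    -- Every covector `l` is the differential of a solution vanishing at `P`. Its `φ_0`-coefficient
    -- is zero, because only `φ_0` is nonzero at `P`; so `l` is a combination of the differentials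
    -- of the other `f_i`, all of which kill `v`.
    refine (SeparatingDual.eq_zero_iff_forall_dual_eq_zero (R := ℝ) v).2 fun l => ?_
    obtain ⟨g, hg⟩ := jet_surjective_iff.2 hfin (0, l)
    rw [← φ.sum_repr g, map_sum, Fin.sum_univ_succ] at hg
    simp only [map_smul, jet_eq (hfφ _)] at hg
    have e1 := congrArg Prod.fst hg
    have e2 := congrArg (fun q : ℝ × (EuclideanSpace ℝ (Fin m) →L[ℝ] ℝ) => q.2 v) hg
    have hfi : ∀ i : Fin m, f i.succ P = 0 := fun i => (hval i.succ).symm.trans (hφ.2 i)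
    simp [Prod.fst_sum, hfi, h0] at e1
    simp only [e1, zero_smul, zero_add, Prod.snd_sum, sum_apply, Prod.smul_snd, smul_apply] at e2
    rw [← e2]
    exact Finset.sum_eq_zero fun i _ => by rw [hvi i, smul_zero]
  filter_upwards [hsol, (hsol.self_of_nhds 0).1.continuousAt.eventually_ne h0',
    eventually_injective_fderiv (hh.fderiv_right (m := ∞) (by simp)).continuousAt hinj]
    with x hx hx0 hxi
  have hψx := contDiffAt_localRep_tailMap fun i => (hx i).1
  exact ⟨isProjectivelyAffineAt_quotient hx0 (hx 0).1 hψx (hx 0).2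
    (HessianEqAt.of_components (hψx.of_le two_le_infty) fun i => (hx i.succ).2) hxi,
    (hx 0).2.inducedPotential_eq hx0⟩

lemma exists_representatives (φ : Fin (m + 1) → solutionGerms cov.toFun P μ) :
    ∃ f : Fin (m + 1) → M → ℝ, (∀ i, SolvesNear cov.toFun μ (f i) P) ∧
      ∀ i, (f i : Filter.Germ (𝓝 P) ℝ) = φ i := by
  choose f hf hfφ using fun i => (φ i).2
  exact ⟨f, hf, hfφ⟩

lemma localPotential_apply {cov : FieldDerivation m M} {x : EuclideanSpace ℝ (Fin m)}
    (u v : EuclideanSpace ℝ (Fin m)) : localPotential cov μ P x u v =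
      μ * localRicciSymm (christoffel cov P) x u v := rfl

/-- A full space of germs for a parameter other than `-1 / (m - 1)` forces the Ricci tensor to
vanish. -/
lemma eventually_ricci_eq_zero (hm : 2 ≤ m) (hμ : μ ≠ -1 / ((m : ℝ) - 1))
    (h : Module.finrank ℝ (solutionGerms cov.toFun P μ) = m + 1) :
    ∀ᶠ y in 𝓝 P, ∀ u v : TangentSpace (𝓡 m) y, ricci cov.toFun y u v = 0 := by
  obtain ⟨φ, hφ⟩ := exists_normalized_basis h
  obtain ⟨f, hf, hfφ⟩ := exists_representatives φ
  have hP := mem_chart_source (EuclideanSpace ℝ (Fin m)) P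
  rw [← eventually_coord_iff hP]
  have hpair := eventually_isProjectivelyAffineAt φ hφ hf hfφ
  filter_upwards [extChartAt_target_mem hP, hpair.eventually_nhds] with x hx hpx u v
  have hys := symm_mem_source hx
  rw [ricci_eq_coord isOpen_univ cov.isCovariantDerivativeOnUniv hsm.contMDiff hys trivial,
    (extChartAt (𝓡 m) P).right_inv hx]
  generalize coordVec P ((extChartAt (𝓡 m) P).symm x) u = u
  generalize coordVec P ((extChartAt (𝓡 m) P).symm x) v = v
  have hA : DifferentiableAt ℝ (christoffel cov.toFun P) x :=
    ((contDiffOn_christoffel_target cov).contDiffAt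
      ((isOpen_extChartAt_target P).mem_nhds hx)).differentiableAt (by simp)
  -- This is `ρ = (1 - m) S` with `S = μ ρ_s`. Symmetrizing it gives a scalar equation for `ρ_s`,
  -- whose coefficient `1 - (1 - m) μ` vanishes only for the excluded parameter.
  have hr : ∀ a b, localRicci (christoffel cov.toFun P) x a b =
      (1 - m) * (μ * localRicciSymm (christoffel cov.toFun P) x a b) := fun a b => by
    rw [IsProjectivelyAffineAt.localRicci_eq hA (hpx.mono fun z hz => hz.1),
      hpx.self_of_nhds.2, finrank_euclideanSpace_fin]
    simp only [localPotential_apply]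
    ring
  have h1 := hr u v
  have h2 := hr v u
  have h3 := localRicciSymm_apply (christoffel cov.toFun P) x u v
  have h4 : localRicciSymm (christoffel cov.toFun P) x v u =
      localRicciSymm (christoffel cov.toFun P) x u v := by
    rw [localRicciSymm_apply, localRicciSymm_apply, add_comm]
  have hm1 : (m : ℝ) - 1 ≠ 0 := by
    have : (2 : ℝ) ≤ m := by exact_mod_cast hm
    linarith
  have hne : 1 - (1 - (m : ℝ)) * μ ≠ 0 := fun hc => hμ (by
    rw [eq_div_iff hm1]
    linarith)
  have h5 : localRicciSymm (christoffel cov.toFun P) x u v = 0 := by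
    refine (mul_eq_zero.1 (?_ : (1 - (1 - (m : ℝ)) * μ) * _ = 0)).resolve_left hne
    rw [h1, h2, h4] at h3
    linarith
  rw [h1, h5]
  ring

end

section

variable {m : ℕ} {M : Type*} [TopologicalSpace M]
  [ChartedSpace (EuclideanSpace ℝ (Fin m)) M] [IsManifold (𝓡 m) ∞ M]

/-! ### Projective changes of a connection on a manifold -/

/-- The endomorphisms `u ↦ -θ(u) v - θ(v) u` of a tangent space. -/
def projectiveTerm (θ : (x : M) → TangentSpace (𝓡 m) x →L[ℝ] ℝ) (y : M) :
    TangentSpace (𝓡 m) y →L[ℝ] TangentSpace (𝓡 m) y →L[ℝ] TangentSpace (𝓡 m) y :=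
  (-symmProd (E := EuclideanSpace ℝ (Fin m)) (θ y) :
    EuclideanSpace ℝ (Fin m) →L[ℝ] EuclideanSpace ℝ (Fin m) →L[ℝ] EuclideanSpace ℝ (Fin m))

lemma projectiveTerm_apply (θ : (x : M) → TangentSpace (𝓡 m) x →L[ℝ] ℝ) (y : M)
    (v u : TangentSpace (𝓡 m) y) :
    projectiveTerm θ y v u = -(θ y v • u + θ y u • v) := rfl

/-- The connection `∇_u Y - θ(u) Y - θ(Y) u`. -/
def projectiveChange (cov : FieldDerivation m M)
    (θ : (x : M) → TangentSpace (𝓡 m) x →L[ℝ] ℝ) : FieldDerivation m M :=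
  fun Y y => cov Y y + projectiveTerm θ y (Y y)

lemma projectiveChange_apply (cov : FieldDerivation m M)
    (θ : (x : M) → TangentSpace (𝓡 m) x →L[ℝ] ℝ) (Y : (x : M) → TangentSpace (𝓡 m) x) (y : M)
    (u : TangentSpace (𝓡 m) y) :
    projectiveChange cov θ Y y u = cov Y y u - (θ y (Y y) • u + θ y u • Y y) := by
  rw [projectiveChange, add_apply, projectiveTerm_apply, ← sub_eq_add_neg]

variable {P y : M} {cov : FieldDerivation m M} {U : Set M}

lemma christoffel_apply (hcov : IsCovariantDerivativeOn (EuclideanSpace ℝ (Fin m)) cov U)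
    (hy : y ∈ (chartAt (EuclideanSpace ℝ (Fin m)) P).source) (hyU : y ∈ U)
    (v w : EuclideanSpace ℝ (Fin m)) :
    christoffel cov P (extChartAt (𝓡 m) P y) v w =
      coordVec P y (cov (frameField P v) y (frameVec P y w)) := by
  rw [coordVec_cov hcov hy hyU (mdifferentiableAt_frameField hy v),
    (coordRep_frameField hy v).fderiv_eq]
  simp [frameField, coordVec_frameVec hy]

/-- A 1-form in the preferred chart at `P`. -/
def formRep (P : M) (θ : (x : M) → TangentSpace (𝓡 m) x →L[ℝ] ℝ) (x : EuclideanSpace ℝ (Fin m)) :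
    EuclideanSpace ℝ (Fin m) →L[ℝ] ℝ :=
  θ ((extChartAt (𝓡 m) P).symm x) ∘L frameVec P ((extChartAt (𝓡 m) P).symm x)

lemma formRep_apply (hy : y ∈ (chartAt (EuclideanSpace ℝ (Fin m)) P).source)
    (θ : (x : M) → TangentSpace (𝓡 m) x →L[ℝ] ℝ) (u : TangentSpace (𝓡 m) y) :
    formRep P θ (extChartAt (𝓡 m) P y) (coordVec P y u) = θ y u := by
  unfold formRep
  rw [symm_extChartAt hy]
  exact congrArg (θ y) (frameVec_coordVec hy u)

lemma isCovariantDerivativeOn_projectiveChange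
    (hcov : IsCovariantDerivativeOn (EuclideanSpace ℝ (Fin m)) cov U)
    (θ : (x : M) → TangentSpace (𝓡 m) x →L[ℝ] ℝ) :
    IsCovariantDerivativeOn (EuclideanSpace ℝ (Fin m)) (projectiveChange cov θ) U :=
  hcov.add_one_form (projectiveTerm θ)

lemma christoffel_projectiveChange
    (hcov : IsCovariantDerivativeOn (EuclideanSpace ℝ (Fin m)) cov U)
    (θ : (x : M) → TangentSpace (𝓡 m) x →L[ℝ] ℝ)
    (hy : y ∈ (chartAt (EuclideanSpace ℝ (Fin m)) P).source) (hyU : y ∈ U) :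
    christoffel (projectiveChange cov θ) P (extChartAt (𝓡 m) P y) =
      christoffel cov P (extChartAt (𝓡 m) P y) - symmProd (formRep P θ (extChartAt (𝓡 m) P y)) := by
  ext1 v
  ext1 w
  rw [christoffel_apply (isCovariantDerivativeOn_projectiveChange hcov θ) hy hyU,
    projectiveChange_apply, map_sub, ← christoffel_apply hcov hy hyU, map_add, map_smul, map_smul,
    sub_apply, sub_apply, symmProd_apply, frameField, coordVec_frameVec hy, coordVec_frameVec hy,
    ← formRep_apply hy, ← formRep_apply hy, coordVec_frameVec hy, coordVec_frameVec hy]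

lemma contMDiffCovariantDerivativeOn_projectiveChange [T2Space M] (hU : IsOpen U)
    (hcov : IsCovariantDerivativeOn (EuclideanSpace ℝ (Fin m)) cov U)
    (hsm : ContMDiffCovariantDerivativeOn (EuclideanSpace ℝ (Fin m)) ∞ cov U)
    {θ : (x : M) → TangentSpace (𝓡 m) x →L[ℝ] ℝ}
    (hθ : ∀ y ∈ U, ∃ P : M, y ∈ (chartAt (EuclideanSpace ℝ (Fin m)) P).source ∧
      ContDiffAt ℝ ∞ (formRep P θ) (extChartAt (𝓡 m) P y)) :
    ContMDiffCovariantDerivativeOn (EuclideanSpace ℝ (Fin m)) ∞ (projectiveChange cov θ) U where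
  contMDiff {σ} hσ y hyU := by
    obtain ⟨P, hy, hθ⟩ := hθ y hyU
    have hσ' : SmoothFieldOn σ U := hσ.of_le (by simp)
    have h1 := (contMDiffAt_end_iff_coord hy).1 (contMDiffAt_cov hU hcov hsm hyU hU hyU hσ')
    have h2 := (contDiffAt_coordRep (P := P) le_rfl hy).1 (hσ'.contMDiffAt (hU.mem_nhds hyU))
    refine ((contMDiffAt_end_iff_coord hy).2 ?_).contMDiffWithinAt
    have h3 : endRep P (projectiveChange cov θ σ) =ᶠ[𝓝 (extChartAt (𝓡 m) P y)] fun x =>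
        endRep P (cov σ) x - ((formRep P θ x (coordRep P σ x)) •
          ContinuousLinearMap.id ℝ (EuclideanSpace ℝ (Fin m)) +
          (formRep P θ x).smulRight (coordRep P σ x)) := by
      filter_upwards [extChartAt_target_mem hy] with x hx
      have hz := symm_mem_source hx
      have hr := (extChartAt (𝓡 m) P).right_inv hx
      ext1 w
      have e1 := formRep_apply hz θ (σ ((extChartAt (𝓡 m) P).symm x))
      rw [hr] at e1
      change coordVec P _ (projectiveChange cov θ σ _ (frameVec P _ w)) =
        coordVec P _ (cov σ _ (frameVec P _ w)) - (formRep P θ x (coordVec P _ (σ _)) • w +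
          (θ _ (frameVec P _ w)) • coordVec P _ (σ _))
      rw [projectiveChange_apply, map_sub, map_add, map_smul, map_smul, coordVec_frameVec hz, e1]
    refine ContDiffAt.congr_of_eventuallyEq ?_ h3
    exact h1.sub (((hθ.clm_apply h2).smul contDiffAt_const).add (hθ.smulRight h2))

lemma smoothFormOn_of_formRep (hU : IsOpen U) {θ : (x : M) → TangentSpace (𝓡 m) x →L[ℝ] ℝ}
    (hθ : ∀ y ∈ U, ∃ P : M, y ∈ (chartAt (EuclideanSpace ℝ (Fin m)) P).source ∧
      ContDiffAt ℝ ∞ (formRep P θ) (extChartAt (𝓡 m) P y)) : SmoothFormOn θ U := by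
  intro X hX y hyU
  obtain ⟨P, hy, hθ⟩ := hθ y hyU
  have h2 := (contDiffAt_coordRep (P := P) le_rfl hy).1 (hX.contMDiffAt (hU.mem_nhds hyU))
  refine ContMDiffAt.contMDiffWithinAt ((contMDiffAt_iff_coord (P := P) le_rfl hy).2 ?_)
  refine (hθ.clm_apply h2).congr_of_eventuallyEq ?_
  filter_upwards [extChartAt_target_mem hy] with x hx
  have hz := symm_mem_source hx
  have e1 := formRep_apply hz θ (X ((extChartAt (𝓡 m) P).symm x))
  rw [(extChartAt (𝓡 m) P).right_inv hx] at e1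
  exact e1.symm

lemma providesProjectiveEquivalenceOn_projectiveChange
    (θ : (x : M) → TangentSpace (𝓡 m) x →L[ℝ] ℝ) :
    ProvidesProjectiveEquivalenceOn θ cov (projectiveChange cov θ) U := by
  intro Y _ x _ u
  rw [projectiveChange_apply]
  abel

/-- `d² = 0` in the form `[X, Y] g = X (Y g) - Y (X g)`. -/
lemma closedFormOn_mvfderiv (hU : IsOpen U) {g : M → ℝ}
    (hg : ∀ y ∈ U, ContMDiffAt (𝓡 m) 𝓘(ℝ, ℝ) ∞ g y) :
    ClosedFormOn (fun y => mvfderiv (𝓡 m) g y) U := by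
  intro X Y hX hY y hy
  rw [lieBracket_coord_derivation ((hg y hy).of_le two_le_infty)
    (mdifferentiableAt_of_smoothFieldOn (hU.mem_nhds hy) hX)
    (mdifferentiableAt_of_smoothFieldOn (hU.mem_nhds hy) hY)]
  ring

lemma formRep_mvfderiv (hy : y ∈ (chartAt (EuclideanSpace ℝ (Fin m)) P).source) {g : M → ℝ}
    (hg : MDifferentiableAt (𝓡 m) 𝓘(ℝ, ℝ) g y) :
    formRep P (fun y => mvfderiv (𝓡 m) g y) (extChartAt (𝓡 m) P y) =
      fderiv ℝ (localRep P g) (extChartAt (𝓡 m) P y) := by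
  ext w
  have h := formRep_apply hy (fun y => mvfderiv (𝓡 m) g y) (frameVec P y w)
  rw [mvfderiv_eq_coord hy hg, coordVec_frameVec hy] at h
  exact h

section

variable [T2Space M] {cov : CovariantDerivative (𝓡 m) (EuclideanSpace ℝ (Fin m))
      (TangentSpace (𝓡 m) : M → Type _)}
    [hsm : CovariantDerivative.ContMDiffCovariantDerivative cov ∞] {μ : ℝ}

/-- The flat connection is the projective change of `∇` by the exact form `d log f₀`; the components
of `h` are its affine functions. -/
lemma stronglyProjectivelyFlatAt_of_projectivelyAffine {f₀ : M → ℝ}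
    {h : EuclideanSpace ℝ (Fin m) → EuclideanSpace ℝ (Fin m)}
    (H : ∀ᶠ x in 𝓝 (extChartAt (𝓡 m) P P),
      IsProjectivelyAffineAt (christoffel cov.toFun P) (localRep P f₀) h x) :
    StronglyProjectivelyFlatAt cov.toFun P := by
  have hP := mem_chart_source (EuclideanSpace ℝ (Fin m)) P
  obtain ⟨W, hW, hoW, hPW⟩ := mem_nhds_iff.1 H
  set U : Set M := (chartAt (EuclideanSpace ℝ (Fin m)) P).source ∩ extChartAt (𝓡 m) P ⁻¹' W with hU
  have hoU : IsOpen U := by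
    have := (continuousOn_extChartAt (I := 𝓡 m) P).isOpen_inter_preimage
      (isOpen_extChartAt_source P) hoW
    rwa [extChartAt_source] at this
  have hne : ∀ y ∈ U, f₀ y ≠ 0 := fun y hy => by
    have := (hW hy.2).ne_zero
    rwa [localRep_apply hy.1] at this
  have hfs : ∀ y ∈ U, ContMDiffAt (𝓡 m) 𝓘(ℝ, ℝ) ∞ f₀ y := fun y hy =>
    (contMDiffAt_iff_coord le_rfl hy.1).2 (hW hy.2).contDiffAt_factor
  set g : M → ℝ := fun y => Real.log (f₀ y) with hg
  have hgs' : ∀ y ∈ U, ContDiffAt ℝ ∞ (localRep P g) (extChartAt (𝓡 m) P y) := fun y hy =>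
    (hW hy.2).contDiffAt_factor.log (hW hy.2).ne_zero
  have hgs : ∀ y ∈ U, ContMDiffAt (𝓡 m) 𝓘(ℝ, ℝ) ∞ g y := fun y hy =>
    (contMDiffAt_iff_coord le_rfl hy.1).2 (hgs' y hy)
  have hgd : ∀ y ∈ U, fderiv ℝ (localRep P g) (extChartAt (𝓡 m) P y) =
      (localRep P f₀ (extChartAt (𝓡 m) P y))⁻¹ •
        fderiv ℝ (localRep P f₀) (extChartAt (𝓡 m) P y) := fun y hy =>
    ((hW hy.2).contDiffAt_factor.differentiableAt (by simp)).hasFDerivAt.log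
      (hW hy.2).ne_zero |>.fderiv
  have hform : ∀ y ∈ U, formRep P (fun y => mvfderiv (𝓡 m) g y) =ᶠ[𝓝 (extChartAt (𝓡 m) P y)]
      fderiv ℝ (localRep P g) := by
    intro y hy
    filter_upwards [(eventually_coord_iff hy.1).2 (hoU.mem_nhds hy), extChartAt_target_mem hy.1]
      with x hx hx'
    have := formRep_mvfderiv hx.1 ((hgs _ hx).mdifferentiableAt (by simp))
    rwa [(extChartAt (𝓡 m) P).right_inv hx'] at this
  have hθs : ∀ y ∈ U, ∃ P : M, y ∈ (chartAt (EuclideanSpace ℝ (Fin m)) P).source ∧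
      ContDiffAt ℝ ∞ (formRep P fun y => mvfderiv (𝓡 m) g y) (extChartAt (𝓡 m) P y) := fun y hy =>
    ⟨P, hy.1, ((hgs' y hy).fderiv_right (by simp)).congr_of_eventuallyEq (hform y hy)⟩
  set cov' : FieldDerivation m M := projectiveChange cov.toFun fun y => mvfderiv (𝓡 m) g y with hc
  have hcovU : IsCovariantDerivativeOn (EuclideanSpace ℝ (Fin m)) cov.toFun U :=
    cov.isCovariantDerivativeOnUniv.mono (Set.subset_univ U)
  have hcov' := isCovariantDerivativeOn_projectiveChange hcovU fun y => mvfderiv (𝓡 m) g y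
  have hsm' : ContMDiffCovariantDerivativeOn (EuclideanSpace ℝ (Fin m)) ∞ cov' U := by
    refine contMDiffCovariantDerivativeOn_projectiveChange hoU hcovU ⟨fun {σ} hσ y hy => ?_⟩ hθs
    exact (contMDiffAt_cov isOpen_univ cov.isCovariantDerivativeOnUniv hsm.contMDiff trivial hoU hy
      (hσ.of_le (by simp))).contMDiffWithinAt
  refine ⟨U, hoU, ⟨hP, hPW⟩, cov', ⟨hcov', hsm', fun y hy u v w => ?_⟩,
    fun y => mvfderiv (𝓡 m) g y, smoothFormOn_of_formRep hoU hθs, closedFormOn_mvfderiv hoU hgs,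
    providesProjectiveEquivalenceOn_projectiveChange _⟩
  apply coordVec_injective hy.1
  rw [curvature_eq_coord hoU hcov' hsm' hy.1 hy, map_zero]
  refine localCurvature_eq_zero_of_projectivelyAffine (A := christoffel cov.toFun P)
    (φ := localRep P f₀) (h := h)
    ((contDiffAt_christoffel hoU hcov' hsm' hy.1 hy).differentiableAt (by simp)) ?_
    (Filter.mem_of_superset (hoW.mem_nhds hy.2) hW) _ _ _
  filter_upwards [(eventually_coord_iff hy.1).2 (hoU.mem_nhds hy), extChartAt_target_mem hy.1,
    hform y hy] with x hx hx' hx''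
  have h1 := christoffel_projectiveChange hcovU (fun y => mvfderiv (𝓡 m) g y) hx.1 hx
  have h2 := hgd _ hx
  rw [(extChartAt (𝓡 m) P).right_inv hx'] at h1 h2
  rw [h1, hx'', h2]

/-- A full space of germs of solutions forces strong projective flatness. -/
lemma stronglyProjectivelyFlatAt_of_finrank
    (h : Module.finrank ℝ (solutionGerms cov.toFun P μ) = m + 1) :
    StronglyProjectivelyFlatAt cov.toFun P := by
  obtain ⟨φ, hφ⟩ := exists_normalized_basis h
  obtain ⟨f, hf, hfφ⟩ := exists_representatives φ
  exact stronglyProjectivelyFlatAt_of_projectivelyAffine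
    ((eventually_isProjectivelyAffineAt φ hφ hf hfφ).mono fun x hx => hx.1)

end

end

section

variable {m : ℕ} {M : Type*} [TopologicalSpace M]
  [ChartedSpace (EuclideanSpace ℝ (Fin m)) M] [IsManifold (𝓡 m) ∞ M]

/-! ### Solutions for a strongly projectively flat connection -/

variable {P y : M} [T2Space M]

section

variable {U : Set M} {θ : (x : M) → TangentSpace (𝓡 m) x →L[ℝ] ℝ}

lemma isOpen_target_inter_preimage (hU : IsOpen U) :
    IsOpen ((extChartAt (𝓡 m) P).target ∩ (extChartAt (𝓡 m) P).symm ⁻¹' U) :=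
  (continuousOn_extChartAt_symm P).isOpen_inter_preimage (isOpen_extChartAt_target P) hU

/-- A field which is constant in a chart, extended globally. -/
lemma exists_constant_field (hy : y ∈ (chartAt (EuclideanSpace ℝ (Fin m)) P).source)
    (v : EuclideanSpace ℝ (Fin m)) :
    ∃ X : (x : M) → TangentSpace (𝓡 m) x, SmoothFieldOn X Set.univ ∧ coordVec P y (X y) = v ∧
      coordRep P X =ᶠ[𝓝 (extChartAt (𝓡 m) P y)] (fun _ => v) ∧
      ∀ᶠ z in 𝓝 y, X z = frameField P v z := by
  obtain ⟨X, hX, hXe⟩ := exists_smooth_extension_frameField hy v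
  refine ⟨X, hX, ?_, (coordRep_congr hy hXe).trans (coordRep_frameField hy v), hXe⟩
  rw [hXe.self_of_nhds]
  exact coordVec_frameVec hy v

lemma localRep_form_apply {X : (x : M) → TangentSpace (𝓡 m) x} {v : EuclideanSpace ℝ (Fin m)}
    (hy : y ∈ (chartAt (EuclideanSpace ℝ (Fin m)) P).source)
    (hX : ∀ᶠ z in 𝓝 y, X z = frameField P v z) :
    localRep P (fun z => θ z (X z)) =ᶠ[𝓝 (extChartAt (𝓡 m) P y)] fun x => formRep P θ x v := by
  filter_upwards [(eventually_coord_iff hy).2 hX] with x hx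
  change θ _ (X _) = _
  rw [hx]
  rfl

/-- Smoothness of `θ` is tested only on fields smooth on `U`; the frame fields become admissible
after a cutoff. -/
lemma contDiffOn_formRep (hU : IsOpen U) (hθ : SmoothFormOn θ U) :
    ContDiffOn ℝ ∞ (formRep P θ)
      ((extChartAt (𝓡 m) P).target ∩ (extChartAt (𝓡 m) P).symm ⁻¹' U) := by
  refine contDiffOn_clm_apply.2 fun v x hx => ContDiffAt.contDiffWithinAt ?_
  have hy := symm_mem_source hx.1
  obtain ⟨X, hX, -, -, hXe⟩ := exists_constant_field hy v
  have h1 := (hθ X (hX.mono (Set.subset_univ U))).contMDiffAt (hU.mem_nhds hx.2)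
  have h2 := ((contMDiffAt_iff_coord le_rfl hy).1 h1).congr_of_eventuallyEq
    (localRep_form_apply hy hXe).symm
  rwa [(extChartAt (𝓡 m) P).right_inv hx.1] at h2

/-- Closedness, evaluated on fields with constant components near the point, where the bracket term
is zero. -/
lemma fderiv_formRep_symm (hU : IsOpen U) (hθ : SmoothFormOn θ U) (hc : ClosedFormOn θ U)
    {x : EuclideanSpace ℝ (Fin m)}
    (hx : x ∈ (extChartAt (𝓡 m) P).target ∩ (extChartAt (𝓡 m) P).symm ⁻¹' U)
    (u v : EuclideanSpace ℝ (Fin m)) :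
    fderiv ℝ (formRep P θ) x u v = fderiv ℝ (formRep P θ) x v u := by
  have hy := symm_mem_source hx.1
  have hr := (extChartAt (𝓡 m) P).right_inv hx.1
  obtain ⟨X, hX, hXv, hXc, hXe⟩ := exists_constant_field hy u
  obtain ⟨Y, hY, hYv, hYc, hYe⟩ := exists_constant_field hy v
  have hXU := hX.mono (Set.subset_univ U)
  have hYU := hY.mono (Set.subset_univ U)
  have hd : DifferentiableAt ℝ (formRep P θ) x :=
    ((contDiffOn_formRep hU hθ).contDiffAt
      ((isOpen_target_inter_preimage hU).mem_nhds hx)).differentiableAt (by simp)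
  have hb : VectorField.mlieBracket (𝓡 m) X Y ((extChartAt (𝓡 m) P).symm x) = 0 := by
    apply coordVec_injective hy
    rw [coordVec_mlieBracket hy (mdifferentiableAt_of_smoothFieldOn Filter.univ_mem hX)
      (mdifferentiableAt_of_smoothFieldOn Filter.univ_mem hY), hXc.fderiv_eq, hYc.fderiv_eq, map_zero]
    simp
  have key : ∀ (Z W : (x : M) → TangentSpace (𝓡 m) x) (w : EuclideanSpace ℝ (Fin m)),
      SmoothFieldOn W U → (∀ᶠ z in 𝓝 ((extChartAt (𝓡 m) P).symm x), W z = frameField P w z) →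
      mvfderiv (𝓡 m) (fun y => θ y (W y)) ((extChartAt (𝓡 m) P).symm x) 
        (Z ((extChartAt (𝓡 m) P).symm x)) = fderiv ℝ (formRep P θ) x
          (coordVec P ((extChartAt (𝓡 m) P).symm x) (Z ((extChartAt (𝓡 m) P).symm x))) w := by
    intro Z W w hW hWe
    have h1 := ((hθ W hW).contMDiffAt (hU.mem_nhds hx.2)).mdifferentiableAt (by simp)
    rw [mvfderiv_eq_coord hy h1, (localRep_form_apply hy hWe).fderiv_eq, hr,
      fderiv_clm_apply hd (differentiableAt_const w)]
    simp
  have h := hc X Y hXU hYU _ hx.2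
  rw [hb, map_zero, sub_zero, key X Y v hYU hYe, key Y X u hXU hXe, hXv, hYv] at h
  exact sub_eq_zero.1 h

/-- The equivalence is tested on a globally smooth field through the given vector; both sides
contain the same derivative of its components, which cancels. -/
lemma christoffel_of_projectiveEquivalence {cov cov' : FieldDerivation m M}
    (hcov : IsCovariantDerivativeOn (EuclideanSpace ℝ (Fin m)) cov U)
    (hcov' : IsCovariantDerivativeOn (EuclideanSpace ℝ (Fin m)) cov' U)
    (h : ProvidesProjectiveEquivalenceOn θ cov cov' U)
    (hy : y ∈ (chartAt (EuclideanSpace ℝ (Fin m)) P).source) (hyU : y ∈ U) :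
    christoffel cov P (extChartAt (𝓡 m) P y) = christoffel cov' P (extChartAt (𝓡 m) P y) +
      symmProd (formRep P θ (extChartAt (𝓡 m) P y)) := by
  ext1 v
  ext1 w
  obtain ⟨X, hX, hXv, -, -⟩ := exists_constant_field hy v
  have hXd := mdifferentiableAt_of_smoothFieldOn (y := y) Filter.univ_mem hX
  have h1 := congrArg (coordVec P y) (h X (hX.mono (Set.subset_univ U)) y hyU (frameVec P y w))
  rw [coordVec_cov hcov hy hyU hXd, map_add, map_add, coordVec_cov hcov' hy hyU hXd, map_smul,
    map_smul, coordVec_frameVec hy, hXv, ← formRep_apply hy, ← formRep_apply hy,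
    coordVec_frameVec hy, hXv] at h1
  rw [add_apply, add_apply, symmProd_apply]
  rw [add_assoc, add_assoc, add_left_cancel_iff] at h1
  rw [h1]
  abel

end

variable {cov : CovariantDerivative (𝓡 m) (EuclideanSpace ℝ (Fin m))
      (TangentSpace (𝓡 m) : M → Type _)}
    [hsm : CovariantDerivative.ContMDiffCovariantDerivative cov ∞] {μ : ℝ}

/-- The tensor `S` of projectively affine coordinates is `-ρ / (m - 1)`. -/
lemma inducedPotential_eq_localPotential (hm : 2 ≤ m) (htorsion : cov.torsion = 0)
    {φ : EuclideanSpace ℝ (Fin m) → ℝ} {h : EuclideanSpace ℝ (Fin m) → EuclideanSpace ℝ (Fin m)}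
    {x : EuclideanSpace ℝ (Fin m)} (hx : x ∈ (extChartAt (𝓡 m) P).target)
    (H : ∀ᶠ z in 𝓝 x, IsProjectivelyAffineAt (christoffel cov.toFun P) φ h z) :
    inducedPotential (christoffel cov.toFun P) φ x =
      localPotential cov.toFun (-1 / ((m : ℝ) - 1)) P x := by
  have hA : DifferentiableAt ℝ (christoffel cov.toFun P) x :=
    ((contDiffOn_christoffel_target cov).contDiffAt
      ((isOpen_extChartAt_target P).mem_nhds hx)).differentiableAt (by simp)
  ext u v
  -- Without torsion `S` is symmetric. Hence so is `ρ = (1 - m) S`, and `ρ` equals `ρ_s`.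
  have hsymm := inducedPotential_symm (A := christoffel cov.toFun P)
    (H.self_of_nhds.contDiffAt_factor.of_le two_le_infty)
    (fun a b => by
      have := christoffel_symm cov htorsion (symm_mem_source hx) a b
      rwa [(extChartAt (𝓡 m) P).right_inv hx] at this) u v
  have hm1 : (m : ℝ) - 1 ≠ 0 := by
    have : (2 : ℝ) ≤ m := by exact_mod_cast hm
    linarith
  rw [localPotential_apply, localRicciSymm_apply, IsProjectivelyAffineAt.localRicci_eq hA H,
    IsProjectivelyAffineAt.localRicci_eq hA H, ← hsymm, finrank_euclideanSpace_fin]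
  field_simp
  ring

/-- Projectively affine coordinates provide a full space of solutions. -/
lemma finrank_of_projectivelyAffine (hm : 2 ≤ m) (htorsion : cov.torsion = 0)
    {φ : EuclideanSpace ℝ (Fin m) → ℝ} {h : EuclideanSpace ℝ (Fin m) → EuclideanSpace ℝ (Fin m)}
    (hφ : φ (extChartAt (𝓡 m) P P) = 1) (hh : h (extChartAt (𝓡 m) P P) = 0)
    (hd : fderiv ℝ h (extChartAt (𝓡 m) P P) = ContinuousLinearMap.id ℝ _)
    (H : ∀ᶠ z in 𝓝 (extChartAt (𝓡 m) P P),
      IsProjectivelyAffineAt (christoffel cov.toFun P) φ h z) :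
    Module.finrank ℝ (solutionGerms cov.toFun P (-1 / ((m : ℝ) - 1))) = m + 1 := by
  have hP := mem_chart_source (EuclideanSpace ℝ (Fin m)) P
  rw [← jet_surjective_iff]
  rintro ⟨a, ξ⟩
  set x₀ := extChartAt (𝓡 m) P P with hx₀
  -- At the base point `φ = 1`, `h = 0` and `dh = id`, so `φ (a + l ∘ h)` has value `a` and
  -- differential `a dφ + l`, which must equal `ξ`.
  set l : EuclideanSpace ℝ (Fin m) →L[ℝ] ℝ := ξ - a • fderiv ℝ φ x₀ with hl
  set g : EuclideanSpace ℝ (Fin m) → ℝ := fun z => φ z • (a + l (h z)) with hg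
  have he : ∀ x ∈ (extChartAt (𝓡 m) P).target,
      localRep P (g ∘ extChartAt (𝓡 m) P) x = g x := fun x hx =>
    congrArg g ((extChartAt (𝓡 m) P).right_inv hx)
  have he' : ∀ᶠ x in 𝓝 x₀, localRep P (g ∘ extChartAt (𝓡 m) P) =ᶠ[𝓝 x] g := by
    filter_upwards [(isOpen_extChartAt_target P).mem_nhds
      (mem_of_mem_nhds (extChartAt_target_mem hP))] with x hx
    exact Filter.eventuallyEq_of_mem ((isOpen_extChartAt_target P).mem_nhds hx) he
  have hsol : SolvesNear cov.toFun (-1 / ((m : ℝ) - 1)) (g ∘ extChartAt (𝓡 m) P) P := by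
    rw [solvesNear_iff hP]
    filter_upwards [H.eventually_nhds, extChartAt_target_mem hP, he'] with x hx hxt hxe
    have hx1 := hx.self_of_nhds
    refine ⟨ContDiffAt.congr_of_eventuallyEq (hx1.contDiffAt_factor.smul
      (contDiffAt_const.add (l.contDiff.contDiffAt.comp x hx1.contDiffAt))) hxe, ?_⟩
    intro u v
    rw [← inducedPotential_eq_localPotential hm htorsion hxt hx]
    exact ((hx1.hessianEqAt a l).congr hxe) u v
  refine ⟨hsol.germ, ?_⟩
  have hH := H.self_of_nhds
  have hder : HasFDerivAt g (φ x₀ • (l ∘L fderiv ℝ h x₀) +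
      (fderiv ℝ φ x₀).smulRight (a + l (h x₀))) x₀ :=
    (hH.contDiffAt_factor.differentiableAt (by simp)).hasFDerivAt.fun_smul
      ((l.hasFDerivAt.comp x₀ (hH.contDiffAt.differentiableAt (by simp)).hasFDerivAt).const_add a)
  rw [jet_eq (f := g ∘ extChartAt (𝓡 m) P) rfl, he'.self_of_nhds.fderiv_eq, hder.fderiv]
  refine Prod.ext ?_ (ContinuousLinearMap.ext fun u => ?_)
  · change g x₀ = a
    simp [hg, hφ, hh]
  · simp [hφ, hh, hd, hl]
    ring

/-- A strongly projectively flat connection has a full space of germs of solutions for the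
parameter `-1 / (m - 1)`. -/
lemma finrank_of_stronglyProjectivelyFlatAt (hm : 2 ≤ m) (htorsion : cov.torsion = 0)
    (h : StronglyProjectivelyFlatAt cov.toFun P) :
    Module.finrank ℝ (solutionGerms cov.toFun P (-1 / ((m : ℝ) - 1))) = m + 1 := by
  obtain ⟨U, hU, hPU, cov', hflat, θ, hθ, hc, hproj⟩ := h
  have hP := mem_chart_source (EuclideanSpace ℝ (Fin m)) P
  set T := (extChartAt (𝓡 m) P).target ∩ (extChartAt (𝓡 m) P).symm ⁻¹' U with hT
  have hoT : IsOpen T := isOpen_target_inter_preimage hU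
  have hxT : extChartAt (𝓡 m) P P ∈ T :=
    ⟨mem_of_mem_nhds (extChartAt_target_mem hP), by
      rw [Set.mem_preimage, symm_extChartAt hP]
      exact hPU⟩
  have hA : ∀ x ∈ T, christoffel cov.toFun P x =
      christoffel cov' P x + symmProd (formRep P θ x) := fun x hx => by
    have := christoffel_of_projectiveEquivalence
      (cov.isCovariantDerivativeOnUniv.mono (Set.subset_univ U)) hflat.isCovariantDerivativeOn
      hproj (symm_mem_source hx.1) hx.2
    rwa [(extChartAt (𝓡 m) P).right_inv hx.1] at this
  -- Flatness of `cov'` says nothing about torsion; symmetry is inherited from `∇`, because the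
  -- projective term is symmetric.
  have hsymm : ∀ x ∈ T, ∀ u v, christoffel cov' P x u v = christoffel cov' P x v u :=
    fun x hx u v => by
      have := christoffel_symm cov htorsion (symm_mem_source hx.1) u v
      rw [(extChartAt (𝓡 m) P).right_inv hx.1, hA x hx] at this
      simp only [add_apply, symmProd_apply] at this
      rwa [add_comm (formRep P θ x u • v), add_left_inj] at this
  have hcurv : ∀ x ∈ T, ∀ u v w, localCurvature (christoffel cov' P) x u v w = 0 := by
    intro x hx u v w
    have hy := symm_mem_source hx.1
    have := curvature_eq_coord hU hflat.isCovariantDerivativeOn hflat.smooth hy hx.2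
      (frameVec P _ u) (frameVec P _ v) (frameVec P _ w)
    rw [hflat.curvature_eq_zero _ hx.2, map_zero, coordVec_frameVec hy, coordVec_frameVec hy,
      coordVec_frameVec hy, (extChartAt (𝓡 m) P).right_inv hx.1] at this
    exact this.symm
  obtain ⟨φ, h, h1, h2, h3, h4⟩ := exists_projectivelyAffine hoT hxT (contDiffOn_formRep hU hθ)
    (fun z hz => fderiv_formRep_symm hU hθ hc hz)
    (contDiffOn_christoffel hU hflat.isCovariantDerivativeOn hflat.smooth) hsymm hcurv hA
  exact finrank_of_projectivelyAffine hm htorsion h1 h2 h3 h4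

end

section

section Monodromy

/-! ### Gluing local solutions on a simply connected space -/

variable {X Y C : Type*} [TopologicalSpace X]

/-- The change of frame between two families of local functions with the same germs. -/
def frameChange [Nonempty C] (s : X → C → X → Y) (P Q y : X) (c : C) : C :=
  Function.invFun (fun c => (s Q c : Filter.Germ (𝓝 y) Y)) (s P c : Filter.Germ (𝓝 y) Y)

/-- `Function.invFun` returns a default value when no `c'` matches. Together with uniqueness of the
match, this property determines the change of frame. -/
lemma frameChange_spec [Nonempty C] {s : X → C → X → Y} {P Q y : X} {c : C}
    (h : ∃ c', s Q c' =ᶠ[𝓝 y] s P c) : s Q (frameChange s P Q y c) =ᶠ[𝓝 y] s P c := by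
  obtain ⟨c', hc'⟩ := h
  exact Filter.Germ.coe_eq.1 (Function.invFun_eq
    (f := fun c => (s Q c : Filter.Germ (𝓝 y) Y)) ⟨c', Filter.Germ.coe_eq.2 hc'⟩)

/-- If the germs of a family of local functions form a local system, then on a simply connected
space every local function of the family extends globally. -/
theorem exists_global_section [SimplyConnectedSpace X] [LocallyPathConnectedSpace X]
    {V : X → Set X} (hV : ∀ P, IsOpen (V P)) (hPV : ∀ P, P ∈ V P) {s : X → C → X → Y}
    (hinj : ∀ P, ∀ y ∈ V P, ∀ c c', s P c =ᶠ[𝓝 y] s P c' → c = c')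
    (hsurj : ∀ P Q, ∀ y ∈ V P ∩ V Q, ∀ c, ∃ c', s Q c' =ᶠ[𝓝 y] s P c) (P : X) (c : C) :
    ∃ g : X → Y, g =ᶠ[𝓝 P] s P c ∧ ∀ Q, ∃ c', g =ᶠ[𝓝 Q] s Q c' := by
  have hne : Nonempty C := ⟨c⟩
  -- With the discrete topology on the parameters, the germs of the family are the points of a fibre
  -- bundle with discrete fibre, that is, of a covering.
  let _ : TopologicalSpace C := ⊥
  have _ : DiscreteTopology C := ⟨rfl⟩
  let Z : FiberBundleCore X X C :=
    { baseSet := V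
      isOpen_baseSet := hV
      indexAt := id
      mem_baseSet_at := hPV
      coordChange := frameChange s
      coordChange_self := fun Q y hy c =>
        hinj Q y hy _ _ (frameChange_spec (hsurj Q Q y ⟨hy, hy⟩ c))
      continuousOn_coordChange := fun P Q p hp => by
        refine ContinuousAt.continuousWithinAt ?_
        obtain ⟨y, c⟩ := p
        have h1 := frameChange_spec (hsurj P Q y hp.1 c)
        refine (continuousAt_const (y := frameChange s P Q y c)).congr ?_
        -- Two functions with the same germ at `y` have the same germ at nearby points, and the
        -- matching parameter is unique there, so the transition is locally constant.
        have h2 : ∀ᶠ z in 𝓝 y, frameChange s P Q z c = frameChange s P Q y c := by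
          filter_upwards [h1.eventually_nhds, (hV Q).mem_nhds hp.1.2, (hV P).mem_nhds hp.1.1]
            with z hz hzQ hzP
          exact hinj Q z hzQ _ _
            ((frameChange_spec (hsurj P Q z ⟨hzP, hzQ⟩ c)).trans (Filter.EventuallyEq.symm hz))
        rw [nhds_prod_eq, nhds_discrete C]
        have h3 : ∀ᶠ q : X × C in 𝓝 y ×ˢ pure c, frameChange s P Q q.1 c = frameChange s P Q y c ∧
            q.2 = c := h2.prod_mk (pb := fun b => b = c) (Filter.eventually_pure.2 rfl)
        filter_upwards [h3] with q hq
        rw [hq.2, hq.1]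
      coordChange_comp := fun i j k y hy c => by
        refine hinj k y hy.2 _ _ ?_
        exact (frameChange_spec (hsurj j k y ⟨hy.1.2, hy.2⟩ _)).trans
          ((frameChange_spec (hsurj i j y hy.1 c)).trans
            (frameChange_spec (hsurj i k y ⟨hy.1.1, hy.2⟩ c)).symm) }
  have hcov : IsCoveringMap Z.proj :=
    IsCoveringMap.mk _ (fun _ => C) (fun Q => Z.localTriv Q) hPV
  -- Simple connectedness: the identity lifts to a section of the covering through the prescribed
  -- germ at `P`.
  obtain ⟨F, ⟨hFP, hF⟩, -⟩ := hcov.existsUnique_continuousMap_lifts (ContinuousMap.id X) P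
    (⟨P, c⟩ : Z.TotalSpace) rfl
  have hF1 : ∀ y, (F y).1 = y := fun y => congrFun hF y
  have key : ∀ Q, (fun y => s (F y).1 (F y).2 y) =ᶠ[𝓝 Q]
      s Q (frameChange s (F Q).1 Q (F Q).1 (F Q).2) := by
    intro Q
    have hmem : F Q ∈ (Z.localTriv Q).source := by
      rw [Z.mem_localTriv_source]
      change (F Q).1 ∈ V Q
      rw [hF1]
      exact hPV Q
    -- In the trivialization at `Q` the section has a continuous, hence locally constant, parameter,
    -- so the glued function is a single member of the family near `Q`.
    have hc : ContinuousAt (fun y => (Z.localTriv Q (F y)).2) Q :=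
      continuousAt_snd.comp (((Z.localTriv Q).continuousAt hmem).comp F.continuous.continuousAt)
    have hc' : ∀ᶠ y in 𝓝 Q, (Z.localTriv Q (F y)).2 = (Z.localTriv Q (F Q)).2 :=
      hc.eventually (p := fun z => z = (Z.localTriv Q (F Q)).2)
        (by rw [nhds_discrete C]; exact Filter.eventually_pure.2 rfl)
    filter_upwards [hc', (hV Q).mem_nhds (hPV Q)] with y hy hyV
    rw [Z.localTriv_apply, Z.localTriv_apply] at hy
    change frameChange s (F y).1 Q (F y).1 (F y).2 = frameChange s (F Q).1 Q (F Q).1 (F Q).2 at hy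
    rw [← hy]
    have h1 := frameChange_spec (hsurj (F y).1 Q (F y).1
      ⟨hPV _, by rw [hF1]; exact hyV⟩ (F y).2)
    have h2 := h1.self_of_nhds
    rw [hF1 y] at h2 ⊢
    exact h2.symm
  refine ⟨fun y => s (F y).1 (F y).2 y, ?_, fun Q => ⟨_, key Q⟩⟩
  have h1 := key P
  rw [hFP] at h1
  have h2 : frameChange s P P P c = c :=
    hinj P P (hPV P) _ _ (frameChange_spec (hsurj P P P ⟨hPV P, hPV P⟩ c))
  rw [← h2]
  exact h1

end Monodromy

end

section

variable {m : ℕ} {M : Type*} [TopologicalSpace M]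
  [ChartedSpace (EuclideanSpace ℝ (Fin m)) M] [IsManifold (𝓡 m) ∞ M]

/-! ### Global solutions on a simply connected manifold -/

variable {P y : M} [T2Space M] {cov : CovariantDerivative (𝓡 m) (EuclideanSpace ℝ (Fin m))
      (TangentSpace (𝓡 m) : M → Type _)}
    [hsm : CovariantDerivative.ContMDiffCovariantDerivative cov ∞] {μ : ℝ}

lemma SolvesNear.congr {f g : M → ℝ} (hf : SolvesNear cov.toFun μ f y) (h : g =ᶠ[𝓝 y] f) :
    SolvesNear cov.toFun μ g y := by
  have hy := mem_chart_source (EuclideanSpace ℝ (Fin m)) y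
  rw [solvesNear_iff hy] at hf ⊢
  filter_upwards [hf, ((localRep_eventuallyEq hy).2 h).eventually_nhds] with x hx hxe
  exact ⟨hx.1.congr_of_eventuallyEq hxe, hx.2.congr hxe⟩

/-- The linear combination `∑ c_i f_i`. -/
def linComb (f : Fin (m + 1) → M → ℝ) (c : Fin (m + 1) → ℝ) : M → ℝ := ∑ i, c i • f i

lemma linComb_coe (f : Fin (m + 1) → M → ℝ) (c : Fin (m + 1) → ℝ) :
    (linComb f c : Filter.Germ (𝓝 y) ℝ) = ∑ i, c i • (f i : Filter.Germ (𝓝 y) ℝ) := by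
  have h := map_sum (Filter.Germ.coeAddHom (M := ℝ) (𝓝 y)) (fun i => c i • f i) Finset.univ
  exact h

lemma solvesNear_linComb {f : Fin (m + 1) → M → ℝ} (hf : ∀ i, SolvesNear cov.toFun μ (f i) y)
    (c : Fin (m + 1) → ℝ) : SolvesNear cov.toFun μ (linComb f c) y := by
  have h : ((∑ i, c i • (hf i).germ : solutionGerms cov.toFun y μ) : Filter.Germ (𝓝 y) ℝ) =
      (linComb f c : Filter.Germ (𝓝 y) ℝ) := by
    rw [linComb_coe, Submodule.coe_sum]
    rfl
  obtain ⟨g, hg, hgφ⟩ := (∑ i, c i • (hf i).germ : solutionGerms cov.toFun y μ).2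
  exact hg.congr (Filter.Germ.coe_eq.1 (hgφ.trans h).symm)

/-- A frame of local solutions. -/
lemma exists_local_frame (h : Module.finrank ℝ (solutionGerms cov.toFun P μ) = m + 1) :
    ∃ V : Set M, IsOpen V ∧ P ∈ V ∧ ∃ f : Fin (m + 1) → M → ℝ,
      (∀ y ∈ V, ∀ i, SolvesNear cov.toFun μ (f i) y) ∧
      (∀ y ∈ V, ∀ c c', linComb f c =ᶠ[𝓝 y] linComb f c' → c = c') ∧
      (∀ y ∈ V, ∀ g, SolvesNear cov.toFun μ g y → ∃ c, linComb f c =ᶠ[𝓝 y] g) := by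
  have hlc : LocallyConnectedSpace M :=
    ChartedSpace.locallyConnectedSpace (EuclideanSpace ℝ (Fin m)) M
  let φ : Module.Basis (Fin (m + 1)) ℝ (solutionGerms cov.toFun P μ) :=
    Module.finBasisOfFinrankEq ℝ _ h
  obtain ⟨f, hf, hfφ⟩ := exists_representatives φ
  have hev : ∀ᶠ y in 𝓝 P, ∀ i, SolvesNear cov.toFun μ (f i) y :=
    Filter.eventually_all.2 fun i => (hf i).eventually_nhds
  -- `V` is taken connected, so that by unique continuation a linear relation between the germs at
  -- any `y ∈ V` is already a relation at `P`.
  obtain ⟨V, ⟨hVo, hPV, hVc⟩, hV⟩ :=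
    (LocallyConnectedSpace.open_connected_basis P).mem_iff.1 hev
  have hsol : ∀ y ∈ V, ∀ i, SolvesNear cov.toFun μ (f i) y := fun y hy => hV hy
  have hinj : ∀ y ∈ V, ∀ c, linComb f c =ᶠ[𝓝 y] 0 → c = 0 := by
    intro y hy c hc
    have h0 := (eventually_eq_zero_of_preconnected hVc.isPreconnected
      (fun z hz => solvesNear_linComb (hsol z hz) c) hy hc) P hPV
    have h1 : ∑ i, c i • φ i = 0 := by
      apply Subtype.ext
      rw [Submodule.coe_sum]
      simp only [Submodule.coe_smul, ← hfφ]
      rw [← linComb_coe]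
      exact Filter.Germ.coe_eq.2 h0
    exact funext (Fintype.linearIndependent_iff.1 φ.linearIndependent c h1)
  refine ⟨V, hVo, hPV, f, hsol, fun y hy c c' hcc => ?_, fun y hy g hg => ?_⟩
  · refine sub_eq_zero.1 (hinj y hy _ ?_)
    filter_upwards [hcc] with z hz
    simp only [linComb, Finset.sum_apply, Pi.smul_apply, Pi.sub_apply, sub_smul,
      Finset.sum_sub_distrib] at hz ⊢
    rw [hz, sub_self]
    rfl
  · let T : (Fin (m + 1) → ℝ) →ₗ[ℝ] solutionGerms cov.toFun y μ :=
      Fintype.linearCombination ℝ fun i => (hsol y hy i).germ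
    have hT : ∀ c, (T c : Filter.Germ (𝓝 y) ℝ) = (linComb f c : Filter.Germ (𝓝 y) ℝ) := fun c => by
      rw [linComb_coe, Fintype.linearCombination_apply, Submodule.coe_sum]
      rfl
    have hTi : Function.Injective T := by
      rw [← LinearMap.ker_eq_bot, LinearMap.ker_eq_bot']
      intro c hc
      refine hinj y hy c (Filter.Germ.coe_eq.1 ?_)
      rw [← hT, hc]
      rfl
    -- The `m + 1` independent germs meet the upper bound for the dimension at `y`, so they span all
    -- solutions there.
    have hfr : Module.finrank ℝ (Fin (m + 1) → ℝ) =
        Module.finrank ℝ (solutionGerms cov.toFun y μ) := by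
      refine le_antisymm (LinearMap.finrank_le_finrank_of_injective hTi) ?_
      rw [Module.finrank_fin_fun]
      exact finrank_solutionGerms_le
    obtain ⟨c, hc⟩ := (LinearMap.injective_iff_surjective_of_finrank_eq_finrank hfr).1 hTi hg.germ
    refine ⟨c, Filter.Germ.coe_eq.1 ?_⟩
    rw [← hT, hc]
    rfl

/-- Local solutions, written in local frames, form a local system with coefficient vectors as
parameters. Solving the equation is a local property, so a global section is a global solution. -/
lemma toGerm_surjective [SimplyConnectedSpace M]
    (h : ∀ P, Module.finrank ℝ (solutionGerms cov.toFun P μ) = m + 1) :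
    Function.Surjective (toGerm P cov μ) := by
  have hlp : LocallyPathConnectedSpace M :=
    ChartedSpace.locallyPathConnectedSpace (EuclideanSpace ℝ (Fin m)) M
  choose V hV hPV f hf hinj hsurj using fun P => exists_local_frame (h P)
  intro φ
  obtain ⟨g₀, hg₀, hg₀φ⟩ := φ.2
  obtain ⟨c, hc⟩ := hsurj P P (hPV P) g₀ hg₀
  obtain ⟨g, hgP, hg⟩ := exists_global_section hV hPV (s := fun P c => linComb (f P) c) hinj
    (fun P Q y hy c => hsurj Q y hy.2 _ (solvesNear_linComb (hf P y hy.1) c)) P c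
  have hgs : ∀ Q, ContMDiffAt (𝓡 m) 𝓘(ℝ, ℝ) ∞ g Q ∧ SolvesAt cov.toFun μ g Q := fun Q => by
    obtain ⟨c', hc'⟩ := hg Q
    exact ((solvesNear_linComb (hf Q Q (hPV Q)) c').congr hc').self_of_nhds
  refine ⟨⟨g, fun Q => (hgs Q).1.of_le two_le_infty, fun Q => (hgs Q).2⟩, Subtype.ext ?_⟩
  rw [← hg₀φ]
  exact Filter.Germ.coe_eq.2 (hgP.trans hc)

lemma finrank_solutionSpace [SimplyConnectedSpace M]
    (h : ∀ P, Module.finrank ℝ (solutionGerms cov.toFun P μ) = m + 1) :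
    Module.finrank ℝ (solutionSpace cov.toFun μ) = m + 1 := by
  obtain ⟨P⟩ : Nonempty M := inferInstance
  rw [← h P]
  exact (LinearEquiv.ofBijective _ ⟨toGerm_injective (P := P), toGerm_surjective h⟩).finrank_eq

end

section

variable {m : ℕ} {M : Type*} [TopologicalSpace M]
  [ChartedSpace (EuclideanSpace ℝ (Fin m)) M] [IsManifold (𝓡 m) ∞ M]

/-! ### Curves in coordinates -/

section SecondDerivative

variable {E F : Type*} [NormedAddCommGroup E] [NormedSpace ℝ E]
  [NormedAddCommGroup F] [NormedSpace ℝ F]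

lemma eventually_hasDerivAt_comp {ψ : E → F} {ξ : ℝ → E} {t : ℝ} (hψ : ContDiffAt ℝ 2 ψ (ξ t))
    (hξ : ContDiffAt ℝ 2 ξ t) :
    ∀ᶠ s in 𝓝 t, HasDerivAt (fun r => ψ (ξ r)) (fderiv ℝ ψ (ξ s) (deriv ξ s)) s := by
  filter_upwards [hξ.continuousAt.eventually (hψ.eventually (by simp)), hξ.eventually (by simp)]
    with s h1 h2
  exact (h1.differentiableAt two_ne_zero).hasFDerivAt.comp_hasDerivAt s
    (h2.differentiableAt two_ne_zero).hasDerivAt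

lemma hasDerivAt_deriv_comp {ψ : E → F} {ξ : ℝ → E} {t : ℝ} (hψ : ContDiffAt ℝ 2 ψ (ξ t))
    (hξ : ContDiffAt ℝ 2 ξ t) :
    HasDerivAt (deriv fun r => ψ (ξ r)) (fderiv ℝ (fderiv ℝ ψ) (ξ t) (deriv ξ t) (deriv ξ t) +
      fderiv ℝ ψ (ξ t) (deriv (deriv ξ) t)) t := by
  have h1 : HasDerivAt (fun s => fderiv ℝ ψ (ξ s)) _ t :=
    ((hψ.fderiv_right (m := 1) (by norm_num)).differentiableAt
      one_ne_zero).hasFDerivAt.comp_hasDerivAt t (hξ.differentiableAt two_ne_zero).hasDerivAt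
  have h2 : HasDerivAt (deriv ξ) (deriv (deriv ξ) t) t := by
    have h3 : deriv ξ = fun s => fderiv ℝ ξ s 1 := funext fun s => fderiv_apply_one_eq_deriv.symm
    have h4 : ContDiffAt ℝ 1 (deriv ξ) t := by
      rw [h3]
      exact (hξ.fderiv_right (m := 1) (by norm_num)).clm_apply contDiffAt_const
    exact (h4.differentiableAt one_ne_zero).hasDerivAt
  refine (h1.clm_apply h2).congr_of_eventuallyEq ?_
  filter_upwards [eventually_hasDerivAt_comp hψ hξ] with s hs
  exact hs.deriv

end SecondDerivative

variable {P y : M}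

lemma contMDiffAt_extChartAt_fun (hy : y ∈ (chartAt (EuclideanSpace ℝ (Fin m)) P).source) :
    ContMDiffAt (𝓡 m) 𝓘(ℝ, EuclideanSpace ℝ (Fin m)) ∞ (fun z => extChartAt (𝓡 m) P z) y :=
  contMDiffAt_extChartAt' hy

lemma contDiffAt_coord_curve {γ : ℝ → M} {t : ℝ} {n : ℕ∞ω} (hn : n ≤ ∞)
    (hγ : ContMDiffAt 𝓘(ℝ, ℝ) (𝓡 m) n γ t)
    (hy : γ t ∈ (chartAt (EuclideanSpace ℝ (Fin m)) P).source) :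
    ContDiffAt ℝ n (fun s => extChartAt (𝓡 m) P (γ s)) t :=
  contMDiffAt_iff_contDiffAt.1 (((contMDiffAt_extChartAt_fun hy).of_le hn).comp t hγ)

lemma coordVec_velocity {γ : ℝ → M} {t : ℝ} (hγ : MDifferentiableAt 𝓘(ℝ, ℝ) (𝓡 m) γ t)
    (hy : γ t ∈ (chartAt (EuclideanSpace ℝ (Fin m)) P).source) :
    coordVec P (γ t) (velocity (m := m) γ t) = deriv (fun s => extChartAt (𝓡 m) P (γ s)) t := by
  have h := mfderiv_comp t (mdifferentiableAt_extChartAt (I := 𝓡 m) hy) hγ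
  unfold coordVec velocity
  rw [TangentBundle.continuousLinearMapAt_trivializationAt hy, ← fderiv_apply_one_eq_deriv]
  rw [mfderiv_eq_fderiv] at h
  exact (congrArg (fun L : ℝ →L[ℝ] EuclideanSpace ℝ (Fin m) => L 1) h).symm

lemma localRep_extChartAt (hy : y ∈ (chartAt (EuclideanSpace ℝ (Fin m)) P).source) :
    localRep P (fun z => extChartAt (𝓡 m) P z) =ᶠ[𝓝 (extChartAt (𝓡 m) P y)] id := by
  filter_upwards [extChartAt_target_mem hy] with x hx
  exact (extChartAt (𝓡 m) P).right_inv hx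

lemma fderiv_transition (hy : y ∈ (chartAt (EuclideanSpace ℝ (Fin m)) P).source)
    (w : TangentSpace (𝓡 m) y) : fderiv ℝ (localRep y fun z => extChartAt (𝓡 m) P z)
      (extChartAt (𝓡 m) y y) (tangentCoords w) = coordVec P y w := by
  have hd := (contMDiffAt_extChartAt_fun hy).mdifferentiableAt (by simp)
  have h1 := mvfderiv_eq_coord hy hd w
  have h2 := mvfderiv_eq_coord (mem_chart_source _ y) hd w
  rw [(localRep_extChartAt hy).fderiv_eq, fderiv_id] at h1
  rw [coordVec_self] at h2
  exact h2.symm.trans h1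

/-- `coordField v` is constant in the chart at `y`, so its components in the chart at `P` vary by
the second derivative of the transition map. To see this, the second derivative of the chart at `P`
along the fields is computed in both charts. -/
lemma fderiv_coordRep_coordField (hy : y ∈ (chartAt (EuclideanSpace ℝ (Fin m)) P).source)
    (v w : TangentSpace (𝓡 m) y) :
    fderiv ℝ (coordRep P (coordField v)) (extChartAt (𝓡 m) P y) (coordVec P y w) =
      fderiv ℝ (fderiv ℝ (localRep y fun z => extChartAt (𝓡 m) P z)) (extChartAt (𝓡 m) y y)
        (tangentCoords w) (tangentCoords v) := by
  have hyy := mem_chart_source (EuclideanSpace ℝ (Fin m)) y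
  have hf := (contMDiffAt_extChartAt_fun (P := P) hy).of_le two_le_infty
  have hV : MDifferentiableAt (𝓡 m) (𝓡 m).tangent
      (fun x => (⟨x, coordField v x⟩ : TangentBundle (𝓡 m) M)) y :=
    FiberBundle.mdifferentiableAt_extend (𝓡 m) (EuclideanSpace ℝ (Fin m)) v
  have hV' : coordField v y = v := FiberBundle.extend_apply_self _ v
  have h1 := mvfderiv_mvfderiv_eq_coord hy hf hV w
  have h2 := mvfderiv_mvfderiv_eq_coord hyy hf hV w
  have h3 : coordRep y (coordField v) =ᶠ[𝓝 (extChartAt (𝓡 m) y y)] fun _ => tangentCoords v :=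
    (coordRep_congr hyy (by
      filter_upwards [(chartAt (EuclideanSpace ℝ (Fin m)) y).open_source.mem_nhds hyy] with z hz
      exact coordField_eq_frameField v hz)).trans (coordRep_frameField hyy _)
  have h4 : fderiv ℝ (localRep P fun z => extChartAt (𝓡 m) P z) =ᶠ[𝓝 (extChartAt (𝓡 m) P y)]
      fun _ => ContinuousLinearMap.id ℝ (EuclideanSpace ℝ (Fin m)) :=
    (localRep_extChartAt hy).fderiv.trans (Filter.Eventually.of_forall fun x => fderiv_id)
  rw [h4.fderiv_eq, h4.self_of_nhds, fderiv_fun_const] at h1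
  rw [h3.fderiv_eq, fderiv_fun_const, hV', coordVec_self, coordVec_self] at h2
  simp only [Pi.zero_apply, zero_apply, zero_add, ContinuousLinearMap.id_apply] at h1 h2
  exact h1.symm.trans (h2.trans ((congrArg _ (map_zero _)).trans (add_zero _)))

variable {cov : CovariantDerivative (𝓡 m) (EuclideanSpace ℝ (Fin m))
      (TangentSpace (𝓡 m) : M → Type _)}

/-- The covariant acceleration in the preferred chart at any point. -/
lemma coordVec_acceleration {γ : ℝ → M} {t : ℝ} (hγ : ContMDiffAt 𝓘(ℝ, ℝ) (𝓡 m) 2 γ t)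
    (hy : γ t ∈ (chartAt (EuclideanSpace ℝ (Fin m)) P).source) :
    coordVec P (γ t) (acceleration cov.toFun γ t) =
      deriv (deriv fun s => extChartAt (𝓡 m) P (γ s)) t +
      christoffel cov.toFun P (extChartAt (𝓡 m) P (γ t))
        (deriv (fun s => extChartAt (𝓡 m) P (γ s)) t)
        (deriv (fun s => extChartAt (𝓡 m) P (γ s)) t) := by
  set y := γ t with hydef
  have hyy := mem_chart_source (EuclideanSpace ℝ (Fin m)) y
  set v := velocity (m := m) γ t with hv
  set ξ : ℝ → EuclideanSpace ℝ (Fin m) := fun s => extChartAt (𝓡 m) y (γ s) with hξ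
  set ψ := localRep (m := m) y fun z => extChartAt (𝓡 m) P z with hψ
  have hd := hγ.mdifferentiableAt two_ne_zero
  have hξs : ContDiffAt ℝ 2 ξ t := contDiffAt_coord_curve two_le_infty hγ hyy
  have hψs : ContDiffAt ℝ 2 ψ (ξ t) := (contMDiffAt_iff_coord two_le_infty hyy).1
    ((contMDiffAt_extChartAt_fun hy).of_le two_le_infty)
  have hv1 : deriv ξ t = tangentCoords v := by
    rw [← coordVec_velocity hd hyy, coordVec_self]
    rfl
  have hx : (fun s => extChartAt (𝓡 m) P (γ s)) =ᶠ[𝓝 t] fun s => ψ (ξ s) := by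
    filter_upwards [hγ.continuousAt.eventually
      ((chartAt (EuclideanSpace ℝ (Fin m)) y).open_source.mem_nhds hyy)] with s hs
    exact (localRep_apply hs _).symm
  have hV : MDifferentiableAt (𝓡 m) (𝓡 m).tangent
      (fun x => (⟨x, coordField v x⟩ : TangentBundle (𝓡 m) M)) y :=
    FiberBundle.mdifferentiableAt_extend (𝓡 m) (EuclideanSpace ℝ (Fin m)) v
  have hV' : coordField v y = v := FiberBundle.extend_apply_self _ v
  -- Its derivative term is the second derivative of the transition map on the velocity, precisely
  -- what the second derivative of the curve lacks when it is carried from the chart at `γ t` to the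
  -- chart at `P`.
  have hcov := coordVec_cov cov.isCovariantDerivativeOnUniv hy trivial hV v
  rw [fderiv_coordRep_coordField hy, hV', coordVec_velocity hd hy] at hcov
  have hsum : coordVec P y (acceleration cov.toFun γ t) =
      fderiv ℝ ψ (ξ t) (deriv (deriv ξ) t) + coordVec P y (cov.toFun (coordField v) y v) :=
    (map_add (coordVec P y) _ _).trans
      (congrArg (· + _) (fderiv_transition hy (deriv (deriv ξ) t)).symm)
  rw [hsum, hcov, hx.deriv.deriv_eq, (hasDerivAt_deriv_comp hψs hξs).deriv,
    hv1, ← add_assoc]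
  congr 1
  exact add_comm _ _

end

section

/-! ### Reparametrization of curves on the line -/

/-- The flow of a nowhere vanishing function `1 / g` on an interval reaches the whole interval. -/
lemma exists_reparametrization {J : Set ℝ} (hJ : IsOpen J) (hJc : J.OrdConnected) {g : ℝ → ℝ}
    (hg : ContDiffOn ℝ ∞ g J) (hg0 : ∀ t ∈ J, g t ≠ 0) :
    ∃ (J' : Set ℝ) (τ : ℝ → ℝ), IsOpen J' ∧ J'.OrdConnected ∧ ContDiffOn ℝ ∞ τ J' ∧
      τ '' J' = J ∧ ∀ s ∈ J', HasDerivAt τ (g (τ s))⁻¹ s := by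
  rcases J.eq_empty_or_nonempty with rfl | ⟨a, ha⟩
  · exact ⟨∅, id, isOpen_empty, Set.ordConnected_empty, contDiff_id.contDiffOn, by simp, by simp⟩
  -- The reparametrization is the inverse of this primitive, so its derivative is `1 / g`. Rolle's
  -- theorem gives injectivity without reference to the sign of `g`.
  set S : ℝ → ℝ := fun t => ∫ r in a..t, g r with hS
  have hd : ∀ t ∈ J, HasDerivAt S (g t) t := fun t ht =>
    intervalIntegral.integral_hasDerivAt_right
      ((hg.continuousOn.mono (hJc.uIcc_subset ha ht)).intervalIntegrable)
      (hg.continuousOn.stronglyMeasurableAtFilter hJ t ht) (hg.continuousOn.continuousAt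
        (hJ.mem_nhds ht))
  have hSs : ContDiffOn ℝ ∞ S J := by
    rw [contDiffOn_infty_iff_deriv_of_isOpen hJ]
    exact ⟨fun t ht => (hd t ht).differentiableAt.differentiableWithinAt,
      hg.congr fun t ht => (hd t ht).deriv⟩
  have hinj : Set.InjOn S J := by
    have key : ∀ b ∈ J, ∀ c ∈ J, b < c → S b ≠ S c := fun b hb c hc hbc he => by
      have hsub : Set.Icc b c ⊆ J := hJc.out hb hc
      obtain ⟨t, ht, ht0⟩ := exists_hasDerivAt_eq_zero hbc (hSs.continuousOn.mono hsub) he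
        fun t ht => hd t (hsub (Set.Ioo_subset_Icc_self ht))
      exact hg0 t (hsub (Set.Ioo_subset_Icc_self ht)) ht0
    intro b hb c hc he
    rcases lt_trichotomy b c with h | h | h
    · exact absurd he (key b hb c hc h)
    · exact h
    · exact absurd he.symm (key c hc b hb h)
  have hstrict : ∀ t ∈ J, HasStrictDerivAt S (g t) t := fun t ht =>
    (hSs.contDiffAt (hJ.mem_nhds ht)).hasStrictDerivAt' (hd t ht) (by simp)
  have hopen : ∀ V ⊆ J, IsOpen V → IsOpen (S '' V) := fun V hVJ hV => by
    rw [isOpen_iff_mem_nhds]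
    rintro _ ⟨t, ht, rfl⟩
    rw [← (hstrict t (hVJ ht)).map_nhds_eq (hg0 t (hVJ ht))]
    exact Filter.image_mem_map (hV.mem_nhds ht)
  let e : OpenPartialHomeomorph ℝ ℝ :=
    OpenPartialHomeomorph.ofContinuousOpenRestrict (hinj.toPartialEquiv S J) hSs.continuousOn
      (fun V hV => by
        obtain ⟨W, hW, rfl⟩ := isOpen_induced_iff.1 hV
        have := hopen (J ∩ W) Set.inter_subset_left (hJ.inter hW)
        convert this using 1
        ext r
        constructor
        · rintro ⟨⟨t, ht⟩, htW, rfl⟩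
          exact ⟨t, ⟨ht, htW⟩, rfl⟩
        · rintro ⟨t, ⟨ht, htW⟩, rfl⟩
          exact ⟨⟨t, ht⟩, htW, rfl⟩) hJ
  have hmem : ∀ s ∈ S '' J, e.symm s ∈ J := fun s hs => e.map_target hs
  have hder : ∀ s ∈ S '' J, HasDerivAt e.symm (g (e.symm s))⁻¹ s := fun s hs =>
    e.hasDerivAt_symm hs (hg0 _ (hmem s hs)) (hd _ (hmem s hs))
  refine ⟨S '' J, e.symm, hopen J subset_rfl hJ,
    (hJc.isPreconnected.image S hSs.continuousOn).ordConnected, fun s hs => ?_,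
    e.symm.image_source_eq_target, hder⟩
  exact (e.contDiffAt_symm_deriv (hg0 _ (hmem s hs)) hs (hd _ (hmem s hs))
    (hSs.contDiffAt (hJ.mem_nhds (hmem s hs)))).contDiffWithinAt

/-- A curve with velocity in a fixed direction runs in a line. -/
lemma exists_eq_add_smul_of_deriv {E : Type*} [NormedAddCommGroup E] [InnerProductSpace ℝ E]
    {J : Set ℝ} (hJ : IsOpen J) (hJc : J.OrdConnected) {ζ : ℝ → E} {r : ℝ → ℝ} {w : E}
    (hζ : ∀ t ∈ J, HasDerivAt ζ (r t • w) t) {a : ℝ} (ha : a ∈ J) :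
    ∀ t ∈ J, ∃ s : ℝ, ζ t = ζ a + s • w := by
  intro t ht
  -- The component of `ζ` orthogonal to `w` is constant. For `w = 0` the quotient is `0` by
  -- convention and `ζ` itself is constant.
  have hd : ∀ t ∈ J, HasDerivAt (fun t => ζ t - (inner ℝ w (ζ t) / inner ℝ w w) • w) 0 t := by
    intro t ht
    have h1 := (innerSL ℝ w).hasFDerivAt.comp_hasDerivAt t (hζ t ht)
    have h2 := (hζ t ht).sub ((h1.div_const (inner ℝ w w)).smul_const w)
    refine h2.congr_deriv ?_
    rw [innerSL_apply_apply, inner_smul_right]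
    rcases eq_or_ne w 0 with rfl | hw
    · simp
    · rw [mul_div_assoc, div_self (inner_self_ne_zero.2 hw), mul_one, sub_self]
  have hc := hJ.is_const_of_deriv_eq_zero hJc.isPreconnected
    (fun t ht => (hd t ht).differentiableAt.differentiableWithinAt) (fun t ht => (hd t ht).deriv)
    ht ha
  refine ⟨inner ℝ w (ζ t) / inner ℝ w w - inner ℝ w (ζ a) / inner ℝ w w, ?_⟩
  rw [sub_smul, ← sub_eq_iff_eq_add', ← sub_eq_zero]
  rw [← sub_eq_zero] at hc
  rw [← hc]
  abel

/-- Along a curve the Hessian of `h` contributes `-2 (dφ/φ)` times the velocity of `h ∘ x`, besides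
the Christoffel term. The weight `φ ^ 2` is the integrating factor that absorbs it and leaves `dh`
of the covariant acceleration. -/
lemma IsProjectivelyAffineAt.hasDerivAt_sq_smul_deriv {E : Type*} [NormedAddCommGroup E]
    [NormedSpace ℝ E] {A : E → E →L[ℝ] E →L[ℝ] E} {φ : E → ℝ} {h : E → E} {x : ℝ → E} {t : ℝ}
    (H : IsProjectivelyAffineAt A φ h (x t)) (hx : ContDiffAt ℝ 2 x t) :
    HasDerivAt (fun s => φ (x s) ^ 2 • deriv (fun r => h (x r)) s) (φ (x t) ^ 2 •
      fderiv ℝ h (x t) (deriv (deriv x) t + A (x t) (deriv x t) (deriv x t))) t := by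
  have hh := H.contDiffAt.of_le two_le_infty
  have h1 : HasDerivAt (fun s => φ (x s)) _ t :=
    (H.contDiffAt_factor.differentiableAt (by simp)).hasFDerivAt.comp_hasDerivAt t
      (hx.differentiableAt two_ne_zero).hasDerivAt
  refine ((h1.pow 2).smul (hasDerivAt_deriv_comp hh hx)).congr_deriv ?_
  have h2 := H.hessian_eq (deriv x t) (deriv x t)
  rw [(eventually_hasDerivAt_comp hh hx).self_of_nhds.deriv, map_add]
  simp only [Pi.pow_apply, Nat.cast_ofNat, Nat.add_one_sub_one, pow_one]
  linear_combination (norm := module) (φ (x t)) • h2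

end

section

variable {m : ℕ} {M : Type*} [TopologicalSpace M]
  [ChartedSpace (EuclideanSpace ℝ (Fin m)) M] [IsManifold (𝓡 m) ∞ M]

/-! ### Coordinates in which the unparametrized geodesics are straight lines -/

/-- An injective endomorphism of a finite dimensional space as an equivalence. -/
def equivOfInjective {E : Type*} [NormedAddCommGroup E] [NormedSpace ℝ E] [FiniteDimensional ℝ E]
    (L : E →L[ℝ] E) (hL : Function.Injective L) : E ≃L[ℝ] E :=
  (LinearEquiv.ofInjectiveEndo (L : E →ₗ[ℝ] E) hL).toContinuousLinearEquiv

lemma equivOfInjective_coe {E : Type*} [NormedAddCommGroup E] [NormedSpace ℝ E]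
    [FiniteDimensional ℝ E] (L : E →L[ℝ] E) (hL : Function.Injective L) :
    (equivOfInjective L hL : E →L[ℝ] E) = L := by
  ext v
  rfl

/-- `z` is a chart with coordinate functions `r` in which the connection is projectively affine,
with factor `f₀`. -/
structure IsProjectivelyAffineChart (cov : FieldDerivation m M) (P : M) (f₀ : M → ℝ)
    (r : M → EuclideanSpace ℝ (Fin m))
    (z : OpenPartialHomeomorph M (EuclideanSpace ℝ (Fin m))) : Prop where
  mem_maximalAtlas : z ∈ IsManifold.maximalAtlas (𝓡 m) ∞ M
  mem_source : P ∈ z.source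
  mem_chart_source : ∀ q ∈ z.source, q ∈ (chartAt (EuclideanSpace ℝ (Fin m)) P).source
  apply_eq : ∀ q ∈ z.source, z q = r q
  isProjectivelyAffineAt : ∀ q ∈ z.source, IsProjectivelyAffineAt (christoffel cov P)
    (localRep P f₀) (localRep P r) (extChartAt (𝓡 m) P q)

/-- The inverse function theorem for `r`, read in the chart at `P`. -/
lemma exists_isProjectivelyAffineChart {cov : FieldDerivation m M} {P : M} {f₀ : M → ℝ}
    {r : M → EuclideanSpace ℝ (Fin m)}
    (H : ∀ᶠ x in 𝓝 (extChartAt (𝓡 m) P P),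
      IsProjectivelyAffineAt (christoffel cov P) (localRep P f₀) (localRep P r) x) :
    ∃ z, IsProjectivelyAffineChart cov P f₀ r z := by
  have hP := mem_chart_source (EuclideanSpace ℝ (Fin m)) P
  have hder : ∀ {x},
      IsProjectivelyAffineAt (christoffel cov P) (localRep P f₀) (localRep P r) x →
      ∃ L : EuclideanSpace ℝ (Fin m) ≃L[ℝ] EuclideanSpace ℝ (Fin m),
        HasFDerivAt (localRep P r) (L : EuclideanSpace ℝ (Fin m) →L[ℝ] _) x := fun {x} hx => by
    refine ⟨equivOfInjective _ hx.injective, ?_⟩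
    rw [equivOfInjective_coe]
    exact (hx.contDiffAt.differentiableAt (by simp)).hasFDerivAt
  obtain ⟨W, hW, hWo, hPW⟩ := eventually_nhds_iff.1 H
  obtain ⟨L, hL⟩ := hder (hW _ hPW)
  -- Restricted to `W`, where the derivative is invertible at every point, so that the inverse is
  -- smooth on the whole target and not only at one point.
  let e := ((hW _ hPW).contDiffAt.toOpenPartialHomeomorph (localRep P r) hL
    (by simp)).restrOpen W hWo
  let z := (chartAt (EuclideanSpace ℝ (Fin m)) P).trans e
  have hsrc : ∀ q ∈ z.source, q ∈ (chartAt (EuclideanSpace ℝ (Fin m)) P).source ∧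
      extChartAt (𝓡 m) P q ∈ W := fun q hq => by
    rw [OpenPartialHomeomorph.trans_source] at hq
    exact ⟨hq.1, hq.2.2⟩
  have hz : ∀ q ∈ z.source, z q = r q := fun q hq => localRep_apply (hsrc q hq).1 r
  refine ⟨z, z.mem_maximalAtlas_of_contMDiffOn (fun q hq => ?_) (fun p hp => ?_), ?_,
    fun q hq => (hsrc q hq).1, hz, fun q hq => hW _ (hsrc q hq).2⟩
  · refine ContMDiffAt.contMDiffWithinAt ?_
    refine ((contMDiffAt_iff_coord le_rfl (hsrc q hq).1).2
      (hW _ (hsrc q hq).2).contDiffAt).congr_of_eventuallyEq ?_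
    filter_upwards [z.open_source.mem_nhds hq] with q' hq' using hz q' hq'
  · refine ContMDiffAt.contMDiffWithinAt ?_
    rw [OpenPartialHomeomorph.trans_target] at hp
    have hxW := e.map_target hp.1
    obtain ⟨L', hL'⟩ := hder (hW _ hxW.2)
    have h1 : ContDiffAt ℝ ∞ e.symm p := e.contDiffAt_symm hp.1 hL' (hW _ hxW.2).contDiffAt
    have h2 : ContMDiffAt (𝓡 m) (𝓡 m) ∞ (chartAt (EuclideanSpace ℝ (Fin m)) P).symm (e.symm p) :=
      contMDiffAt_symm_of_mem_maximalAtlas (IsManifold.chart_mem_maximalAtlas P) hp.2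
    exact h2.comp p h1.contMDiffAt
  · rw [OpenPartialHomeomorph.trans_source]
    exact ⟨hP, (hW _ hPW).contDiffAt.mem_toOpenPartialHomeomorph_source hL (by simp), hPW⟩

namespace IsProjectivelyAffineChart

variable {P : M} {cov : CovariantDerivative (𝓡 m) (EuclideanSpace ℝ (Fin m))
      (TangentSpace (𝓡 m) : M → Type _)} {f₀ : M → ℝ} {r : M → EuclideanSpace ℝ (Fin m)}
  {z : OpenPartialHomeomorph M (EuclideanSpace ℝ (Fin m))} {γ : ℝ → M} {t : ℝ}

lemma eventually_apply_curve (Z : IsProjectivelyAffineChart cov.toFun P f₀ r z)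
    (hγ : ContinuousAt γ t) (ht : γ t ∈ z.source) :
    (fun s => z (γ s)) =ᶠ[𝓝 t] (fun s => localRep P r (extChartAt (𝓡 m) P (γ s))) ∧
    (fun s => f₀ (γ s)) =ᶠ[𝓝 t] (fun s => localRep P f₀ (extChartAt (𝓡 m) P (γ s))) := by
  constructor <;>
  · filter_upwards [hγ.eventually (z.open_source.mem_nhds ht)] with s hs
    rw [localRep_apply (Z.mem_chart_source _ hs)]
    try exact Z.apply_eq _ hs

lemma hasDerivAt_curve (Z : IsProjectivelyAffineChart cov.toFun P f₀ r z)
    (hγ : ContMDiffAt 𝓘(ℝ, ℝ) (𝓡 m) 2 γ t) (ht : γ t ∈ z.source) :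
    HasDerivAt (fun s => z (γ s)) (fderiv ℝ (localRep P r) (extChartAt (𝓡 m) P (γ t))
      (coordVec P (γ t) (velocity (m := m) γ t))) t := by
  have hy := Z.mem_chart_source _ ht
  have hx := contDiffAt_coord_curve two_le_infty hγ hy
  rw [coordVec_velocity (hγ.mdifferentiableAt two_ne_zero) hy]
  exact (eventually_hasDerivAt_comp ((Z.isProjectivelyAffineAt _ ht).contDiffAt.of_le two_le_infty)
    hx).self_of_nhds.congr_of_eventuallyEq (Z.eventually_apply_curve hγ.continuousAt ht).1

lemma deriv_curve_ne_zero (Z : IsProjectivelyAffineChart cov.toFun P f₀ r z)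
    (hγ : ContMDiffAt 𝓘(ℝ, ℝ) (𝓡 m) 2 γ t) (ht : γ t ∈ z.source)
    (hv : velocity (m := m) γ t ≠ 0) : deriv (fun s => z (γ s)) t ≠ 0 := by
  rw [(Z.hasDerivAt_curve hγ ht).deriv]
  intro h0
  refine hv (coordVec_injective (Z.mem_chart_source _ ht)
    ((Z.isProjectivelyAffineAt _ ht).injective ?_))
  rw [h0, map_zero, map_zero]

lemma hasDerivAt_sq_smul_deriv (Z : IsProjectivelyAffineChart cov.toFun P f₀ r z)
    (hγ : ContMDiffAt 𝓘(ℝ, ℝ) (𝓡 m) 2 γ t) (ht : γ t ∈ z.source) :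
    HasDerivAt (fun s => f₀ (γ s) ^ 2 • deriv (fun r => z (γ r)) s)
      (f₀ (γ t) ^ 2 • fderiv ℝ (localRep P r) (extChartAt (𝓡 m) P (γ t))
        (coordVec P (γ t) (acceleration cov.toFun γ t))) t := by
  have hy := Z.mem_chart_source _ ht
  have hx := contDiffAt_coord_curve two_le_infty hγ hy
  obtain ⟨h1, h2⟩ := Z.eventually_apply_curve hγ.continuousAt ht
  rw [coordVec_acceleration hγ hy, show f₀ (γ t) = _ from h2.self_of_nhds]
  refine ((Z.isProjectivelyAffineAt _ ht).hasDerivAt_sq_smul_deriv hx).congr_of_eventuallyEq ?_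
  filter_upwards [h1.deriv, h2] with s hs1 hs2
  rw [hs1, hs2]

lemma factor_ne_zero (Z : IsProjectivelyAffineChart cov.toFun P f₀ r z) {q : M}
    (hq : q ∈ z.source) : f₀ q ≠ 0 := by
  have h := (Z.isProjectivelyAffineAt q hq).ne_zero
  rwa [localRep_apply (Z.mem_chart_source q hq)] at h

/-- A geodesic in the chart is a curve whose weighted velocity `f₀ ^ 2 • (z ∘ γ)'` has zero
derivative, since `dr` is injective and `f₀` does not vanish. -/
lemma acceleration_eq_zero_iff (Z : IsProjectivelyAffineChart cov.toFun P f₀ r z)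
    (hγ : ContMDiffAt 𝓘(ℝ, ℝ) (𝓡 m) 2 γ t) (ht : γ t ∈ z.source) :
    acceleration cov.toFun γ t = 0 ↔
      deriv (fun s => f₀ (γ s) ^ 2 • deriv (fun r => z (γ r)) s) t = 0 := by
  rw [(Z.hasDerivAt_sq_smul_deriv hγ ht).deriv,
    smul_eq_zero_iff_right (pow_ne_zero 2 (Z.factor_ne_zero ht))]
  constructor
  · intro h
    rw [h]
    exact (congrArg _ (map_zero (coordVec P (γ t)))).trans (map_zero _)
  · intro h
    refine coordVec_injective (Z.mem_chart_source _ ht)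
      ((Z.isProjectivelyAffineAt _ ht).injective (h.trans ?_))
    exact ((congrArg _ (map_zero (coordVec P (γ t)))).trans (map_zero _)).symm

lemma isInLine_of_isUnparametrizedGeodesicOn
    (Z : IsProjectivelyAffineChart cov.toFun P f₀ r z) (hm : m ≠ 0) {J : Set ℝ} {c : ℝ → M}
    (hcJ : Set.MapsTo c J z.source) (h : IsUnparametrizedGeodesicOn cov.toFun c J) :
    IsInLine (z '' (c '' J)) := by
  obtain ⟨v₀, hv₀⟩ : ∃ v : EuclideanSpace ℝ (Fin m), v ≠ 0 := by
    have : Nonempty (Fin m) := Fin.pos_iff_nonempty.1 (Nat.pos_of_ne_zero hm)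
    exact exists_ne 0
  obtain ⟨J', τ, hJ'o, hJ'c, hτ, hτ0, hτJ, hgs, hga⟩ := h
  rcases J'.eq_empty_or_nonempty with rfl | ⟨a, ha⟩
  · refine ⟨0, v₀, hv₀, ?_⟩
    rw [← hτJ]
    simp
  have hmem : ∀ s ∈ J', (c ∘ τ) s ∈ z.source := fun s hs => hcJ (hτJ ▸ Set.mem_image_of_mem τ hs)
  have hsm : ∀ s ∈ J', ContMDiffAt 𝓘(ℝ, ℝ) (𝓡 m) 2 (c ∘ τ) s := fun s hs =>
    (hgs.contMDiffAt (hJ'o.mem_nhds hs)).of_le two_le_infty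
  -- The weighted velocity is a constant `w`, so the image moves in the fixed direction `w`. If `w =
  -- 0` the image is a point, and `v₀` provides the direction of a line through it.
  obtain ⟨w, hw⟩ := hJ'o.exists_is_const_of_deriv_eq_zero hJ'c.isPreconnected
    (fun s hs => (Z.hasDerivAt_sq_smul_deriv (hsm s hs)
      (hmem s hs)).differentiableAt.differentiableWithinAt)
    (fun s hs => (Z.acceleration_eq_zero_iff (hsm s hs) (hmem s hs)).1 (hga s hs))
  have hd : ∀ s ∈ J', HasDerivAt (fun s => z ((c ∘ τ) s)) ((f₀ ((c ∘ τ) s) ^ 2)⁻¹ • w) s := by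
    intro s hs
    rw [← hw s hs, inv_smul_smul₀ (pow_ne_zero 2 (Z.factor_ne_zero (hmem s hs)))]
    exact (Z.hasDerivAt_curve (hsm s hs) (hmem s hs)).differentiableAt.hasDerivAt
  have hline := exists_eq_add_smul_of_deriv hJ'o hJ'c hd ha
  refine ⟨z ((c ∘ τ) a), if w = 0 then v₀ else w, by split_ifs <;> assumption, ?_⟩
  rw [← hτJ]
  rintro _ ⟨_, ⟨_, ⟨s, hs, rfl⟩, rfl⟩, rfl⟩
  obtain ⟨l, hl⟩ := hline s hs
  split_ifs with h0
  · exact ⟨0, by rw [zero_smul]; rw [h0, smul_zero] at hl; exact hl⟩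
  · exact ⟨l, hl⟩

lemma isUnparametrizedGeodesicOn_of_isInLine
    (Z : IsProjectivelyAffineChart cov.toFun P f₀ r z) {J : Set ℝ} {c : ℝ → M} (hJ : IsOpen J)
    (hJc : J.OrdConnected) (hc : IsRegularCurveOn m c J) (hcJ : Set.MapsTo c J z.source)
    (h : IsInLine (z '' (c '' J))) : IsUnparametrizedGeodesicOn cov.toFun c J := by
  obtain ⟨p, v, hv, hpv⟩ := h
  have hcs : ∀ t ∈ J, ContMDiffAt 𝓘(ℝ, ℝ) (𝓡 m) ∞ c t := fun t ht =>
    hc.1.contMDiffAt (hJ.mem_nhds ht)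
  have hvv : inner ℝ v v ≠ (0 : ℝ) := inner_self_ne_zero.2 hv
  -- The parameter along the line, written as an inner product so that it is visibly smooth.
  -- Regularity of `c` makes its derivative nonzero.
  let σ : ℝ → ℝ := fun t => inner ℝ v (z (c t) - p) / inner ℝ v v
  have hσ : ∀ t ∈ J, z (c t) = p + σ t • v := fun t ht => by
    obtain ⟨s, hs⟩ := hpv _ ⟨_, ⟨t, ht, rfl⟩, rfl⟩
    simp only [σ]
    rw [hs, add_sub_cancel_left, inner_smul_right, mul_div_assoc, div_self hvv, mul_one]
  have hζs : ContDiffOn ℝ ∞ (fun t => z (c t)) J := fun t ht => by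
    have h1 := contMDiffAt_of_mem_maximalAtlas Z.mem_maximalAtlas (hcJ ht)
    exact (contMDiffAt_iff_contDiffAt.1 (h1.comp t (hcs t ht))).contDiffWithinAt
  have hσs : ContDiffOn ℝ ∞ σ J :=
    (contDiffOn_const.inner ℝ (hζs.sub contDiffOn_const)).div_const _
  have hσd : ∀ t ∈ J, HasDerivAt σ (deriv σ t) t := fun t ht =>
    ((hσs.contDiffAt (hJ.mem_nhds ht)).differentiableAt (by simp)).hasDerivAt
  have hζd : ∀ t ∈ J, HasDerivAt (fun t => z (c t)) (deriv σ t • v) t := fun t ht => by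
    refine (((hσd t ht).smul_const v).const_add p).congr_of_eventuallyEq ?_
    filter_upwards [hJ.mem_nhds ht] with s hs using hσ s hs
  have hσ0 : ∀ t ∈ J, deriv σ t ≠ 0 := fun t ht h0 => by
    refine Z.deriv_curve_ne_zero ((hcs t ht).of_le two_le_infty) (hcJ ht) (hc.2 t ht) ?_
    rw [(hζd t ht).deriv, h0, zero_smul]
  have hf₀ : ContDiffOn ℝ ∞ (fun t => f₀ (c t)) J := fun t ht => by
    have h1 := (Z.isProjectivelyAffineAt _ (hcJ ht)).contDiffAt_factor
    rw [← contMDiffAt_iff_coord le_rfl (Z.mem_chart_source _ (hcJ ht))] at h1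
    exact (contMDiffAt_iff_contDiffAt.1 (h1.comp t (hcs t ht))).contDiffWithinAt
  have hf0 : ∀ t ∈ J, f₀ (c t) ≠ 0 := fun t ht => Z.factor_ne_zero (hcJ ht)
  -- With `τ' = 1 / (f₀² σ')` the weighted velocity of `z ∘ c ∘ τ` is the constant `v`, so `c ∘ τ`
  -- is a geodesic.
  obtain ⟨J', τ, hJ'o, hJ'c, hτs, hτJ, hτd⟩ := exists_reparametrization hJ hJc
    (g := fun t => f₀ (c t) ^ 2 * deriv σ t)
    ((hf₀.pow 2).mul ((contDiffOn_infty_iff_deriv_of_isOpen hJ).1 hσs).2)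
    (fun t ht => mul_ne_zero (pow_ne_zero 2 (hf0 t ht)) (hσ0 t ht))
  have hmem : ∀ s ∈ J', τ s ∈ J := fun s hs => hτJ ▸ Set.mem_image_of_mem τ hs
  have hsm : ContMDiffOn 𝓘(ℝ, ℝ) (𝓡 m) ∞ (c ∘ τ) J' := hc.1.comp hτs.contMDiffOn hmem
  refine ⟨J', τ, hJ'o, hJ'c, hτs, fun s hs => ?_, hτJ, hsm, fun s hs => ?_⟩
  · rw [(hτd s hs).deriv]
    exact inv_ne_zero (mul_ne_zero (pow_ne_zero 2 (hf0 _ (hmem s hs))) (hσ0 _ (hmem s hs)))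
  · rw [Z.acceleration_eq_zero_iff ((hsm.contMDiffAt (hJ'o.mem_nhds hs)).of_le two_le_infty)
      (hcJ (hmem s hs))]
    have hconst : (fun s => f₀ ((c ∘ τ) s) ^ 2 • deriv (fun r => z ((c ∘ τ) r)) s) =ᶠ[𝓝 s]
        fun _ => v := by
      filter_upwards [hJ'o.mem_nhds hs] with s hs
      have h1 : HasDerivAt (fun r => z ((c ∘ τ) r)) _ s :=
        (hζd _ (hmem s hs)).scomp s (hτd s hs)
      rw [h1.deriv, smul_smul, smul_smul, Function.comp_apply, mul_right_comm,
        mul_inv_cancel₀ (mul_ne_zero (pow_ne_zero 2 (hf0 _ (hmem s hs))) (hσ0 _ (hmem s hs))),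
        one_smul]
    rw [hconst.deriv_eq, deriv_const]

lemma geodesicsAreStraightLines (Z : IsProjectivelyAffineChart cov.toFun P f₀ r z) (hm : m ≠ 0) :
    GeodesicsAreStraightLines cov.toFun z := fun _ _ hJ hJc hc hcJ =>
  ⟨Z.isInLine_of_isUnparametrizedGeodesicOn hm hcJ,
    Z.isUnparametrizedGeodesicOn_of_isInLine hJ hJc hc hcJ⟩

end IsProjectivelyAffineChart

variable {P : M} [T2Space M] {cov : CovariantDerivative (𝓡 m) (EuclideanSpace ℝ (Fin m))
      (TangentSpace (𝓡 m) : M → Type _)}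
    [hsm : CovariantDerivative.ContMDiffCovariantDerivative cov ∞] {μ : ℝ}

/-- The quotients of a normalized basis of germs of solutions are coordinates in which the
unparametrized geodesics are straight lines. -/
lemma exists_isRatioChart_geodesicsAreStraightLines (hm : m ≠ 0)
    (φ : Module.Basis (Fin (m + 1)) ℝ (solutionGerms cov.toFun P μ))
    (hφ : IsNormalizedAt (fun i => (φ i : Filter.Germ (𝓝 P) ℝ))) :
    ∃ z, IsRatioChart (fun i => (φ i : Filter.Germ (𝓝 P) ℝ)) z ∧
      GeodesicsAreStraightLines cov.toFun z := by
  obtain ⟨f, hf, hfφ⟩ := exists_representatives φ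
  obtain ⟨z, Z⟩ := exists_isProjectivelyAffineChart
    ((eventually_isProjectivelyAffineAt φ hφ hf hfφ).mono fun x hx => hx.1)
  refine ⟨z, ⟨Z.mem_maximalAtlas, Z.mem_source, fun i => ?_⟩, Z.geodesicsAreStraightLines hm⟩
  simp only [← hfφ]
  rw [← Filter.Germ.coe_div]
  refine Filter.Germ.coe_eq.2 ?_
  filter_upwards [z.open_source.mem_nhds Z.mem_source] with q hq
  rw [Z.apply_eq q hq]
  exact (div_eq_inv_mul _ _).symm

end

end AffineGeometry

end

/-! ### Assembly of the four statements -/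

theorem theorem1p5 {m : ℕ} (hm : 2 ≤ m) {M : Type*} [TopologicalSpace M] [T2Space M]
    [SecondCountableTopology M] [ChartedSpace (EuclideanSpace ℝ (Fin m)) M]
    [IsManifold (𝓡 m) ∞ M]
    (cov : CovariantDerivative (𝓡 m) (EuclideanSpace ℝ (Fin m))
      (TangentSpace (𝓡 m) : M → Type _))
    [CovariantDerivative.ContMDiffCovariantDerivative cov ∞]
    (htorsion : cov.torsion = 0) :
    -- (1) pointwise, and globally on a simply connected manifold
    (∀ P : M, AffineGeometry.StronglyProjectivelyFlatAt cov.toFun P ↔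
      Module.finrank ℝ (AffineGeometry.solutionGerms cov.toFun P (-1 / ((m : ℝ) - 1))) = m + 1) ∧
    (SimplyConnectedSpace M →
      (AffineGeometry.StronglyProjectivelyFlat cov.toFun ↔
        Module.finrank ℝ (AffineGeometry.solutionSpace cov.toFun (-1 / ((m : ℝ) - 1))) = m + 1)) ∧
    -- (2) pointwise, and globally on a connected manifold
    (∀ (P : M) (μ : ℝ),
      Module.finrank ℝ (AffineGeometry.solutionGerms cov.toFun P μ) = m + 1 →
      AffineGeometry.StronglyProjectivelyFlatAt cov.toFun P) ∧
    (ConnectedSpace M → ∀ μ : ℝ,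
      Module.finrank ℝ (AffineGeometry.solutionSpace cov.toFun μ) = m + 1 →
      AffineGeometry.StronglyProjectivelyFlat cov.toFun) ∧
    -- (3) pointwise, and globally on a connected manifold
    (∀ (P : M) (μ : ℝ), μ ≠ -1 / ((m : ℝ) - 1) →
      Module.finrank ℝ (AffineGeometry.solutionGerms cov.toFun P μ) = m + 1 →
      ∀ᶠ x in 𝓝 P, ∀ u v : TangentSpace (𝓡 m) x, AffineGeometry.ricci cov.toFun x u v = 0) ∧
    (ConnectedSpace M → ∀ μ : ℝ, μ ≠ -1 / ((m : ℝ) - 1) →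
      Module.finrank ℝ (AffineGeometry.solutionSpace cov.toFun μ) = m + 1 →
      AffineGeometry.RicciFlat cov.toFun) ∧
    -- (4) a normalized basis exists, and every such basis gives coordinates near `P`
    (∀ P : M,
      Module.finrank ℝ (AffineGeometry.solutionGerms cov.toFun P (-1 / ((m : ℝ) - 1))) = m + 1 →
      (∃ φ : Module.Basis (Fin (m + 1)) ℝ
          (AffineGeometry.solutionGerms cov.toFun P (-1 / ((m : ℝ) - 1))),
        AffineGeometry.IsNormalizedAt (fun i => (φ i : Filter.Germ (𝓝 P) ℝ))) ∧
      (∀ φ : Module.Basis (Fin (m + 1)) ℝ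
          (AffineGeometry.solutionGerms cov.toFun P (-1 / ((m : ℝ) - 1))),
        AffineGeometry.IsNormalizedAt (fun i => (φ i : Filter.Germ (𝓝 P) ℝ)) →
        ∃ z : OpenPartialHomeomorph M (EuclideanSpace ℝ (Fin m)),
          AffineGeometry.IsRatioChart (fun i => (φ i : Filter.Germ (𝓝 P) ℝ)) z ∧
          AffineGeometry.GeodesicsAreStraightLines cov.toFun z)) := by
  refine ⟨fun P => ⟨fun h => AffineGeometry.finrank_of_stronglyProjectivelyFlatAt hm htorsion h,
      fun h => AffineGeometry.stronglyProjectivelyFlatAt_of_finrank h⟩,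
    fun _ => ⟨fun h => AffineGeometry.finrank_solutionSpace fun P =>
        AffineGeometry.finrank_of_stronglyProjectivelyFlatAt hm htorsion (h P),
      fun h P => AffineGeometry.stronglyProjectivelyFlatAt_of_finrank
        (AffineGeometry.finrank_solutionGerms_of_global h P)⟩,
    fun P μ h => AffineGeometry.stronglyProjectivelyFlatAt_of_finrank h,
    fun _ μ h P => AffineGeometry.stronglyProjectivelyFlatAt_of_finrank
      (AffineGeometry.finrank_solutionGerms_of_global h P),
    fun P μ hμ h => AffineGeometry.eventually_ricci_eq_zero hm hμ h,
    fun _ μ hμ h P => (AffineGeometry.eventually_ricci_eq_zero hm hμ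
      (AffineGeometry.finrank_solutionGerms_of_global h P)).self_of_nhds,
    fun P h => ⟨AffineGeometry.exists_normalized_basis h, fun φ hφ =>
      AffineGeometry.exists_isRatioChart_geodesicsAreStraightLines (by omega) φ hφ⟩⟩
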